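/- Let $d\ge 1$ and let $m$ be a complex measure on the Borel sets of $\mathbb{R}^d$ with $\int_{\mathbb{R}^d} e^{C|\alpha|}\,d|m|(\alpha)<\infty$ for all $C>0$, and put $V(x)=\int_{\mathbb{R}^d} e^{\alpha\cdot x}\,dm(\alpha)$. Let $g\in\mathbb{C}$, $t_0\in\mathbb{R}$ and let $\theta\in\mathcal{S}(\mathbb{R},\mathbb{C}^d)$ be a Schwartz function. Write $z\cdot w=\sum_i z_iw_i$ for the bilinear product on $\mathbb{C}^d$, and $z^2=z\cdot z$. For $x,x_0\in\mathbb{R}^d$ and $t>t_0$ define $$K^{(\theta)}(x,t\mid x_0,t_0)=\sum_{n=0}^\infty\frac{(-ig)^n}{n!}\,(2\pi i(t-t_0))^{-d/2}\int_{[t_0,t]^n}\int_{\mathbb{R}^{dn}}\exp\Big\{-\frac i2\int_{t_0}^t\Big(\theta(s)+i\sum_{j=1}^n\alpha_j\mathbf 1_{(\tau_j,t]}(s)\Big)^2ds\Big\}$$ $$\times\exp\Big\{-\frac1{2i(t-t_0)}\Big[\int_{t_0}^t\theta(s)\,ds+i\sum_{j=1}^n\alpha_j(t-\tau_j)+(x-x_0)\Big]^2\Big\}\exp\Big(\sum_{j=1}^n\alpha_j\cdot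 x\Big)\,e^{\,ix_0\cdot\theta(t_0)-ix\cdot\theta(t)}\prod_{j=1}^n dm(\alpha_j)\,d^n\tau ,$$ with the principal value of the power $(2\pi i(t-t_0))^{-d/2}$. Then: 1. For all $x,x_0\in\mathbb{R}^d$ and $t>t_0$, all these integrals and the series converge absolutely. 2. For all $x,x_0\in\mathbb{R}^d$ and $t>t_0$, the function $K^{(\theta)}$ is differentiable in $t$ and of class $C^2$ in $x$, and it satisfies pointwise the Schrödinger equation $$\Big(i\frac{\partial}{\partial t}+\frac12\Delta_x-gV(x)-x\cdot\dot\theta(t)\Big)K^{(\theta)}(x,t\mid x_0,t_0)=0 .$$ 3. $\lim_{t\searrow t_0}K^{(\theta)}(x,t\mid x_0,t_0)=\delta(x-x_0)$ in the sense of distributions on $\mathbb{R}^d$, both in the variable $x$ for every fixed $x_0$ and in the variable $x_0$ for every fixed $x$. That is, for $t>t_0$ the function $K^{(\theta)}$ is locally integrable in the respective variable, and for every $\varphi\in C_c^\infty(\mathbb{R}^d)$, as $t\searrow t_0$, $\int K^{(\theta)}(x,t\mid x_0,t_0)\varphi(x)\,dx\to\varphi(x_0)$ for every $x_0$ and $\int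 K^{(\theta)}(x,t\mid x_0,t_0)\varphi(x_0)\,dx_0\to\varphi(x)$ for every $x$. -/

import Mathlib

open MeasureTheory Filter Topology
open scoped ContDiff SchwartzMap Laplacian

noncomputable section

namespace FeynmanPropagator

/-- Configuration space `ℝᵈ` with its Euclidean structure. -/
abbrev Space (d : ℕ) : Type := EuclideanSpace ℝ (Fin d)

/-- Its complexification `ℂᵈ`. -/
abbrev CSpace (d : ℕ) : Type := EuclideanSpace ℂ (Fin d)

/-- The inclusion `ℝᵈ ⊆ ℂᵈ`. -/
def toC {d : ℕ} (x : Space d) : CSpace d := WithLp.toLp 2 fun i => (x i : ℂ)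

/-- The complex **bilinear** (not sesquilinear) extension `z · w = ∑ zᵢ wᵢ` of the scalar product
of `ℝᵈ`. -/
def cdot {d : ℕ} (z w : CSpace d) : ℂ := ∑ i, z i * w i

/-- The integral `∫ f dm` of a complex function against a complex measure. -/
abbrev cintegral {X : Type*} [MeasurableSpace X] (m : ComplexMeasure X) (f : X → ℂ) : ℂ :=
  m.integral f (ContinuousLinearMap.mul ℝ ℂ)

/-- The `n`-fold product complex measure `m ⊗ ⋯ ⊗ m` on `Xⁿ`, i.e. `∏ⱼ dm(αⱼ)`. -/
def productMeasure {X : Type*} [MeasurableSpace X] (m : ComplexMeasure X) :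
    (n : ℕ) → ComplexMeasure (Fin n → X)
  | 0 => VectorMeasure.dirac (fun j => j.elim0) 1
  | n + 1 =>
      (m.prod (productMeasure m n) (ContinuousLinearMap.mul ℝ ℂ)).map
        (MeasurableEquiv.piFinSuccAbove (fun _ : Fin (n + 1) => X) 0).symm

/-- The moment condition `∫ e^{C|α|} d|m|(α) < ∞` for all `C > 0`, where `|m|` is the total
variation measure of `m`. -/
def ExpMoments {d : ℕ} (m : ComplexMeasure (Space d)) : Prop :=
  ∀ C : ℝ, 0 < C → ∫⁻ α, ENNReal.ofReal (Real.exp (C * ‖α‖)) ∂m.variation < ⊤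

/-- The potential `V(x) = ∫ e^{α·x} dm(α)`. -/
def potential {d : ℕ} (m : ComplexMeasure (Space d)) (x : Space d) : ℂ :=
  cintegral m fun α => Complex.exp (inner ℝ α x : ℝ)

/-- The shifted test function `θ(s) + i ∑ⱼ αⱼ 1_{(τⱼ, t]}(s)`. -/
def shifted {d n : ℕ} (θ : 𝓢(ℝ, CSpace d)) (t : ℝ) (τ : Fin n → ℝ) (α : Fin n → Space d)
    (s : ℝ) : CSpace d :=
  θ s + Complex.I • ∑ j, (Set.Ioc (τ j) t).indicator (fun _ => toC (α j)) s

/-- The endpoint vector `∫_{t₀}^t θ(s) ds + i ∑ⱼ αⱼ (t - τⱼ) + (x - x₀)`. -/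
def endpoint {d n : ℕ} (θ : 𝓢(ℝ, CSpace d)) (x : Space d) (t : ℝ) (x₀ : Space d) (t₀ : ℝ)
    (τ : Fin n → ℝ) (α : Fin n → Space d) : CSpace d :=
  (∫ s in t₀..t, θ s) + Complex.I • (∑ j, ((t - τ j : ℝ) : ℂ) • toC (α j)) + (toC x - toC x₀)

/-- The integrand of the `n`-th term of the perturbation series. -/
def integrand {d : ℕ} (θ : 𝓢(ℝ, CSpace d)) (x : Space d) (t : ℝ) (x₀ : Space d) (t₀ : ℝ)
    (n : ℕ) (τ : Fin n → ℝ) (α : Fin n → Space d) : ℂ :=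
  Complex.exp (-(Complex.I / 2) *
      ∫ s in t₀..t, cdot (shifted θ t τ α s) (shifted θ t τ α s)) *
    Complex.exp (-(1 / (2 * Complex.I * ((t - t₀ : ℝ) : ℂ))) *
      cdot (endpoint θ x t x₀ t₀ τ α) (endpoint θ x t x₀ t₀ τ α)) *
    Complex.exp (∑ j, (inner ℝ (α j) x : ℝ)) *
    Complex.exp (Complex.I * cdot (toC x₀) (θ t₀) - Complex.I * cdot (toC x) (θ t))

/-- The `n`-th term of the perturbation series, including its power of the coupling constant `g`.
The power `(2πi(t - t₀))^{-d/2}` is the principal one. -/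
def term {d : ℕ} (m : ComplexMeasure (Space d)) (g : ℂ) (θ : 𝓢(ℝ, CSpace d))
    (x : Space d) (t : ℝ) (x₀ : Space d) (t₀ : ℝ) (n : ℕ) : ℂ :=
  (-Complex.I * g) ^ n / (n.factorial : ℂ) *
    (2 * (Real.pi : ℂ) * Complex.I * ((t - t₀ : ℝ) : ℂ)) ^ (-(d : ℂ) / 2) *
    ∫ τ in Set.Icc (fun _ : Fin n => t₀) (fun _ : Fin n => t),
      cintegral (productMeasure m n) (integrand θ x t x₀ t₀ n τ)

/-- The propagator `K^{(θ)}(x, t | x₀, t₀)`. -/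
def propagator {d : ℕ} (m : ComplexMeasure (Space d)) (g : ℂ) (θ : 𝓢(ℝ, CSpace d))
    (x : Space d) (t : ℝ) (x₀ : Space d) (t₀ : ℝ) : ℂ :=
  ∑' n, term m g θ x t x₀ t₀ n

/-- The integral in the `n`-th term converges absolutely, over `[t₀, t]ⁿ × ℝ^{dn}`. -/
def TermIntegrable {d : ℕ} (m : ComplexMeasure (Space d)) (θ : 𝓢(ℝ, CSpace d))
    (x : Space d) (t : ℝ) (x₀ : Space d) (t₀ : ℝ) (n : ℕ) : Prop :=
  Integrable (fun p : (Fin n → ℝ) × (Fin n → Space d) => integrand θ x t x₀ t₀ n p.1 p.2)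
    ((volume.restrict (Set.Icc (fun _ : Fin n => t₀) (fun _ : Fin n => t))).prod
      (productMeasure m n).variation)

/-- `F t → δ_a` in the sense of distributions on `ℝᵈ` as `t ↓ t₀`, the `F t` being locally
integrable functions for `t > t₀`. -/
def TendstoDelta {d : ℕ} (F : ℝ → Space d → ℂ) (t₀ : ℝ) (a : Space d) : Prop :=
  (∀ t, t₀ < t → LocallyIntegrable (F t) volume) ∧
    ∀ φ : Space d → ℂ, ContDiff ℝ ∞ φ → HasCompactSupport φ →
      Tendsto (fun t => ∫ y, F t y * φ y) (𝓝[>] t₀) (𝓝 (φ a))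

end FeynmanPropagator

end

/-! Write m = h |m| with |h| = 1. Every integral against m or its powers becomes an integral of an
explicit function against a positive measure. The n-th term is then an integral over n points (τ_j,
α_j) of [t₀, t] × ℝ^d with prefactor 1/n!, so the whole series is a single integral over finite
configurations, with respect to the measure Σ νⁿ/n! (`fock`), where ν is Lebesgue measure times |m|.
A multiplicative weight ∏ w(y_j) integrates to exp(∫ w dν) (`integral_weight`), so one-point bounds
control the full series.

Convergence. Carrying out the s-integral gives the integrand as exp(`phase`). The terms of the phase
quadratic in the α_j come from real symmetric forms multiplied by i, hence are purely imaginary. The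
real part is therefore at most linear in Σ (1 + |α_j|), locally uniformly in the other data
(`norm_exp_phase_le`), and the exponential moments of |m| suffice.

Schrödinger equation. Moving t has three effects. The domain grows: singling out the latest point of
a configuration, the boundary contribution is that of a point placed at time t, which multiplies the
integrand by -i g h(α) e^{α·x} (`phase_cons`) and so produces -i g V K. The phase moves: its time
derivative and the square of its x-gradient satisfy an eikonal identity for each configuration
separately (`phaseDeriv_add_slopeX_sq`). The prefactor moves: its derivative cancels the Laplacian
of the quadratic part of the phase. Smoothness in x holds because, up to the free Gaussian, the
phase is affine in x, so K is a Gaussian times a Laplace transform with all exponential moments.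

Initial condition. The same affine structure, in x or in x₀, turns ∫ K φ into an average over
configurations of the free evolution of e^{b·y} φ(y), with b and the remaining weight depending on
the configuration. By Parseval the free evolution is bounded by C e^{C|b|} uniformly in time
(`exists_norm_freeEvolution_le`). As t ↓ t₀ all nonempty configurations together contribute
O(exp(c(t - t₀)) - 1), and for the empty one both b and the offset tend to 0, so Fourier inversion
yields the value of φ. -/

noncomputable section

namespace FeynmanPropagator

/-! ### Polar decomposition of complex measures and of their powers -/

section ComplexMeasures

variable {X : Type*} [MeasurableSpace X]

/-- The real and imaginary parts are signed measures absolutely continuous with respect to μ;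
Radon–Nikodym applies to each, and the two densities are recombined. -/
theorem withDensity_rnDeriv_eq_of_variation_le (m : ComplexMeasure X) (μ : Measure X)
    [IsFiniteMeasure μ] (h : ∀ s, μ s = 0 → m s = 0) :
    μ.withDensityᵥ (m.rnDeriv μ) = m := by
  have hre : μ.withDensityᵥ (m.re.rnDeriv μ) = m.re := by
    rw [← SignedMeasure.absolutelyContinuous_iff_withDensityᵥ_rnDeriv_eq]
    refine VectorMeasure.AbsolutelyContinuous.mk fun s hs h0 => ?_
    rw [Measure.toENNRealVectorMeasure_apply_measurable hs] at h0
    have := h s h0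
    change Complex.re (m s) = 0
    simp [this]
  have him : μ.withDensityᵥ (m.im.rnDeriv μ) = m.im := by
    rw [← SignedMeasure.absolutelyContinuous_iff_withDensityᵥ_rnDeriv_eq]
    refine VectorMeasure.AbsolutelyContinuous.mk fun s hs h0 => ?_
    rw [Measure.toENNRealVectorMeasure_apply_measurable hs] at h0
    have := h s h0
    change Complex.im (m s) = 0
    simp [this]
  ext s hs
  rw [withDensityᵥ_apply (m.integrable_rnDeriv μ) hs]
  apply Complex.ext
  · rw [← RCLike.re_eq_complex_re, ← integral_re (m.integrable_rnDeriv μ).integrableOn,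
      RCLike.re_eq_complex_re]
    have := congrArg (fun v => v s) hre
    rw [withDensityᵥ_apply (SignedMeasure.integrable_rnDeriv _ _) hs] at this
    exact this
  · rw [← RCLike.im_eq_complex_im, ← integral_im (m.integrable_rnDeriv μ).integrableOn,
      RCLike.im_eq_complex_im]
    have := congrArg (fun v => v s) him
    rw [withDensityᵥ_apply (SignedMeasure.integrable_rnDeriv _ _) hs] at this
    exact this

/-- Polar decomposition of a complex measure of finite total variation. -/
theorem exists_polar_decomposition (m : ComplexMeasure X) [IsFiniteMeasure m.variation] :
    ∃ h : X → ℂ, Measurable h ∧ (∀ x, ‖h x‖ = 1) ∧ m = m.variation.withDensityᵥ h := by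
  set μ := m.variation with hμ
  have hac : ∀ s, μ s = 0 → m s = 0 := fun s h0 => by
    have := VectorMeasure.enorm_measure_le_variation m s
    rw [← hμ, h0] at this
    simpa using this
  set k := m.rnDeriv μ with hk
  have hkm : Measurable k := by
    have h1 : Measurable (m.re.rnDeriv μ) := SignedMeasure.measurable_rnDeriv _ _
    have h2 : Measurable (m.im.rnDeriv μ) := SignedMeasure.measurable_rnDeriv _ _
    exact Complex.measurableEquivRealProd.symm.measurable.comp (h1.prodMk h2)
  have hki : Integrable k μ := m.integrable_rnDeriv μ
  have hd : μ.withDensityᵥ k = m := withDensity_rnDeriv_eq_of_variation_le m μ hac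
  -- The variation of k μ is |k| μ; since k μ = m, it is also μ itself. Uniqueness of densities
  -- forces |k| = 1 almost everywhere.
  have hv : μ.withDensity (fun x => ‖k x‖ₑ) = μ.withDensity 1 := by
    rw [← Measure.variation_withDensityᵥ hki, hd, withDensity_one]
  have h1 : (fun x => ‖k x‖ₑ) =ᵐ[μ] 1 :=
    (withDensity_eq_iff_of_sigmaFinite hkm.enorm.aemeasurable measurable_one.aemeasurable).1 hv
  -- Changing k on a null set makes the modulus equal to 1 at every point, which spares later
  -- arguments an almost-everywhere clause.
  refine ⟨fun x => if ‖k x‖ = 1 then k x else 1, ?_, ?_, ?_⟩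
  · exact Measurable.ite (hkm.norm (measurableSet_singleton 1)) hkm measurable_const
  · intro x
    by_cases hx : ‖k x‖ = 1 <;> simp [hx]
  · rw [← WithDensityᵥEq.congr_ae, hd]
    filter_upwards [h1] with x hx
    have : ‖k x‖ = 1 := by simpa [enorm_eq_nnnorm, ← coe_nnnorm] using hx
    simp [this]

theorem variation_withDensityᵥ_of_norm_eq_one {μ : Measure X} [IsFiniteMeasure μ] {h : X → ℂ}
    (hm : Measurable h) (h1 : ∀ x, ‖h x‖ = 1) : (μ.withDensityᵥ h).variation = μ := by
  have hi : Integrable h μ := Integrable.of_bound hm.aestronglyMeasurable 1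
    (Eventually.of_forall fun x => (h1 x).le)
  rw [Measure.variation_withDensityᵥ hi]
  have : (fun x => ‖h x‖ₑ) = 1 := by
    ext x
    rw [← ofReal_norm, h1]
    simp
  rw [this, withDensity_one]

/-- Both sides agree on indicators, are additive, and are continuous on L¹(μ): on the left because
the variation of h μ is μ, on the right because multiplication by h is an isometry of L¹. -/
theorem cintegral_withDensityᵥ {μ : Measure X} [IsFiniteMeasure μ] {h : X → ℂ}
    (hm : Measurable h) (h1 : ∀ x, ‖h x‖ = 1) {F : X → ℂ} (hF : Integrable F μ) :
    cintegral (μ.withDensityᵥ h) F = ∫ x, F x * h x ∂μ := by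
  have hi : Integrable h μ := Integrable.of_bound hm.aestronglyMeasurable 1
    (Eventually.of_forall fun x => (h1 x).le)
  have hv := variation_withDensityᵥ_of_norm_eq_one (μ := μ) hm h1
  have hmul : ∀ {f : X → ℂ}, Integrable f μ → Integrable (fun x => f x * h x) μ := fun hf =>
    hf.mul_bdd (c := 1) hm.aestronglyMeasurable (Eventually.of_forall fun x => (h1 x).le)
  have hfin : IsFiniteMeasure (μ.withDensityᵥ h).variation := by rw [hv]; infer_instance
  refine Integrable.induction (μ := μ)
    (fun F => cintegral (μ.withDensityᵥ h) F = ∫ x, F x * h x ∂μ) ?_ ?_ ?_ ?_ hF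
  · intro c s hs hsm
    change VectorMeasure.integral _ _ _ = _
    rw [VectorMeasure.integral_indicator hs, VectorMeasure.setIntegral_const,
      withDensityᵥ_apply hi hs]
    have : (fun x => s.indicator (fun _ => c) x * h x) = s.indicator (fun x => c * h x) := by
      ext x
      by_cases hx : x ∈ s <;> simp [hx]
    rw [this, integral_indicator hs, integral_const_mul]
    simp
  · intro f g hfg hf hg ihf ihg
    change VectorMeasure.integral _ _ _ = _
    rw [VectorMeasure.integral_add (by simpa [VectorMeasure.Integrable, hv] using hf)
      (by simpa [VectorMeasure.Integrable, hv] using hg)]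
    simp only [Pi.add_apply, add_mul]
    rw [integral_add (hmul hf) (hmul hg), ← ihf, ← ihg]
  · have c1 : Continuous fun f : Lp ℂ 1 μ => cintegral (μ.withDensityᵥ h) f := by
      have := VectorMeasure.continuous_integral (μ := μ.withDensityᵥ h)
        (B := ContinuousLinearMap.mul ℝ ℂ)
      rw [hv] at this
      exact this
    have c2 : Continuous fun f : Lp ℂ 1 μ => ∫ x, f x * h x ∂μ := by
      refine continuous_iff_continuousAt.2 fun f => ?_
      refine tendsto_integral_of_L1' _ (hmul (L1.integrable_coeFn f)).aestronglyMeasurable ?_ ?_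
      · exact Eventually.of_forall fun g => hmul (L1.integrable_coeFn g)
      · have : (fun g : Lp ℂ 1 μ => eLpNorm ((fun x => g x * h x) - fun x => f x * h x) 1 μ)
            = fun g => edist g f := by
          ext g
          rw [Lp.edist_def]
          refine eLpNorm_congr_norm_ae (Eventually.of_forall fun x => ?_)
          simp [← sub_mul, h1]
        rw [this]
        simpa using (tendsto_iff_edist_tendsto_0.1 (tendsto_id (α := Lp ℂ 1 μ) (x := 𝓝 f)))
    exact isClosed_eq c1 c2
  · intro f g hfg hf ih
    rw [← integral_congr_ae (f := fun x => f x * h x) (g := fun x => g x * h x)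
      (hfg.mono fun x hx => by simp only [hx]), ← ih]
    exact VectorMeasure.integral_congr_ae (by rw [hv]; exact hfg.symm)

/-- Induction on the number of factors: a product of vector measures is determined by its values on
rectangles, where Fubini factors the integral of the product density. -/
theorem productMeasure_eq_withDensityᵥ (m : ComplexMeasure X) [IsFiniteMeasure m.variation]
    {h : X → ℂ} (hm : Measurable h) (h1 : ∀ x, ‖h x‖ = 1) (hmh : m = m.variation.withDensityᵥ h)
    (n : ℕ) : productMeasure m n =
      (Measure.pi fun _ : Fin n => m.variation).withDensityᵥ fun α => ∏ j, h (α j) := by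
  have hpm : ∀ n, Measurable fun α : Fin n → X => ∏ j, h (α j) := fun n =>
    Finset.measurable_fun_prod _ fun j _ => hm.comp (measurable_pi_apply j)
  have hp1 : ∀ n, ∀ α : Fin n → X, ‖∏ j, h (α j)‖ = 1 := fun n α => by
    rw [norm_prod]
    exact Finset.prod_eq_one fun j _ => h1 _
  have hpi : ∀ n, Integrable (fun α : Fin n → X => ∏ j, h (α j))
      (Measure.pi fun _ : Fin n => m.variation) := fun n =>
    Integrable.of_bound (hpm n).aestronglyMeasurable 1 (Eventually.of_forall fun x => (hp1 n x).le)
  have hi : Integrable h m.variation := Integrable.of_bound hm.aestronglyMeasurable 1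
    (Eventually.of_forall fun x => (h1 x).le)
  induction n with
  | zero =>
    ext s hs
    rw [withDensityᵥ_apply (hpi 0) hs, productMeasure, Measure.pi_of_empty _ fun j => j.elim0]
    classical
    by_cases hx : (fun j : Fin 0 => (j.elim0 : X)) ∈ s
    · rw [VectorMeasure.dirac_apply_of_mem hs hx, MeasureTheory.restrict_dirac' hs, if_pos hx]
      simp
    · rw [VectorMeasure.dirac_apply_of_notMem hx, MeasureTheory.restrict_dirac' hs, if_neg hx]
      simp
  | succ n ih =>
    ext s hs
    rw [withDensityᵥ_apply (hpi _) hs, productMeasure, ih]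
    set e := MeasurableEquiv.piFinSuccAbove (fun _ : Fin (n + 1) => X) 0
    have hprod : m.prod ((Measure.pi fun _ : Fin n => m.variation).withDensityᵥ
        fun α => ∏ j, h (α j)) (ContinuousLinearMap.mul ℝ ℂ) =
        (m.variation.prod (Measure.pi fun _ : Fin n => m.variation)).withDensityᵥ
          fun p => h p.1 * ∏ j, h (p.2 j) := by
      refine VectorMeasure.prod_eq_of_forall_apply_prod fun s t hs ht => ?_
      rw [withDensityᵥ_apply (hi.mul_prod (hpi n)) (hs.prod ht), withDensityᵥ_apply (hpi n) ht,
        setIntegral_prod_mul (f := h) (g := fun α : Fin n → X => ∏ j, h (α j))]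
      have hms : m s = ∫ x in s, h x ∂m.variation := by
        rw [← withDensityᵥ_apply hi hs, ← hmh]
      rw [hms]
      simp
    rw [hprod, VectorMeasure.map_apply _ e.symm.measurable hs,
      withDensityᵥ_apply (hi.mul_prod (hpi n)) (e.symm.measurable hs)]
    have hmp := (measurePreserving_piFinSuccAbove (fun _ : Fin (n + 1) => m.variation) 0).symm
    rw [← hmp.setIntegral_preimage_emb (MeasurableEquiv.measurableEmbedding _)]
    refine setIntegral_congr_fun (e.symm.measurable hs) fun p _ => ?_
    simp [Fin.prod_univ_succ, MeasurableEquiv.piFinSuccAbove]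

/-- The product density is unimodular, so the variation of the power is the power of the variation.
Absolute convergence of a term is thereby a statement about a positive product measure. -/
theorem variation_productMeasure (m : ComplexMeasure X) [IsFiniteMeasure m.variation] (n : ℕ) :
    (productMeasure m n).variation = Measure.pi fun _ : Fin n => m.variation := by
  obtain ⟨h, hm, h1, hmh⟩ := exists_polar_decomposition m
  rw [productMeasure_eq_withDensityᵥ m hm h1 hmh]
  refine variation_withDensityᵥ_of_norm_eq_one ?_ fun α => ?_
  · exact Finset.measurable_fun_prod _ fun j _ => hm.comp (measurable_pi_apply j)
  · rw [norm_prod]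
    exact Finset.prod_eq_one fun j _ => h1 _

theorem cintegral_productMeasure (m : ComplexMeasure X) [IsFiniteMeasure m.variation]
    {h : X → ℂ} (hm : Measurable h) (h1 : ∀ x, ‖h x‖ = 1) (hmh : m = m.variation.withDensityᵥ h)
    (n : ℕ) {F : (Fin n → X) → ℂ} (hF : Integrable F (Measure.pi fun _ => m.variation)) :
    cintegral (productMeasure m n) F =
      ∫ α, F α * ∏ j, h (α j) ∂(Measure.pi fun _ => m.variation) := by
  rw [productMeasure_eq_withDensityᵥ m hm h1 hmh]
  refine cintegral_withDensityᵥ ?_ (fun α => ?_) hF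
  · exact Finset.measurable_fun_prod _ fun j _ => hm.comp (measurable_pi_apply j)
  · rw [norm_prod]
    exact Finset.prod_eq_one fun j _ => h1 _

end ComplexMeasures

/-! ### The measure on finite configurations -/

section Fock

variable {Y : Type*} [MeasurableSpace Y]

/-- Finite ordered configurations of points of `Y`. -/
abbrev Config (Y : Type*) : Type _ := Σ n : ℕ, Fin n → Y

/-- Adding a point in front of a configuration. -/
def Config.cons {Y : Type*} (y : Y) (c : Config Y) : Config Y :=
  ⟨c.1 + 1, Fin.cons y c.2⟩

/-- The empty configuration. -/
def Config.empty {Y : Type*} : Config Y := ⟨0, fun j => j.elim0⟩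

/-- The measure `∑ₙ λⁿ / n!` on finite configurations. -/
def fock (ν : Measure Y) : Measure (Config Y) :=
  Measure.sum fun n : ℕ => ENNReal.ofReal ((n.factorial : ℝ)⁻¹) •
    (Measure.pi fun _ : Fin n => ν).map (Sigma.mk n)

theorem measurable_sigma_iff {ι : Type*} {β : ι → Type*} [∀ i, MeasurableSpace (β i)]
    {Z : Type*} [MeasurableSpace Z] {f : (Σ i, β i) → Z} :
    Measurable f ↔ ∀ i, Measurable fun z => f ⟨i, z⟩ := by
  constructor
  · intro h i s hs
    exact MeasurableSpace.measurableSet_iInf.1 (h hs) i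
  · intro h s hs
    exact MeasurableSpace.measurableSet_iInf.2 fun i => h i hs

theorem measurable_sigma_mk {ι : Type*} {β : ι → Type*} [∀ i, MeasurableSpace (β i)] (i : ι) :
    Measurable (Sigma.mk i : β i → Σ i, β i) :=
  measurable_sigma_iff.1 measurable_id i

theorem measurableEmbedding_sigma_mk {ι : Type*} {β : ι → Type*} [∀ i, MeasurableSpace (β i)]
    (i : ι) : MeasurableEmbedding (Sigma.mk i : β i → Σ i, β i) where
  injective := sigma_mk_injective
  measurable := measurable_sigma_mk i
  measurableSet_image' s hs := by
    refine MeasurableSpace.measurableSet_iInf.2 fun j => ?_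
    change MeasurableSet (Sigma.mk j ⁻¹' (Sigma.mk i '' s))
    by_cases h : i = j
    · subst h
      rwa [Set.preimage_image_eq _ sigma_mk_injective]
    · convert MeasurableSet.empty
      ext z
      simp [h]

/-- The σ-algebra of a sum type is tested summand by summand, but a product with a sum type is not
itself a sum type. Countability of the index set lets the preimage be written as a countable union
of images under measurable embeddings. -/
theorem measurable_prod_sigma {ι : Type*} [Countable ι] {β : ι → Type*}
    [∀ i, MeasurableSpace (β i)] {W Z : Type*} [MeasurableSpace W] [MeasurableSpace Z]
    {f : W × (Σ i, β i) → Z} (h : ∀ i, Measurable fun p : W × β i => f (p.1, ⟨i, p.2⟩)) :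
    Measurable f := by
  intro s hs
  have : f ⁻¹' s = ⋃ i, Prod.map id (Sigma.mk i) ''
      ((fun p : W × β i => f (p.1, ⟨i, p.2⟩)) ⁻¹' s) := by
    ext ⟨w, i, z⟩
    simp only [Set.mem_preimage, Set.mem_iUnion, Set.mem_image]
    constructor
    · exact fun h => ⟨i, (w, z), h, rfl⟩
    · rintro ⟨j, ⟨w', z'⟩, h, he⟩
      simp only [Prod.map_apply, id_eq] at he
      rw [← he]
      exact h
  rw [this]
  exact MeasurableSet.iUnion fun i =>
    (MeasurableEmbedding.id.prodMap (measurableEmbedding_sigma_mk i)).measurableSet_image.2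
      (h i hs)

theorem measurable_cons : Measurable fun p : Y × Config Y => Config.cons p.1 p.2 := by
  refine measurable_prod_sigma fun n => ?_
  refine (measurable_sigma_mk (β := fun n => Fin n → Y) (n + 1)).comp (measurable_pi_iff.2 fun j => ?_)
  refine Fin.cases ?_ (fun j => ?_) j
  · simpa using measurable_fst
  · simpa using! (measurable_pi_apply j).comp measurable_snd

/-- Integrability on configuration space packages two facts: every term converges absolutely, and
the absolute values are summable after division by n!. -/
theorem integrable_fock_iff {ν : Measure Y} {F : Config Y → ℂ} :
    Integrable F (fock ν) ↔
      (∀ n, Integrable (fun z => F ⟨n, z⟩) (Measure.pi fun _ : Fin n => ν)) ∧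
      Summable fun n : ℕ => (n.factorial : ℝ)⁻¹ *
        ∫ z, ‖F ⟨n, z⟩‖ ∂(Measure.pi fun _ : Fin n => ν) := by
  rw [fock, integrable_sum_measure_iff]
  have hs : ∀ n : ℕ, ∫ c, ‖F c‖ ∂(ENNReal.ofReal ((n.factorial : ℝ)⁻¹) •
      (Measure.pi fun _ : Fin n => ν).map (Sigma.mk n)) = (n.factorial : ℝ)⁻¹ *
        ∫ z, ‖F ⟨n, z⟩‖ ∂(Measure.pi fun _ : Fin n => ν) := fun n => by
    rw [integral_smul_measure, (measurableEmbedding_sigma_mk n).integral_map,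
      ENNReal.toReal_ofReal (by positivity), smul_eq_mul]
  simp_rw [hs]
  refine and_congr (forall_congr' fun n => ?_) Iff.rfl
  rw [integrable_smul_measure (by positivity) (by simp),
    (measurableEmbedding_sigma_mk n).integrable_map_iff]
  rfl

theorem hasSum_integral_fock {ν : Measure Y} {F : Config Y → ℂ} (hF : Integrable F (fock ν)) :
    HasSum (fun n : ℕ => ((n.factorial : ℝ)⁻¹ : ℝ) •
      ∫ z, F ⟨n, z⟩ ∂(Measure.pi fun _ : Fin n => ν)) (∫ c, F c ∂fock ν) := by
  have hs : ∀ n : ℕ, ∫ c, F c ∂(ENNReal.ofReal ((n.factorial : ℝ)⁻¹) •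
      (Measure.pi fun _ : Fin n => ν).map (Sigma.mk n)) = ((n.factorial : ℝ)⁻¹ : ℝ) •
        ∫ z, F ⟨n, z⟩ ∂(Measure.pi fun _ : Fin n => ν) := fun n => by
    rw [integral_smul_measure, (measurableEmbedding_sigma_mk n).integral_map,
      ENNReal.toReal_ofReal (by positivity)]
  simpa only [hs] using! hasSum_integral_measure hF

/-- The multiplicative functional attached to a one-point weight. -/
def weight {Y : Type*} (w : Y → ℝ) (c : Config Y) : ℝ := ∏ j, w (c.2 j)

@[simp] theorem weight_cons {Y : Type*} (w : Y → ℝ) (y : Y) (c : Config Y) :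
    weight w (Config.cons y c) = w y * weight w c := by
  change ∏ j : Fin (c.1 + 1), w ((Fin.cons y c.2 : Fin (c.1 + 1) → Y) j) = _
  simp [Fin.prod_univ_succ, weight]

theorem weight_nonneg {Y : Type*} {w : Y → ℝ} (hw : ∀ y, 0 ≤ w y) (c : Config Y) :
    0 ≤ weight w c := Finset.prod_nonneg fun _ _ => hw _

theorem measurable_weight {w : Y → ℝ} (hw : Measurable w) : Measurable (weight w) :=
  measurable_sigma_iff.2 fun n => by
    change Measurable fun z : Fin n → Y => ∏ j, w (z j)
    exact Finset.measurable_fun_prod _ fun j _ => hw.comp (measurable_pi_apply j)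

theorem integrable_weight {ν : Measure Y} [SigmaFinite ν] {w : Y → ℝ} (hw0 : ∀ y, 0 ≤ w y)
    (hw : Integrable w ν) : Integrable (fun c => (weight w c : ℂ)) (fock ν) := by
  refine integrable_fock_iff.2 ⟨fun n => ?_, ?_⟩
  · simpa [weight] using (Integrable.fintype_prod (ι := Fin n) (fun _ => hw.ofReal (𝕜 := ℂ)))
  · have : ∀ n : ℕ, ∫ z, ‖((weight w ⟨n, z⟩ : ℝ) : ℂ)‖ ∂(Measure.pi fun _ : Fin n => ν)
        = (∫ y, w y ∂ν) ^ n := fun n => by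
      have h := integral_fintype_prod_eq_pow (ι := Fin n) w (μ := ν)
      rw [Fintype.card_fin] at h
      rw [← h]
      refine integral_congr_ae (Eventually.of_forall fun z => ?_)
      simp only [Complex.norm_real, Real.norm_eq_abs]
      exact abs_of_nonneg (weight_nonneg hw0 _)
    simp_rw [this]
    simpa [div_eq_inv_mul] using Real.summable_pow_div_factorial (∫ y, w y ∂ν)

theorem integrable_weight_real {ν : Measure Y} [SigmaFinite ν] {w : Y → ℝ} (hw0 : ∀ y, 0 ≤ w y)
    (hw : Integrable w ν) : Integrable (weight w) (fock ν) := by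
  simpa using (integrable_weight hw0 hw).re

/-- On n points a multiplicative weight integrates to the n-th power of the one-point integral, so
the sum over n is the exponential series. -/
theorem integral_weight {ν : Measure Y} [SigmaFinite ν] {w : Y → ℝ} (hw0 : ∀ y, 0 ≤ w y)
    (hw : Integrable w ν) : ∫ c, weight w c ∂fock ν = Real.exp (∫ y, w y ∂ν) := by
  have h := hasSum_integral_fock (integrable_weight hw0 hw)
  have h2 : ∀ n : ℕ, ∫ z, ((weight w ⟨n, z⟩ : ℝ) : ℂ) ∂(Measure.pi fun _ : Fin n => ν)
        = (((∫ y, w y ∂ν) ^ n : ℝ) : ℂ) := fun n => by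
    have h := integral_fintype_prod_eq_pow (ι := Fin n) w (μ := ν)
    rw [Fintype.card_fin] at h
    rw [← h]
    exact integral_ofReal
  simp_rw [h2] at h
  rw [show ∫ c, ((weight w c : ℝ) : ℂ) ∂fock ν = ((∫ c, weight w c ∂fock ν : ℝ) : ℂ) from
    integral_ofReal] at h
  have h3 : HasSum (fun n : ℕ => (n.factorial : ℝ)⁻¹ * (∫ y, w y ∂ν) ^ n)
      (∫ c, weight w c ∂fock ν) := by
    refine Complex.hasSum_ofReal.1 ?_
    simpa using h
  refine h3.unique ?_
  rw [Real.exp_eq_exp_ℝ]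
  simpa [div_eq_inv_mul] using NormedSpace.expSeries_div_hasSum_exp (∫ y, w y ∂ν)

instance isFiniteMeasure_fock (ν : Measure Y) [IsFiniteMeasure ν] : IsFiniteMeasure (fock ν) := by
  have h := integrable_weight_real (ν := ν) (w := fun _ => 1) (fun _ => zero_le_one)
    (integrable_const _)
  have : weight (fun _ : Y => (1 : ℝ)) = fun _ => 1 := by ext; simp [weight]
  rw [this, integrable_const_iff] at h
  simpa using h

theorem ae_fock_of_forall {ν : Measure Y} {p : Config Y → Prop}
    (h : ∀ n, ∀ᵐ z ∂(Measure.pi fun _ : Fin n => ν), p ⟨n, z⟩) : ∀ᵐ c ∂fock ν, p c := by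
  rw [fock, Measure.ae_sum_iff]
  intro n
  refine Measure.ae_smul_measure ?_ _
  exact (measurableEmbedding_sigma_mk n).ae_map_iff.2 (h n)

theorem ae_forall_fock {ν : Measure Y} [SigmaFinite ν] {p : Y → Prop} (h : ∀ᵐ y ∂ν, p y) :
    ∀ᵐ c ∂fock ν, ∀ j, p (c.2 j) := by
  refine ae_fock_of_forall fun n => ?_
  change ∀ᵐ z ∂(Measure.pi fun _ : Fin n => ν), ∀ j : Fin n, p (z j)
  rw [ae_all_iff]
  intro j
  exact (Measure.quasiMeasurePreserving_eval (μ := fun _ : Fin n => ν) j).ae h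

/-- This allows one fixed reference measure to serve for all final times, the time dependence being
carried by the domain of integration. -/
theorem fock_restrict (ν : Measure Y) [IsFiniteMeasure ν] {s : Set Y} (hs : MeasurableSet s) :
    fock (ν.restrict s) = (fock ν).restrict {c | ∀ j, c.2 j ∈ s} := by
  have hS : MeasurableSet {c : Config Y | ∀ j, c.2 j ∈ s} := by
    refine MeasurableSpace.measurableSet_iInf.2 fun n => ?_
    change MeasurableSet {z : Fin n → Y | ∀ j, z j ∈ s}
    rw [show {z : Fin n → Y | ∀ j, z j ∈ s} = Set.univ.pi fun _ => s by ext; simp]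
    exact MeasurableSet.univ_pi fun _ => hs
  rw [fock, fock, Measure.restrict_sum _ hS]
  congr 1
  ext1 n
  rw [Measure.restrict_smul, Measure.restrict_map (measurable_sigma_mk n) hS]
  congr 2
  rw [← Measure.restrict_pi_pi]
  congr 1
  ext
  simp

/-- No condition on `F` is required: the sector of zero points carries a Dirac mass. -/
theorem integrable_ite_zero {ν : Measure Y} [SigmaFinite ν] (F : Config Y → ℂ) :
    Integrable (fun c => if c.1 = 0 then F c else 0) (fock ν) := by
  refine integrable_fock_iff.2 ⟨fun n => ?_, ?_⟩
  · rcases eq_or_ne n 0 with rfl | hn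
    · rw [Measure.pi_of_empty _ fun j => j.elim0]
      exact integrable_dirac (by simp)
    · simp [hn]
  · refine summable_of_ne_finset_zero (s := {0}) fun n hn => ?_
    have : n ≠ 0 := by simpa using hn
    simp [this]

theorem integral_ite_zero {ν : Measure Y} [SigmaFinite ν] (F : Config Y → ℂ) :
    ∫ c, (if c.1 = 0 then F c else 0) ∂fock ν = F Config.empty := by
  refine (hasSum_integral_fock (integrable_ite_zero F)).unique ?_
  convert hasSum_single 0 fun n hn => ?_ using 1
  · rw [Measure.pi_of_empty _ fun j => j.elim0, integral_dirac]
    simp [Config.empty]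
  · simp [hn]

end Fock

/-! ### Singling out the latest point of a configuration -/

section Layer

variable {Y : Type*} [MeasurableSpace Y]

/-- Isolate coordinate i and apply Fubini: for a fixed value of it, the other time avoids that value
almost surely. -/
theorem ae_pi_time_ne {ν : Measure Y} [IsFiniteMeasure ν] {T : Y → ℝ} (hT : Measurable T)
    (hν : ∀ s, ∀ᵐ y ∂ν, T y ≠ s) {n : ℕ} {i j : Fin (n + 1)} (hij : i ≠ j) :
    ∀ᵐ z ∂(Measure.pi fun _ : Fin (n + 1) => ν), T (z i) ≠ T (z j) := by
  obtain ⟨k, rfl⟩ := Fin.exists_succAbove_eq hij.symm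
  have hmp := measurePreserving_piFinSuccAbove (fun _ : Fin (n + 1) => ν) i
  have h : ∀ᵐ p ∂(ν.prod (Measure.pi fun _ : Fin n => ν)), T p.1 ≠ T (p.2 k) := by
    rw [Measure.ae_prod_iff_ae_ae]
    · refine Eventually.of_forall fun y => ?_
      refine (Measure.quasiMeasurePreserving_eval (μ := fun _ : Fin n => ν) k).ae
        (p := fun x => T y ≠ T x) ?_
      filter_upwards [hν (T y)] with x hx using hx.symm
    · exact (measurableSet_eq_fun (hT.comp measurable_fst)
        (hT.comp ((measurable_pi_apply k).comp measurable_snd))).compl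
  filter_upwards [hmp.quasiMeasurePreserving.ae h] with z hz
  exact hz

/-- Almost surely exactly one of the n + 1 points has the largest time. Splitting according to its
index gives n + 1 pieces, which are equal by symmetry after that point is moved to the front. -/
theorem integral_pi_eq_integral_last {ν : Measure Y} [IsFiniteMeasure ν] {T : Y → ℝ}
    (hT : Measurable T) (hν : ∀ s, ∀ᵐ y ∂ν, T y ≠ s) {n : ℕ} {H : (Fin (n + 1) → Y) → ℂ}
    (hH : Integrable H (Measure.pi fun _ => ν))
    (hsymm : ∀ (i : Fin (n + 1)) (y : Y) (z : Fin n → Y),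
      H (i.insertNth y z) = H (Fin.cons y z)) :
    ∫ z, H z ∂(Measure.pi fun _ => ν) = ((n + 1 : ℕ) : ℝ) •
      ∫ p, {p : Y × (Fin n → Y) | ∀ k, T (p.2 k) ≤ T p.1}.indicator
        (fun p => H (Fin.cons p.1 p.2)) p ∂(ν.prod (Measure.pi fun _ : Fin n => ν)) := by
  classical
  set B : Fin (n + 1) → Set (Fin (n + 1) → Y) := fun i => {z | ∀ j, T (z j) ≤ T (z i)} with hB
  have hBm : ∀ i, MeasurableSet (B i) := fun i => by
    simp only [hB, Set.ofPred_forall]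
    exact MeasurableSet.iInter fun j => measurableSet_le (hT.comp (measurable_pi_apply j))
      (hT.comp (measurable_pi_apply i))
  have hae : H =ᵐ[Measure.pi fun _ => ν] fun z => ∑ i, (B i).indicator H z := by
    have hne : ∀ᵐ z ∂(Measure.pi fun _ : Fin (n + 1) => ν), ∀ i j, i ≠ j → T (z i) ≠ T (z j) := by
      rw [ae_all_iff]
      intro i
      rw [ae_all_iff]
      intro j
      by_cases hij : i = j
      · simp [hij]
      · filter_upwards [ae_pi_time_ne hT hν hij] with z hz _ using hz
    filter_upwards [hne] with z hz
    obtain ⟨i, hi⟩ := Finite.exists_max fun j => T (z j)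
    rw [Finset.sum_eq_single i]
    · rw [Set.indicator_of_mem (show z ∈ B i from hi)]
    · intro j _ hji
      refine Set.indicator_of_notMem (fun hj => hz i j hji.symm ?_) _
      exact le_antisymm (hj i) (hi j)
    · simp
  rw [integral_congr_ae hae, integral_finsetSum _ fun i _ => hH.indicator (hBm i)]
  have hi : ∀ i, ∫ z, (B i).indicator H z ∂(Measure.pi fun _ => ν) =
      ∫ p, {p : Y × (Fin n → Y) | ∀ k, T (p.2 k) ≤ T p.1}.indicator
        (fun p => H (Fin.cons p.1 p.2)) p ∂(ν.prod (Measure.pi fun _ : Fin n => ν)) := by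
    intro i
    have hmp := (measurePreserving_piFinSuccAbove (fun _ : Fin (n + 1) => ν) i).symm
    rw [← hmp.integral_comp (MeasurableEquiv.measurableEmbedding _)]
    refine integral_congr_ae (Eventually.of_forall fun p => ?_)
    have he : (MeasurableEquiv.piFinSuccAbove (fun _ : Fin (n + 1) => Y) i).symm p =
      i.insertNth p.1 p.2 := rfl
    simp only [he]
    have hmem : (i.insertNth p.1 p.2 : Fin (n + 1) → Y) ∈ B i ↔ ∀ k, T (p.2 k) ≤ T p.1 := by
      simp [hB, i.forall_iff_succAbove]
    by_cases h : ∀ k, T (p.2 k) ≤ T p.1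
    · rw [Set.indicator_of_mem (hmem.2 h), Set.indicator_of_mem (by exact h), hsymm]
    · rw [Set.indicator_of_notMem (fun h' => h (hmem.1 h')), Set.indicator_of_notMem (by exact h)]
  simp_rw [hi]
  simp

/-- Symmetry of a functional of configurations under moving a point to the front. -/
def SymmetricFunctional {Y : Type*} (H : Config Y → ℂ) : Prop :=
  ∀ (n : ℕ) (i : Fin (n + 1)) (y : Y) (z : Fin n → Y),
    H ⟨n + 1, i.insertNth y z⟩ = H ⟨n + 1, Fin.cons y z⟩

/-- Singling out the point of largest time in a configuration. -/
theorem integral_fock_eq_integral_last {ν : Measure Y} [IsFiniteMeasure ν] {T : Y → ℝ}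
    (hT : Measurable T) (hν : ∀ s, ∀ᵐ y ∂ν, T y ≠ s) {H : Config Y → ℂ}
    (hH : Integrable H (fock ν)) (hsymm : SymmetricFunctional H)
    (hc : Integrable (fun p : Y × Config Y => H (Config.cons p.1 p.2)) (ν.prod (fock ν))) :
    ∫ c, H c ∂fock ν = H Config.empty +
      ∫ p, {p : Y × Config Y | ∀ k, T (p.2.2 k) ≤ T p.1}.indicator
        (fun p => H (Config.cons p.1 p.2)) p ∂(ν.prod (fock ν)) := by
  set S := {p : Y × Config Y | ∀ k, T (p.2.2 k) ≤ T p.1} with hS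
  have hSn : ∀ n : ℕ, MeasurableSet {p : Y × (Fin n → Y) | ∀ k, T (p.2 k) ≤ T p.1} := fun n => by
    simp only [Set.ofPred_forall]
    exact MeasurableSet.iInter fun j => measurableSet_le
      (hT.comp ((measurable_pi_apply j).comp measurable_snd)) (hT.comp measurable_fst)
  have hSm : MeasurableSet S := by
    have : Measurable fun p : Y × Config Y => p ∈ S := measurable_prod_sigma fun n => by
      exact measurableSet_setOfPred.1 (hSn n)
    exact measurableSet_setOfPred.2 this
  have hG := hc.indicator hSm
  have h1 := hasSum_integral_fock hH
  have h2 := hasSum_integral_fock hG.integral_prod_right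
  rw [← integral_prod_symm _ hG] at h2
  refine h1.unique ?_
  -- The sector of n + 1 points on the left matches the sector of n points on the right; the sector
  -- of zero points is split off as the value at the empty configuration.
  refine (hasSum_nat_add_iff' 1).1 ?_
  have h0 : ∫ z, H ⟨0, z⟩ ∂(Measure.pi fun _ : Fin 0 => ν) = H Config.empty := by
    rw [Measure.pi_of_empty _ fun j => j.elim0, integral_dirac]
    rfl
  simp only [Finset.range_one, Finset.sum_singleton, Nat.factorial_zero, Nat.cast_one, inv_one,
    one_smul, h0, add_sub_cancel_left]
  refine h2.congr_fun fun n => ?_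
  have hHn := (integrable_fock_iff.1 hH).1 (n + 1)
  rw [integral_pi_eq_integral_last hT hν hHn (hsymm n), smul_smul]
  -- The factor n + 1 counting the choices of the latest point turns 1/(n+1)! into 1/n!, which is
  -- the weight of the remaining n points.
  have hfac : (((n + 1).factorial : ℝ)⁻¹ * ((n + 1 : ℕ) : ℝ)) = (n.factorial : ℝ)⁻¹ := by
    rw [Nat.factorial_succ]
    push_cast
    field_simp
  rw [hfac, integral_prod_symm]
  · rfl
  · refine Integrable.indicator ?_ (hSn n)
    have hmp := (measurePreserving_piFinSuccAbove (fun _ : Fin (n + 1) => ν) 0).symm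
    have := (hmp.integrable_comp_emb (MeasurableEquiv.measurableEmbedding _)).2 hHn
    refine this.congr (Eventually.of_forall fun p => ?_)
    change H ⟨n + 1, (0 : Fin (n + 1)).insertNth p.1 p.2⟩ = _
    rw [Fin.insertNth_zero']

end Layer

/-! ### Differentiation of configuration integrals in the final time -/

section TimeDerivative

variable {X : Type*} [MeasurableSpace X]

/-- The product of Lebesgue measure on `[a, b]` and `μ`. -/
def strip (μ : Measure X) (a b : ℝ) : Measure (ℝ × X) :=
  (volume.restrict (Set.Icc a b)).prod μ

instance (μ : Measure X) [IsFiniteMeasure μ] (a b : ℝ) : IsFiniteMeasure (strip μ a b) := by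
  unfold strip
  infer_instance

/-- Configurations all of whose times are at most `t`. -/
def before {X : Type*} (t : ℝ) : Set (Config (ℝ × X)) := {c | ∀ j, (c.2 j).1 ≤ t}

/-- Configurations all of whose times lie in `[a, b]`. -/
def within {X : Type*} (a b : ℝ) : Set (Config (ℝ × X)) := {c | ∀ j, (c.2 j).1 ∈ Set.Icc a b}

theorem measurableSet_before_prod :
    MeasurableSet {p : ℝ × Config (ℝ × X) | p.2 ∈ before p.1} := by
  have : Measurable fun p : ℝ × Config (ℝ × X) => p.2 ∈ before p.1 :=
    measurable_prod_sigma fun n => by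
      refine measurableSet_setOfPred.1 ?_
      change MeasurableSet {p : ℝ × (Fin n → ℝ × X) | ∀ j : Fin n, (p.2 j).1 ≤ p.1}
      simp only [Set.ofPred_forall]
      exact MeasurableSet.iInter fun j => measurableSet_le
        (measurable_fst.comp ((measurable_pi_apply j).comp measurable_snd)) measurable_fst
  exact measurableSet_setOfPred.2 this

theorem measurableSet_before (t : ℝ) : MeasurableSet (before t : Set (Config (ℝ × X))) :=
  measurable_prodMk_left (x := t) measurableSet_before_prod

theorem cons_mem_before {X : Type*} {t : ℝ} {y : ℝ × X} {c : Config (ℝ × X)} :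
    Config.cons y c ∈ before t ↔ y.1 ≤ t ∧ c ∈ before t := by
  change (∀ j : Fin (c.1 + 1), ((Fin.cons y c.2 : Fin (c.1 + 1) → ℝ × X) j).1 ≤ t) ↔ _
  rw [Fin.forall_fin_succ]
  simp [before]

theorem cons_mem_within {X : Type*} {a b : ℝ} {y : ℝ × X} {c : Config (ℝ × X)} :
    Config.cons y c ∈ within a b ↔ y.1 ∈ Set.Icc a b ∧ c ∈ within a b := by
  change (∀ j : Fin (c.1 + 1), ((Fin.cons y c.2 : Fin (c.1 + 1) → ℝ × X) j).1 ∈ Set.Icc a b) ↔ _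
  rw [Fin.forall_fin_succ]
  simp [within]

variable {μ : Measure X} [IsFiniteMeasure μ] {a b t C : ℝ} {w : X → ℝ}

omit [IsFiniteMeasure μ] in
theorem ae_strip_mem : ∀ᵐ y ∂strip μ a b, y.1 ∈ Set.Icc a b :=
  Measure.quasiMeasurePreserving_fst.ae (ae_restrict_mem measurableSet_Icc)

omit [IsFiniteMeasure μ] in
theorem ae_strip_ne (s : ℝ) : ∀ᵐ y ∂strip μ a b, y.1 ≠ s :=
  Measure.quasiMeasurePreserving_fst.ae (p := fun r => r ≠ s)
    (ae_restrict_of_ae (Measure.ae_ne volume s))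

theorem ae_fock_within : ∀ᵐ c ∂fock (strip μ a b), c ∈ within a b :=
  ae_forall_fock (p := fun y : ℝ × X => y.1 ∈ Set.Icc a b) ae_strip_mem

theorem integrable_strip (hw : Integrable w μ) :
    Integrable (fun y : ℝ × X => w y.2) (strip μ a b) :=
  hw.comp_snd _

theorem integral_strip (hab : a ≤ b) :
    ∫ y, w y.2 ∂strip μ a b = (b - a) * ∫ x, w x ∂μ := by
  rw [strip, integral_fun_snd]
  simp [hab]

theorem strip_restrict (h : t ≤ b) :
    (strip μ a b).restrict {y | y.1 ≤ t} = strip μ a t := by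
  have : {y : ℝ × X | y.1 ≤ t} = Set.Iic t ×ˢ Set.univ := by ext; simp
  rw [this, strip, ← Measure.prod_restrict, Measure.restrict_univ,
    Measure.restrict_restrict measurableSet_Iic, strip]
  congr 2
  ext s
  simp only [Set.mem_inter_iff, Set.mem_Iic, Set.mem_Icc]
  constructor
  · exact fun h => ⟨h.2.1, h.1⟩
  · exact fun h' => ⟨h'.2, h'.1, h'.2.trans h⟩

theorem fock_strip_restrict (h : t ≤ b) :
    (fock (strip μ a b)).restrict (before t) = fock (strip μ a t) := by
  rw [← strip_restrict h, fock_restrict _ (measurableSet_le measurable_fst measurable_const)]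
  rfl

theorem integrable_of_le_weight (hw0 : ∀ x, 0 ≤ w x) (hw : Integrable w μ)
    {H : Config (ℝ × X) → ℂ} (hm : AEStronglyMeasurable H (fock (strip μ a b)))
    (hb : ∀ c ∈ within a b, ‖H c‖ ≤ C * weight (fun y => w y.2) c) :
    Integrable H (fock (strip μ a b)) :=
  ((integrable_weight_real (fun y : ℝ × X => hw0 y.2) (integrable_strip hw)).const_mul C).mono'
    hm (ae_fock_within.mono hb)

/-- Disintegrating by the latest point y = (r, x), the integral over configurations up to time s
equals H(∅) + ∫_a^s S(r) dr, where S(r) integrates H over configurations with one point at time r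
and the others no later. The derivative is S(t) by the fundamental theorem of calculus, once S is
known to be continuous at t. -/
theorem hasDerivAt_integral_before (ha : a < t) (hb : t < b) (hw0 : ∀ x, 0 ≤ w x)
    (hw : Integrable w μ) {H : Config (ℝ × X) → ℂ} (hm : Measurable H)
    (hsymm : SymmetricFunctional H)
    (hbound : ∀ c ∈ within a b, ‖H c‖ ≤ C * weight (fun y => w y.2) c)
    (hcont : ∀ x c, ContinuousAt (fun s => H (Config.cons (s, x) c)) t) :
    HasDerivAt (fun s => ∫ c in before s, H c ∂fock (strip μ a b))
      (∫ x, ∫ c in before t, H (Config.cons (t, x) c) ∂fock (strip μ a b) ∂μ) t := by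
  set ρ := fock (strip μ a b) with hρ
  set K : ℝ × (X × Config (ℝ × X)) → ℂ := fun q =>
    (before q.1).indicator (fun c => H (Config.cons (q.1, q.2.1) c)) q.2.2 with hK
  have hKm : Measurable K := by
    have hset : MeasurableSet {q : ℝ × (X × Config (ℝ × X)) | q.2.2 ∈ before q.1} :=
      (measurable_fst.prodMk (measurable_snd.comp measurable_snd)) measurableSet_before_prod
    have hcons : Measurable fun q : ℝ × (X × Config (ℝ × X)) =>
        H (Config.cons (q.1, q.2.1) q.2.2) := hm.comp (measurable_cons.comp
      ((measurable_fst.prodMk (measurable_fst.comp measurable_snd)).prodMk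
        (measurable_snd.comp measurable_snd)))
    exact hcons.indicator hset
  have hWi : Integrable (fun q : X × Config (ℝ × X) => C * (w q.1 * weight (fun y => w y.2) q.2))
      (μ.prod ρ) :=
    (hw.mul_prod (integrable_weight_real (fun y : ℝ × X => hw0 y.2)
      (integrable_strip hw))).const_mul C
  have hKb : ∀ s ∈ Set.Icc a b, ∀ q : X × Config (ℝ × X), q.2 ∈ within a b →
      ‖K (s, q)‖ ≤ C * (w q.1 * weight (fun y => w y.2) q.2) := by
    intro s hs q hq
    refine (norm_indicator_le_norm_self _ _).trans ?_
    have := hbound _ (cons_mem_within.2 ⟨hs, hq⟩ : Config.cons (s, q.1) q.2 ∈ within a b)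
    rwa [weight_cons] at this
  have hqw : ∀ᵐ q ∂(μ.prod ρ), q.2 ∈ within a b :=
    Measure.quasiMeasurePreserving_snd.ae ae_fock_within
  have hKi : Integrable K ((volume.restrict (Set.Icc a b)).prod (μ.prod ρ)) := by
    refine (hWi.comp_snd (volume.restrict (Set.Icc a b))).mono' hKm.aestronglyMeasurable ?_
    filter_upwards [Measure.quasiMeasurePreserving_fst.ae (ae_restrict_mem measurableSet_Icc),
      Measure.quasiMeasurePreserving_snd.ae hqw] with q h1 h2
    exact hKb _ h1 _ h2
  set S : ℝ → ℂ := fun s => ∫ q, K (s, q) ∂(μ.prod ρ) with hS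
  have hSi : IntegrableOn S (Set.Icc a b) := hKi.integral_prod_left
  have hSc : ContinuousAt S t := by
    refine continuousAt_of_dominated
      (Eventually.of_forall fun s => (hKm.comp measurable_prodMk_left).aestronglyMeasurable)
      ?_ hWi ?_
    · filter_upwards [Icc_mem_nhds ha hb] with s hs
      exact hqw.mono (hKb s hs)
    -- The domain of integration in S jumps only when some time of the configuration equals t, a
    -- null event. Away from it the indicator is locally constant near t, so dominated convergence
    -- applies.
    · have hne : ∀ᵐ q ∂(μ.prod ρ), ∀ j, (q.2.2 j).1 ≠ t :=
        Measure.quasiMeasurePreserving_snd.ae (p := fun c : Config (ℝ × X) => ∀ j, (c.2 j).1 ≠ t)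
          (ae_forall_fock (ae_strip_ne t))
      filter_upwards [hne] with q hq
      by_cases hlt : ∀ j, (q.2.2 j).1 < t
      · have hev : (fun s => K (s, q)) =ᶠ[𝓝 t] fun s => H (Config.cons (s, q.1) q.2) := by
          have : ∀ᶠ s in 𝓝 t, ∀ j, (q.2.2 j).1 < s :=
            eventually_all.2 fun j => lt_mem_nhds (hlt j)
          filter_upwards [this] with s hs
          exact Set.indicator_of_mem (show q.2 ∈ before s from fun j => (hs j).le) _
        exact (hcont q.1 q.2).congr hev.symm
      · push Not at hlt
        obtain ⟨j, hj⟩ := hlt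
        have hj' : t < (q.2.2 j).1 := lt_of_le_of_ne hj (hq j).symm
        have hev : (fun s => K (s, q)) =ᶠ[𝓝 t] fun _ => 0 := by
          filter_upwards [gt_mem_nhds hj'] with s hs
          exact Set.indicator_of_notMem (fun h => (h j).not_gt hs) _
        exact continuousAt_const.congr hev.symm
  have hHi : Integrable H ρ := integrable_of_le_weight hw0 hw hm.aestronglyMeasurable hbound
  have hrep : ∀ s ∈ Set.Ioo a b, ∫ c in before s, H c ∂ρ =
      H Config.empty + ∫ r in a..s, S r := by
    intro s hs
    have hsym' : SymmetricFunctional ((before s).indicator H) := by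
      intro n i y z
      have : (⟨n + 1, i.insertNth y z⟩ : Config (ℝ × X)) ∈ before s ↔
          (⟨n + 1, Fin.cons y z⟩ : Config (ℝ × X)) ∈ before s := by
        change (∀ j : Fin (n + 1), ((i.insertNth y z : Fin (n + 1) → ℝ × X) j).1 ≤ s) ↔
          (∀ j : Fin (n + 1), ((Fin.cons y z : Fin (n + 1) → ℝ × X) j).1 ≤ s)
        rw [i.forall_iff_succAbove, Fin.forall_fin_succ]
        simp
      by_cases h : (⟨n + 1, Fin.cons y z⟩ : Config (ℝ × X)) ∈ before s
      · rw [Set.indicator_of_mem h, Set.indicator_of_mem (this.2 h), hsymm]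
      · rw [Set.indicator_of_notMem h, Set.indicator_of_notMem (fun h' => h (this.1 h'))]
    have hci : Integrable (fun p : (ℝ × X) × Config (ℝ × X) =>
        (before s).indicator H (Config.cons p.1 p.2)) ((strip μ a b).prod ρ) := by
      have hWi' : Integrable (fun p : (ℝ × X) × Config (ℝ × X) =>
          C * (w p.1.2 * weight (fun y => w y.2) p.2)) ((strip μ a b).prod ρ) :=
        ((integrable_strip hw).mul_prod (integrable_weight_real (fun y : ℝ × X => hw0 y.2)
          (integrable_strip hw))).const_mul C
      refine hWi'.mono' ((hm.indicator (measurableSet_before s)).comp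
        measurable_cons).aestronglyMeasurable ?_
      filter_upwards [Measure.quasiMeasurePreserving_fst.ae (ae_strip_mem (μ := μ)),
        Measure.quasiMeasurePreserving_snd.ae ae_fock_within] with p h1 h2
      refine (norm_indicator_le_norm_self _ _).trans ?_
      have := hbound _ (cons_mem_within.2 ⟨h1, h2⟩)
      rwa [weight_cons] at this
    rw [← integral_indicator (measurableSet_before s),
      integral_fock_eq_integral_last measurable_fst ae_strip_ne
        (hHi.indicator (measurableSet_before s)) hsym' hci]
    congr 1
    · exact Set.indicator_of_mem (fun j => j.elim0) _
    · have hassoc := measurePreserving_prodAssoc (volume.restrict (Set.Icc a b)) μ ρ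
      have hI : ∫ r in a..s, S r = ∫ q, (Set.Iic s ×ˢ Set.univ).indicator K q
          ∂((volume.restrict (Set.Icc a b)).prod (μ.prod ρ)) := by
        rw [integral_prod _ (hKi.indicator (measurableSet_Iic.prod MeasurableSet.univ)),
          intervalIntegral.integral_of_le hs.1.le, ← integral_Icc_eq_integral_Ioc]
        have : Set.Icc a s = Set.Iic s ∩ Set.Icc a b := by
          ext r
          simp only [Set.mem_inter_iff, Set.mem_Iic, Set.mem_Icc]
          exact ⟨fun h => ⟨h.2, h.1, h.2.trans hs.2.le⟩, fun h => ⟨h.2.1, h.1⟩⟩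
        rw [this, ← Measure.restrict_restrict measurableSet_Iic,
          ← integral_indicator measurableSet_Iic]
        refine integral_congr_ae (Eventually.of_forall fun r => ?_)
        by_cases hr : r ∈ Set.Iic s
        · simp only [Set.indicator_of_mem hr]
          refine integral_congr_ae (Eventually.of_forall fun q => ?_)
          exact (Set.indicator_of_mem (show (r, q) ∈ Set.Iic s ×ˢ Set.univ from ⟨hr, trivial⟩) K).symm
        · simp only [Set.indicator_of_notMem hr]
          rw [integral_congr_ae (g := fun _ => (0 : ℂ)) (Eventually.of_forall fun q => ?_)]
          · simp
          · exact Set.indicator_of_notMem (fun h => hr h.1) K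
      rw [hI, ← hassoc.integral_comp (MeasurableEquiv.measurableEmbedding _)]
      refine integral_congr_ae (Eventually.of_forall fun p => ?_)
      obtain ⟨⟨r, x⟩, c⟩ := p
      change Set.indicator {p : (ℝ × X) × Config (ℝ × X) | ∀ k, (p.2.2 k).1 ≤ p.1.1}
        (fun p => (before s).indicator H (Config.cons p.1 p.2)) ((r, x), c) =
          (Set.Iic s ×ˢ Set.univ).indicator K (r, x, c)
      by_cases hc : c ∈ before r
      · rw [Set.indicator_of_mem (show ((r, x), c) ∈
          {p : (ℝ × X) × Config (ℝ × X) | ∀ k, (p.2.2 k).1 ≤ p.1.1} from hc)]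
        by_cases hr : r ≤ s
        · rw [Set.indicator_of_mem (show (r, x, c) ∈ Set.Iic s ×ˢ Set.univ from ⟨hr, trivial⟩)]
          rw [Set.indicator_of_mem (cons_mem_before.2 ⟨hr, fun j => (hc j).trans hr⟩)]
          exact (Set.indicator_of_mem hc fun c => H (Config.cons (r, x) c)).symm
        · rw [Set.indicator_of_notMem (fun h => hr (cons_mem_before.1 h).1),
            Set.indicator_of_notMem (fun h => hr h.1)]
      · rw [Set.indicator_of_notMem (by exact hc)]
        have : K (r, x, c) = 0 := Set.indicator_of_notMem hc _
        by_cases hr : (r, x, c) ∈ Set.Iic s ×ˢ (Set.univ : Set (X × Config (ℝ × X)))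
        · rw [Set.indicator_of_mem hr, this]
        · rw [Set.indicator_of_notMem hr]
  have hSt : S t = ∫ x, ∫ c in before t, H (Config.cons (t, x) c) ∂ρ ∂μ := by
    have hint : Integrable (fun q => K (t, q)) (μ.prod ρ) :=
      hWi.mono' (hKm.comp measurable_prodMk_left).aestronglyMeasurable
        (hqw.mono (hKb t ⟨ha.le, hb.le⟩))
    simp only [hS]
    rw [integral_prod _ hint]
    refine integral_congr_ae (Eventually.of_forall fun x => ?_)
    simp only [hK]
    exact integral_indicator (measurableSet_before t)
  rw [← hSt]
  have hd : HasDerivAt (fun s => ∫ r in a..s, S r) (S t) t := by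
    refine intervalIntegral.integral_hasDerivAt_right ?_ ?_ hSc
    · refine (intervalIntegrable_iff_integrableOn_Icc_of_le ha.le).2 (hSi.mono_set ?_)
      exact Set.Icc_subset_Icc_right hb.le
    · exact ⟨Set.Icc a b, Icc_mem_nhds ha hb, hSi.aestronglyMeasurable⟩
  refine (hd.const_add (H Config.empty)).congr_of_eventuallyEq ?_
  filter_upwards [Ioo_mem_nhds ha hb] with s hs
  exact hrep s hs

/-- Product rule for a moving domain and a moving integrand. The integral of Φ_s over the domain at
s is the sum of the variation of the domain alone, the variation of the integrand alone, a constant,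
and a mixed remainder, which is of second order. -/
theorem hasDerivAt_integral_before_param (ha : a < t) (hb : t < b) (hw0 : ∀ x, 0 ≤ w x)
    (hw : Integrable w μ) (hwm : Measurable w) {Φ Φ' : ℝ → Config (ℝ × X) → ℂ}
    (hm : ∀ s, Measurable (Φ s)) (hm' : Measurable (Φ' t)) (hsymm : SymmetricFunctional (Φ t))
    {l u : ℝ} (hl : l < t) (hu : t < u)
    (hbound : ∀ s ∈ Set.Ioo l u, ∀ c ∈ within a b, ‖Φ s c‖ ≤ C * weight (fun y => w y.2) c)
    (hbound' : ∀ s ∈ Set.Ioo l u, ∀ c ∈ within a b, ‖Φ' s c‖ ≤ C * weight (fun y => w y.2) c)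
    (hderiv : ∀ s ∈ Set.Ioo l u, ∀ c ∈ within a b, HasDerivAt (fun r => Φ r c) (Φ' s c) s)
    (hcont : ∀ x c, ContinuousAt (fun s => Φ t (Config.cons (s, x) c)) t) :
    HasDerivAt (fun s => ∫ c in before s, Φ s c ∂fock (strip μ a b))
      ((∫ x, ∫ c in before t, Φ t (Config.cons (t, x) c) ∂fock (strip μ a b) ∂μ) +
        ∫ c in before t, Φ' t c ∂fock (strip μ a b)) t := by
  set ρ := fock (strip μ a b) with hρ
  set B : Config (ℝ × X) → ℝ := weight fun y => w y.2 with hB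
  have hB0 : ∀ c, 0 ≤ B c := weight_nonneg fun y => hw0 y.2
  have hBi : Integrable B ρ :=
    integrable_weight_real (fun y : ℝ × X => hw0 y.2) (integrable_strip hw)
  have htlu : t ∈ Set.Ioo l u := ⟨hl, hu⟩
  have hΦi : ∀ s ∈ Set.Ioo l u, Integrable (Φ s) ρ := fun s hs =>
    integrable_of_le_weight hw0 hw (hm s).aestronglyMeasurable (hbound s hs)
  have h1 := hasDerivAt_integral_before ha hb hw0 hw (hm t) hsymm (hbound t htlu) hcont
  have h2 : HasDerivAt (fun s => ∫ c in before t, Φ s c ∂ρ) (∫ c in before t, Φ' t c ∂ρ) t := by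
    refine (hasDerivAt_integral_of_dominated_loc_of_deriv_le (bound := fun c => C * B c)
      (Ioo_mem_nhds hl hu) ?_ ?_ ?_ ?_ ?_ ?_).2
    · exact Eventually.of_forall fun s => (hm s).aestronglyMeasurable
    · exact (hΦi t htlu).integrableOn
    · exact hm'.aestronglyMeasurable
    · filter_upwards [ae_restrict_of_ae ae_fock_within] with c hc s hs using hbound' s hs c hc
    · exact (hBi.const_mul C).integrableOn
    · filter_upwards [ae_restrict_of_ae ae_fock_within] with c hc s hs using hderiv s hs c hc
  have hlip : ∀ s ∈ Set.Ioo l u, ∀ c ∈ within a b, ‖Φ s c - Φ t c‖ ≤ C * B c * |s - t| := by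
    intro s hs c hc
    exact (convex_Ioo l u).norm_image_sub_le_of_norm_hasDerivWithin_le
      (fun r hr => (hderiv r hr c hc).hasDerivWithinAt) (fun r hr => hbound' r hr c hc) htlu hs
  -- The mixed remainder is the integral of Φ_s - Φ_t over the layer between the two domains. The
  -- integrand is Lipschitz in s with constant C B, and the B-mass of the layer tends to 0, hence R
  -- = o(s - t).
  set R : ℝ → ℂ := fun s => (∫ c in before s, (Φ s c - Φ t c) ∂ρ) -
    ∫ c in before t, (Φ s c - Φ t c) ∂ρ with hR
  set β : ℝ → ℝ := fun s => ∫ c in before s, B c ∂ρ with hβ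
  -- Continuity of the dominating mass in the final time comes from the preceding theorem applied to
  -- the weight itself.
  have hβc : ContinuousAt β t := by
    have := (hasDerivAt_integral_before (μ := μ) (C := 1) (H := fun c => (B c : ℂ)) ha hb hw0 hw
      (Complex.measurable_ofReal.comp (measurable_weight (hwm.comp measurable_snd))) ?_ ?_ ?_)
    · have h3 := Complex.continuous_re.continuousAt.comp this.continuousAt
      refine h3.congr (Eventually.of_forall fun s => ?_)
      simp only [Function.comp_apply]
      rw [show ∫ c in before s, ((B c : ℝ) : ℂ) ∂ρ = ((∫ c in before s, B c ∂ρ : ℝ) : ℂ) from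
        integral_ofReal, Complex.ofReal_re]
    · intro n i y z
      have : B ⟨n + 1, i.insertNth y z⟩ = B ⟨n + 1, Fin.cons y z⟩ := by
        change ∏ j : Fin (n + 1), w ((i.insertNth y z : Fin (n + 1) → ℝ × X) j).2 =
          ∏ j : Fin (n + 1), w ((Fin.cons y z : Fin (n + 1) → ℝ × X) j).2
        rw [Fin.prod_univ_succAbove _ i, Fin.prod_univ_succ]
        simp
      simp only [this]
    · intro c _
      simp only [Complex.norm_real, Real.norm_eq_abs, one_mul]
      exact (abs_of_nonneg (hB0 c)).le
    · intro x c
      simp only [hB, weight_cons]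
      exact continuousAt_const
  have hRb : ∀ s ∈ Set.Ioo l u, ‖R s‖ ≤ |C| * |β s - β t| * |s - t| := by
    intro s hs
    have hD : Integrable (fun c => Φ s c - Φ t c) ρ := (hΦi s hs).sub (hΦi t htlu)
    have key : ∀ r r' : ℝ, r ≤ r' → ‖(∫ c in before r', (Φ s c - Φ t c) ∂ρ) -
        ∫ c in before r, (Φ s c - Φ t c) ∂ρ‖ ≤ |C| * |β r' - β r| * |s - t| := by
      intro r r' hrr
      have hsub : (before r : Set (Config (ℝ × X))) ⊆ before r' := fun c hc j => (hc j).trans hrr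
      rw [← setIntegral_sdiff (measurableSet_before r) hD.integrableOn hsub]
      have hd : β r' - β r = ∫ c in before r' \ before r, B c ∂ρ :=
        (setIntegral_sdiff (measurableSet_before r) hBi.integrableOn hsub).symm
      rw [hd, abs_of_nonneg (integral_nonneg hB0)]
      calc ‖∫ c in before r' \ before r, (Φ s c - Φ t c) ∂ρ‖
          ≤ ∫ c in before r' \ before r, |C| * |s - t| * B c ∂ρ := by
            refine norm_integral_le_of_norm_le (hBi.const_mul _).integrableOn ?_
            filter_upwards [ae_restrict_of_ae ae_fock_within] with c hc
            refine (hlip s hs c hc).trans ?_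
            rw [mul_right_comm]
            gcongr
            · exact hB0 c
            · exact le_abs_self C
        _ = _ := by rw [integral_const_mul]; ring
    rcases le_total s t with h | h
    · rw [hR, ← norm_neg, neg_sub, abs_sub_comm (β s)]
      exact key s t h
    · exact key t s h
  have h3 : HasDerivAt R 0 t := by
    rw [hasDerivAt_iff_isLittleO]
    have hRt : R t = 0 := by simp [hR]
    simp only [hRt, sub_zero, smul_zero]
    refine Asymptotics.IsLittleO.of_isBigOWith fun ε hε => ?_
    refine Asymptotics.isBigOWith_iff.2 ?_
    have hlim : Tendsto (fun s => |C| * |β s - β t|) (𝓝 t) (𝓝 0) := by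
      have : ContinuousAt (fun s => |C| * |β s - β t|) t :=
        continuousAt_const.mul (hβc.sub continuousAt_const).abs
      simpa [ContinuousAt] using this
    filter_upwards [Ioo_mem_nhds hl hu, (tendsto_order.1 hlim).2 ε hε] with s hs hs'
    refine (hRb s hs).trans ?_
    rw [Real.norm_eq_abs]
    gcongr
  have hsum := (h1.add h2).add h3
  rw [add_zero] at hsum
  refine ((hsum.sub_const (∫ c in before t, Φ t c ∂ρ))).congr_of_eventuallyEq ?_
  filter_upwards [Ioo_mem_nhds hl hu] with s hs
  simp only [hR, Pi.add_apply]
  rw [integral_sub (hΦi s hs).integrableOn (hΦi t htlu).integrableOn,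
    integral_sub (hΦi s hs).integrableOn (hΦi t htlu).integrableOn]
  ring

end TimeDerivative

/-! ### The bilinear product on ℂ^d -/

section Bilinear

variable {d : ℕ}

theorem cdot_comm (z w : CSpace d) : cdot z w = cdot w z := by
  simp [cdot, mul_comm]

theorem cdot_add_left (u v w : CSpace d) : cdot (u + v) w = cdot u w + cdot v w := by
  simp [cdot, add_mul, Finset.sum_add_distrib]

theorem cdot_add_right (u v w : CSpace d) : cdot u (v + w) = cdot u v + cdot u w := by
  simp [cdot, mul_add, Finset.sum_add_distrib]

theorem cdot_sub_left (u v w : CSpace d) : cdot (u - v) w = cdot u w - cdot v w := by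
  simp [cdot, sub_mul, Finset.sum_sub_distrib]

theorem cdot_sub_right (u v w : CSpace d) : cdot u (v - w) = cdot u v - cdot u w := by
  simp [cdot, mul_sub, Finset.sum_sub_distrib]

theorem cdot_smul_left (r : ℂ) (v w : CSpace d) : cdot (r • v) w = r * cdot v w := by
  simp [cdot, Finset.mul_sum, mul_assoc]

theorem cdot_smul_right (r : ℂ) (v w : CSpace d) : cdot v (r • w) = r * cdot v w := by
  simp [cdot, Finset.mul_sum, mul_left_comm]

@[simp] theorem cdot_zero_left (w : CSpace d) : cdot 0 w = 0 := by simp [cdot]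

@[simp] theorem cdot_zero_right (w : CSpace d) : cdot w 0 = 0 := by simp [cdot]

theorem cdot_sum_left {ι : Type*} (s : Finset ι) (f : ι → CSpace d) (w : CSpace d) :
    cdot (∑ j ∈ s, f j) w = ∑ j ∈ s, cdot (f j) w := by
  classical
  induction s using Finset.induction_on with
  | empty => simp
  | insert j s hj ih => rw [Finset.sum_insert hj, Finset.sum_insert hj, cdot_add_left, ih]

theorem cdot_sum_right {ι : Type*} (s : Finset ι) (f : ι → CSpace d) (w : CSpace d) :
    cdot w (∑ j ∈ s, f j) = ∑ j ∈ s, cdot w (f j) := by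
  rw [cdot_comm, cdot_sum_left]
  simp only [cdot_comm]

/-- The bilinear product is the Hermitian one with the first argument conjugated, and conjugation
preserves the norm; Cauchy–Schwarz applies. -/
theorem norm_cdot_le (z w : CSpace d) : ‖cdot z w‖ ≤ ‖z‖ * ‖w‖ := by
  have h : cdot z w = inner ℂ (WithLp.toLp 2 fun i => (starRingEnd ℂ) (z i) : CSpace d) w := by
    simp [cdot, PiLp.inner_apply, mul_comm]
  have hn : ‖(WithLp.toLp 2 fun i => (starRingEnd ℂ) (z i) : CSpace d)‖ = ‖z‖ := by
    simp [EuclideanSpace.norm_eq]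
  rw [h, ← hn]
  exact norm_inner_le_norm _ _

theorem norm_toC (x : Space d) : ‖toC x‖ = ‖x‖ := by
  simp [toC, EuclideanSpace.norm_eq]

theorem toC_add (x y : Space d) : toC (x + y) = toC x + toC y := by
  ext i
  simp [toC]

theorem toC_sub (x y : Space d) : toC (x - y) = toC x - toC y := by
  ext i
  simp [toC]

theorem toC_smul (r : ℝ) (x : Space d) : toC (r • x) = (r : ℂ) • toC x := by
  ext i
  simp [toC]

theorem toC_sum {ι : Type*} (s : Finset ι) (f : ι → Space d) :
    toC (∑ j ∈ s, f j) = ∑ j ∈ s, toC (f j) := by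
  classical
  induction s using Finset.induction_on with
  | empty => ext i; simp [toC]
  | insert j s hj ih => rw [Finset.sum_insert hj, Finset.sum_insert hj, toC_add, ih]

theorem cdot_toC (x y : Space d) : cdot (toC x) (toC y) = ((inner ℝ x y : ℝ) : ℂ) := by
  simp [cdot, toC, PiLp.inner_apply, mul_comm]

theorem continuous_toC : Continuous (toC : Space d → CSpace d) := by
  unfold toC
  fun_prop

theorem continuous_cdot : Continuous fun p : CSpace d × CSpace d => cdot p.1 p.2 := by
  unfold cdot
  fun_prop

theorem continuous_cdot_comp {Z : Type*} [TopologicalSpace Z] {f g : Z → CSpace d}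
    (hf : Continuous f) (hg : Continuous g) :
    Continuous fun z => cdot (f z) (g z) :=
  continuous_cdot.comp (hf.prodMk hg)

theorem hasDerivAt_cdot {f g : ℝ → CSpace d} {f' g' : CSpace d} {t : ℝ}
    (hf : HasDerivAt f f' t) (hg : HasDerivAt g g' t) :
    HasDerivAt (fun s => cdot (f s) (g s))
      (cdot f' (g t) + cdot (f t) g') t := by
  have hc : ∀ {f : ℝ → CSpace d} {f' : CSpace d}, HasDerivAt f f' t → ∀ i,
      HasDerivAt (fun s => f s i) (f' i) t := fun hf i =>
    ((EuclideanSpace.proj i : CSpace d →L[ℂ] ℂ).restrictScalars ℝ).hasFDerivAt.comp_hasDerivAt t hf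
  have := HasDerivAt.fun_sum (u := Finset.univ) fun i _ => (hc hf i).mul (hc hg i)
  simpa [cdot, Finset.sum_add_distrib] using this

/-- `z ↦ cdot v z` as a continuous linear map. -/
def cdotCLM (v : CSpace d) : CSpace d →L[ℝ] ℂ :=
  LinearMap.mkContinuous
    { toFun := fun z => cdot v z
      map_add' := cdot_add_right v
      map_smul' := fun r z => by
        have : r • z = (r : ℂ) • z := by ext i; simp
        rw [this, cdot_smul_right]
        simp } ‖v‖ fun z => norm_cdot_le v z

@[simp] theorem cdotCLM_apply (v z : CSpace d) : cdotCLM v z = cdot v z := rfl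

theorem cdot_intervalIntegral (v : CSpace d) {f : ℝ → CSpace d} {a b : ℝ}
    (hf : IntervalIntegrable f volume a b) :
    cdot v (∫ s in a..b, f s) = ∫ s in a..b, cdot v (f s) :=
  ((cdotCLM v).intervalIntegral_comp_comm hf).symm

end Bilinear

/-! ### Closed form of the integrand -/

section Action

variable {d : ℕ} (θ : 𝓢(ℝ, CSpace d)) (t₀ t : ℝ) (x x₀ : Space d)
  (c : Config (ℝ × Space d))

/-- The total momentum `∑ⱼ αⱼ` of a configuration. -/
def momentum : CSpace d := ∑ j, toC (c.2 j).2

/-- The displacement `∑ⱼ αⱼ (t - τⱼ)` of a configuration. -/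
def drift : CSpace d := ∑ j, ((t - (c.2 j).1 : ℝ) : ℂ) • toC (c.2 j).2

/-- The closed form of `∫ (θ + i ∑ⱼ αⱼ 1_{(τⱼ, t]})²`. -/
def action : ℂ :=
  (∫ s in t₀..t, cdot (θ s) (θ s)) +
    2 * Complex.I * ∑ j, cdot (toC (c.2 j).2) (∫ s in (c.2 j).1..t, θ s) -
    ∑ j, ∑ k, ((t - max (c.2 j).1 (c.2 k).1 : ℝ) : ℂ) * cdot (toC (c.2 j).2) (toC (c.2 k).2)

/-- The vector `∫ θ + i ∑ⱼ αⱼ (t - τⱼ)`. -/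
def shift : CSpace d := (∫ s in t₀..t, θ s) + Complex.I • drift t c

/-- The exponent of the integrand. -/
def phase : ℂ :=
  -(Complex.I / 2) * action θ t₀ t c +
    -(1 / (2 * Complex.I * ((t - t₀ : ℝ) : ℂ))) *
      cdot (shift θ t₀ t c + (toC x - toC x₀)) (shift θ t₀ t c + (toC x - toC x₀)) +
    cdot (toC x) (momentum c) +
    (Complex.I * cdot (toC x₀) (θ t₀) - Complex.I * cdot (toC x) (θ t))

theorem integral_indicator_Ioc {E : Type*} [NormedAddCommGroup E] [NormedSpace ℝ E]
    {a b r : ℝ} (hr : r ∈ Set.Icc a b) (f : ℝ → E) :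
    ∫ s in a..b, (Set.Ioc r b).indicator f s = ∫ s in r..b, f s := by
  rw [intervalIntegral.integral_of_le (hr.1.trans hr.2), intervalIntegral.integral_of_le hr.2,
    setIntegral_indicator measurableSet_Ioc]
  congr 2
  ext s
  simp only [Set.mem_inter_iff, Set.mem_Ioc]
  exact ⟨fun h => h.2, fun h => ⟨⟨hr.1.trans_lt h.1, h.2⟩, h⟩⟩

/-- Expand the square. The product of the indicators of (τ_j, t] and (τ_k, t] is that of (max(τ_j,
τ_k), t], whose length is the coefficient in the double sum; i² gives the minus sign. That the times
lie in [t₀, t] is what makes the lengths correct. -/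
theorem integral_shifted_sq {t₀ t : ℝ} {n : ℕ} {z : Fin n → ℝ × Space d}
    (hz : ∀ j, (z j).1 ∈ Set.Icc t₀ t) :
    ∫ s in t₀..t, cdot (shifted θ t (fun j => (z j).1) (fun j => (z j).2) s)
      (shifted θ t (fun j => (z j).1) (fun j => (z j).2) s) = action θ t₀ t ⟨n, z⟩ := by
  have hpt : ∀ s, cdot (shifted θ t (fun j => (z j).1) (fun j => (z j).2) s)
      (shifted θ t (fun j => (z j).1) (fun j => (z j).2) s) =
      cdot (θ s) (θ s) + 2 * Complex.I * (∑ j, (Set.Ioc (z j).1 t).indicator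
        (fun s => cdot (toC (z j).2) (θ s)) s) -
      ∑ j, ∑ k, (Set.Ioc (max (z j).1 (z k).1) t).indicator
        (fun _ => cdot (toC (z j).2) (toC (z k).2)) s := by
    intro s
    have hjk : ∀ j k, (Set.Ioc (max (z j).1 (z k).1) t).indicator
        (fun _ => cdot (toC (z j).2) (toC (z k).2)) s =
        cdot ((Set.Ioc (z j).1 t).indicator (fun _ => toC (z j).2) s)
          ((Set.Ioc (z k).1 t).indicator (fun _ => toC (z k).2) s) := by
      intro j k
      by_cases hj : s ∈ Set.Ioc (z j).1 t
      · by_cases hk : s ∈ Set.Ioc (z k).1 t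
        · rw [Set.indicator_of_mem hj, Set.indicator_of_mem hk, Set.indicator_of_mem
            (show s ∈ Set.Ioc (max (z j).1 (z k).1) t from ⟨max_lt hj.1 hk.1, hj.2⟩)]
        · rw [Set.indicator_of_notMem hk, Set.indicator_of_notMem, cdot_zero_right]
          exact fun h => hk ⟨(le_max_right _ _).trans_lt h.1, h.2⟩
      · rw [Set.indicator_of_notMem hj, Set.indicator_of_notMem, cdot_zero_left]
        exact fun h => hj ⟨(le_max_left _ _).trans_lt h.1, h.2⟩
    have hj : ∀ j, (Set.Ioc (z j).1 t).indicator (fun s => cdot (toC (z j).2) (θ s)) s =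
        cdot ((Set.Ioc (z j).1 t).indicator (fun _ => toC (z j).2) s) (θ s) := by
      intro j
      by_cases hj : s ∈ Set.Ioc (z j).1 t
      · rw [Set.indicator_of_mem hj, Set.indicator_of_mem hj]
      · rw [Set.indicator_of_notMem hj, Set.indicator_of_notMem hj, cdot_zero_left]
    simp_rw [hjk, hj, ← cdot_sum_right, ← cdot_sum_left]
    simp only [shifted, cdot_add_left, cdot_add_right, cdot_smul_left, cdot_smul_right]
    rw [cdot_comm (θ s) (∑ j, _)]
    linear_combination (cdot (∑ j, (Set.Ioc (z j).1 t).indicator (fun _ => toC (z j).2) s)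
      (∑ j, (Set.Ioc (z j).1 t).indicator (fun _ => toC (z j).2) s)) * Complex.I_mul_I
  have hθ : Continuous (θ : ℝ → CSpace d) := θ.continuous
  have i1 : IntervalIntegrable (fun s => cdot (θ s) (θ s)) volume t₀ t :=
    (continuous_cdot_comp hθ hθ).intervalIntegrable _ _
  have hind : ∀ (f : ℝ → ℂ) (r : ℝ), Continuous f →
      IntervalIntegrable ((Set.Ioc r t).indicator f) volume t₀ t := fun f r hf => by
    have := hf.intervalIntegrable (μ := volume) t₀ t
    exact ⟨this.1.indicator measurableSet_Ioc, this.2.indicator measurableSet_Ioc⟩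
  have i2 : ∀ j, IntervalIntegrable (fun s => (Set.Ioc (z j).1 t).indicator
      (fun s => cdot (toC (z j).2) (θ s)) s) volume t₀ t := fun j =>
    hind _ _ (continuous_cdot_comp continuous_const hθ)
  have i3 : ∀ j k, IntervalIntegrable (fun s => (Set.Ioc (max (z j).1 (z k).1) t).indicator
      (fun _ => cdot (toC (z j).2) (toC (z k).2)) s) volume t₀ t := fun j k =>
    hind _ _ continuous_const
  have s2 : IntervalIntegrable (fun s => ∑ j, (Set.Ioc (z j).1 t).indicator
      (fun s => cdot (toC (z j).2) (θ s)) s) volume t₀ t := by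
    simpa only [Finset.sum_fn] using IntervalIntegrable.sum Finset.univ fun j _ => i2 j
  have s3' : ∀ j, IntervalIntegrable (fun s => ∑ k, (Set.Ioc (max (z j).1 (z k).1) t).indicator
      (fun _ => cdot (toC (z j).2) (toC (z k).2)) s) volume t₀ t := fun j => by
    simpa only [Finset.sum_fn] using IntervalIntegrable.sum Finset.univ fun k _ => i3 j k
  have s3 : IntervalIntegrable (fun s => ∑ j, ∑ k, (Set.Ioc (max (z j).1 (z k).1) t).indicator
      (fun _ => cdot (toC (z j).2) (toC (z k).2)) s) volume t₀ t := by
    simpa only [Finset.sum_fn] using IntervalIntegrable.sum Finset.univ fun j _ => s3' j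
  simp_rw [hpt]
  rw [intervalIntegral.integral_sub (i1.add (s2.const_mul _)) s3,
    intervalIntegral.integral_add i1 (s2.const_mul _), intervalIntegral.integral_const_mul,
    intervalIntegral.integral_finsetSum fun j _ => i2 j,
    intervalIntegral.integral_finsetSum fun j _ => s3' j]
  simp_rw [intervalIntegral.integral_finsetSum fun k _ => i3 _ k]
  unfold action
  congr 1
  · congr 2
    refine Finset.sum_congr rfl fun j _ => ?_
    rw [integral_indicator_Ioc (hz j), cdot_intervalIntegral _ (hθ.intervalIntegrable _ _)]
  · refine Finset.sum_congr rfl fun j _ => Finset.sum_congr rfl fun k _ => ?_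
    rw [integral_indicator_Ioc ⟨(hz j).1.trans (le_max_left _ _), max_le (hz j).2 (hz k).2⟩]
    simp

theorem integrand_eq_exp_phase {t₀ t : ℝ} {n : ℕ} {z : Fin n → ℝ × Space d}
    (hz : ∀ j, (z j).1 ∈ Set.Icc t₀ t) :
    integrand θ x t x₀ t₀ n (fun j => (z j).1) (fun j => (z j).2) =
      Complex.exp (phase θ t₀ t x x₀ ⟨n, z⟩) := by
  have h : (∑ j, ((inner ℝ (z j).2 x : ℝ) : ℂ)) = cdot (toC x) (momentum ⟨n, z⟩) := by
    rw [momentum, cdot_sum_right]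
    refine Finset.sum_congr rfl fun j _ => ?_
    rw [cdot_toC, real_inner_comm]
  rw [integrand, integral_shifted_sq θ hz, phase, Complex.exp_add, Complex.exp_add, Complex.exp_add, h]
  rfl

end Action

/-! ### Structure of the phase: affine parts, time derivative, symmetry, regularity -/

section Phase

variable {d : ℕ} (θ : 𝓢(ℝ, CSpace d)) (t₀ t : ℝ) (x x₀ : Space d)
  (c : Config (ℝ × Space d))

/-- The coefficient of `x` in the phase, apart from the free Gaussian. -/
def slopeX : CSpace d :=
  (Complex.I / ((t - t₀ : ℝ) : ℂ)) • shift θ t₀ t c + momentum c - Complex.I • θ t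

/-- The part of the phase that does not depend on `x`, apart from the free Gaussian. -/
def offsetX : ℂ :=
  -(Complex.I / 2) * action θ t₀ t c +
    Complex.I / (2 * ((t - t₀ : ℝ) : ℂ)) * cdot (shift θ t₀ t c) (shift θ t₀ t c) -
    Complex.I / ((t - t₀ : ℝ) : ℂ) * cdot (toC x₀) (shift θ t₀ t c) +
    Complex.I * cdot (toC x₀) (θ t₀)

/-- The coefficient of `x₀` in the phase, apart from the free Gaussian. -/
def slopeY : CSpace d :=
  -(Complex.I / ((t - t₀ : ℝ) : ℂ)) • shift θ t₀ t c + Complex.I • θ t₀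

/-- The part of the phase that does not depend on `x₀`, apart from the free Gaussian. -/
def offsetY : ℂ :=
  -(Complex.I / 2) * action θ t₀ t c +
    Complex.I / (2 * ((t - t₀ : ℝ) : ℂ)) * cdot (shift θ t₀ t c) (shift θ t₀ t c) +
    Complex.I / ((t - t₀ : ℝ) : ℂ) * cdot (toC x) (shift θ t₀ t c) +
    cdot (toC x) (momentum c) - Complex.I * cdot (toC x) (θ t)

theorem neg_one_div_two_I_mul (T : ℂ) : -(1 / (2 * Complex.I * T)) = Complex.I / (2 * T) := by
  have : (1 : ℂ) / (2 * Complex.I * T) = (Complex.I)⁻¹ / (2 * T) := by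
    rw [div_eq_mul_inv, div_eq_mul_inv, mul_inv, mul_inv, mul_inv]
    ring
  rw [this, Complex.inv_I]
  ring

theorem norm_sub_sq_eq_cdot (x y : Space d) :
    ((‖x - y‖ ^ 2 : ℝ) : ℂ) = cdot (toC x - toC y) (toC x - toC y) := by
  rw [← toC_sub, cdot_toC, real_inner_self_eq_norm_sq]

/-- The only quadratic dependence on x is the free Gaussian, which does not involve the
configuration. The propagator is therefore that Gaussian times a Laplace transform in x, and
likewise in x₀. -/
theorem phase_eq_slopeX : phase θ t₀ t x x₀ c =
    Complex.I / (2 * ((t - t₀ : ℝ) : ℂ)) * ((‖x - x₀‖ ^ 2 : ℝ) : ℂ) +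
      cdot (toC x) (slopeX θ t₀ t c) + offsetX θ t₀ t x₀ c := by
  rw [phase, slopeX, offsetX, neg_one_div_two_I_mul, norm_sub_sq_eq_cdot]
  simp only [cdot_add_left, cdot_add_right, cdot_sub_left, cdot_sub_right, cdot_smul_right]
  rw [cdot_comm (shift θ t₀ t c) (toC x), cdot_comm (shift θ t₀ t c) (toC x₀)]
  ring

theorem phase_eq_slopeY : phase θ t₀ t x x₀ c =
    Complex.I / (2 * ((t - t₀ : ℝ) : ℂ)) * ((‖x₀ - x‖ ^ 2 : ℝ) : ℂ) +
      cdot (toC x₀) (slopeY θ t₀ t c) + offsetY θ t₀ t x c := by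
  rw [phase, slopeY, offsetY, neg_one_div_two_I_mul, norm_sub_sq_eq_cdot]
  simp only [cdot_add_left, cdot_add_right, cdot_sub_left, cdot_sub_right, cdot_smul_right]
  rw [cdot_comm (shift θ t₀ t c) (toC x), cdot_comm (shift θ t₀ t c) (toC x₀)]
  ring

/-- The time derivative of the phase. -/
def phaseDeriv : ℂ :=
  -(Complex.I / 2) * cdot (θ t + Complex.I • momentum c) (θ t + Complex.I • momentum c) -
    Complex.I / (2 * ((t - t₀ : ℝ) : ℂ) ^ 2) *
      cdot (shift θ t₀ t c + (toC x - toC x₀)) (shift θ t₀ t c + (toC x - toC x₀)) +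
    Complex.I / ((t - t₀ : ℝ) : ℂ) *
      cdot (shift θ t₀ t c + (toC x - toC x₀)) (θ t + Complex.I • momentum c) -
    Complex.I * cdot (toC x) (deriv θ t)

theorem hasDerivAt_shift :
    HasDerivAt (fun s => shift θ t₀ s c) (θ t + Complex.I • momentum c) t := by
  have h1 : HasDerivAt (fun s => ∫ r in t₀..s, θ r) (θ t) t :=
    intervalIntegral.integral_hasDerivAt_right (θ.continuous.intervalIntegrable _ _)
      (θ.continuous.stronglyMeasurableAtFilter _ _) θ.continuous.continuousAt
  have h2 : HasDerivAt (fun s => drift s c) (momentum c) t := by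
    refine HasDerivAt.fun_sum fun j _ => ?_
    have h3 : HasDerivAt (fun s : ℝ => ((s - (c.2 j).1 : ℝ) : ℂ)) 1 t := by
      simpa using ((hasDerivAt_id t).sub_const (c.2 j).1).ofReal_comp
    simpa using h3.smul_const (toC (c.2 j).2)
  exact h1.add (h2.const_smul Complex.I)

/-- The closed form is differentiable in t without any condition τ_j ≤ t. This matters because
differentiation takes place over a fixed strip whose times may exceed t. -/
theorem hasDerivAt_action : HasDerivAt (fun s => action θ t₀ s c)
    (cdot (θ t + Complex.I • momentum c) (θ t + Complex.I • momentum c)) t := by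
  have hp : ∀ r, HasDerivAt (fun s => ∫ u in r..s, θ u) (θ t) t := fun r =>
    intervalIntegral.integral_hasDerivAt_right (θ.continuous.intervalIntegrable _ _)
      (θ.continuous.stronglyMeasurableAtFilter _ _) θ.continuous.continuousAt
  have hcθ : Continuous fun s => cdot (θ s) (θ s) :=
    continuous_cdot_comp θ.continuous θ.continuous
  have h1 : HasDerivAt (fun s => ∫ u in t₀..s, cdot (θ u) (θ u)) (cdot (θ t) (θ t)) t :=
    intervalIntegral.integral_hasDerivAt_right (hcθ.intervalIntegrable _ _)
      (hcθ.stronglyMeasurableAtFilter _ _) hcθ.continuousAt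
  have h2 : HasDerivAt (fun s => ∑ j, cdot (toC (c.2 j).2) (∫ u in (c.2 j).1..s, θ u))
      (∑ j, cdot (toC (c.2 j).2) (θ t)) t := by
    refine HasDerivAt.fun_sum fun j _ => ?_
    simpa using hasDerivAt_cdot (hasDerivAt_const t (toC (c.2 j).2)) (hp (c.2 j).1)
  have h3 : HasDerivAt (fun s => ∑ j, ∑ k, ((s - max (c.2 j).1 (c.2 k).1 : ℝ) : ℂ) *
      cdot (toC (c.2 j).2) (toC (c.2 k).2)) (∑ j, ∑ k, cdot (toC (c.2 j).2) (toC (c.2 k).2)) t := by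
    refine HasDerivAt.fun_sum fun j _ => HasDerivAt.fun_sum fun k _ => ?_
    have h3 : HasDerivAt (fun s : ℝ => ((s - max (c.2 j).1 (c.2 k).1 : ℝ) : ℂ)) 1 t := by
      simpa using ((hasDerivAt_id t).sub_const (max (c.2 j).1 (c.2 k).1)).ofReal_comp
    simpa using h3.mul_const (cdot (toC (c.2 j).2) (toC (c.2 k).2))
  refine ((h1.add (h2.const_mul (2 * Complex.I))).sub h3).congr_deriv ?_
  symm
  simp_rw [← cdot_sum_right, ← cdot_sum_left]
  change _ = cdot (θ t) (θ t) + 2 * Complex.I * cdot (momentum c) (θ t) -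
    cdot (momentum c) (momentum c)
  simp only [cdot_add_left, cdot_add_right, cdot_smul_left, cdot_smul_right]
  rw [cdot_comm (θ t) (momentum c)]
  linear_combination cdot (momentum c) (momentum c) * Complex.I_mul_I

theorem hasDerivAt_phase (ht : t ≠ t₀) :
    HasDerivAt (fun s => phase θ t₀ s x x₀ c) (phaseDeriv θ t₀ t x x₀ c) t := by
  have hT : ((t - t₀ : ℝ) : ℂ) ≠ 0 := by exact_mod_cast sub_ne_zero.2 ht
  have hE := (hasDerivAt_shift θ t₀ t c).add_const (toC x - toC x₀)
  have hEE := hasDerivAt_cdot hE hE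
  have hθ : HasDerivAt (fun s => θ s) (deriv θ t) t := θ.differentiableAt.hasDerivAt
  have hxθ := hasDerivAt_cdot (hasDerivAt_const t (toC x)) hθ
  have hinv : HasDerivAt (fun s : ℝ => Complex.I / (2 * ((s - t₀ : ℝ) : ℂ)))
      (-(Complex.I / (2 * ((t - t₀ : ℝ) : ℂ) ^ 2))) t := by
    have h3 : HasDerivAt (fun s : ℝ => ((s - t₀ : ℝ) : ℂ)) 1 t := by
      simpa using ((hasDerivAt_id t).sub_const t₀).ofReal_comp
    refine (((h3.inv hT).const_mul (Complex.I / 2)).congr_deriv ?_).congr_of_eventuallyEq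
      (Eventually.of_forall fun s => ?_)
    · field_simp
    · simp only [Pi.inv_apply]
      rw [div_mul_eq_div_div, div_eq_mul_inv (Complex.I / 2)]
  have hmain := ((((hasDerivAt_action θ t₀ t c).const_mul (-(Complex.I / 2))).add
    (hinv.mul hEE)).add_const (cdot (toC x) (momentum c))).add
    ((hxθ.const_mul Complex.I).const_sub (Complex.I * cdot (toC x₀) (θ t₀)))
  refine (hmain.congr_deriv ?_).congr_of_eventuallyEq (Eventually.of_forall fun s => ?_)
  swap
  · simp only [phase, neg_one_div_two_I_mul]
    rfl
  · rw [phaseDeriv, cdot_zero_left, zero_add]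
    rw [cdot_comm (θ t + Complex.I • momentum c) (shift θ t₀ t c + (toC x - toC x₀))]
    field_simp
    ring

/-- The pointwise free Schrödinger equation satisfied by the phase. -/
theorem phaseDeriv_add_slopeX_sq (ht : t ≠ t₀) :
    Complex.I * phaseDeriv θ t₀ t x x₀ c + 1 / 2 * ∑ i,
      (Complex.I / ((t - t₀ : ℝ) : ℂ) * ((x i - x₀ i : ℝ) : ℂ) + slopeX θ t₀ t c i) ^ 2 =
    cdot (toC x) (deriv θ t) := by
  have hT : ((t - t₀ : ℝ) : ℂ) ≠ 0 := by exact_mod_cast sub_ne_zero.2 ht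
  set E := shift θ t₀ t c + (toC x - toC x₀) with hE
  set ψ := θ t + Complex.I • momentum c with hψ
  -- The x-gradient of the phase is (i/T) E - i ψ, with E the endpoint vector and ψ = θ(t) + i Σ
  -- α_j. The time derivative of the phase involves only the products E·E, E·ψ, ψ·ψ and x·θ'(t), and
  -- the first three cancel against half the square of the gradient.
  have hG : ∑ i, (Complex.I / ((t - t₀ : ℝ) : ℂ) * ((x i - x₀ i : ℝ) : ℂ) + slopeX θ t₀ t c i) ^ 2
      = cdot ((Complex.I / ((t - t₀ : ℝ) : ℂ)) • E - Complex.I • ψ)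
        ((Complex.I / ((t - t₀ : ℝ) : ℂ)) • E - Complex.I • ψ) := by
    unfold cdot
    refine Finset.sum_congr rfl fun i _ => ?_
    have : Complex.I / ((t - t₀ : ℝ) : ℂ) * ((x i - x₀ i : ℝ) : ℂ) + slopeX θ t₀ t c i =
        ((Complex.I / ((t - t₀ : ℝ) : ℂ)) • E - Complex.I • ψ) i := by
      simp only [slopeX, hE, hψ, toC, PiLp.add_apply, PiLp.sub_apply, PiLp.smul_apply, smul_eq_mul]
      push_cast
      linear_combination (momentum c i) * Complex.I_mul_I
    rw [this, sq]
  rw [hG, phaseDeriv, ← hE, ← hψ]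
  simp only [cdot_sub_left, cdot_sub_right, cdot_smul_left, cdot_smul_right]
  rw [cdot_comm ψ E]
  field_simp
  ring_nf
  simp only [Complex.I_sq]
  ring

theorem sum_insertNth_eq_sum_cons {Y E : Type*} [AddCommMonoid E] {n : ℕ} (i : Fin (n + 1)) (y : Y)
    (z : Fin n → Y) (f : Y → E) :
    ∑ j, f ((i.insertNth y z : Fin (n + 1) → Y) j) =
      ∑ j, f ((Fin.cons y z : Fin (n + 1) → Y) j) := by
  rw [Fin.sum_univ_succAbove _ i, Fin.sum_univ_succ]
  simp

theorem sum_cons {Y E : Type*} [AddCommMonoid E] (y : Y) (c : Config Y) (f : Y → E) :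
    ∑ j, f ((Config.cons y c).2 j) = f y + ∑ j, f (c.2 j) := by
  change ∑ j : Fin (c.1 + 1), f ((Fin.cons y c.2 : Fin (c.1 + 1) → Y) j) = _
  rw [Fin.sum_univ_succ]
  simp

/-- The phase is built from sums over points and pairs of points, so the position of a point in the
list is irrelevant. This supplies the symmetry needed to single out the latest point. -/
theorem phase_insertNth {n : ℕ} (i : Fin (n + 1)) (y : ℝ × Space d) (z : Fin n → ℝ × Space d) :
    phase θ t₀ t x x₀ ⟨n + 1, i.insertNth y z⟩ = phase θ t₀ t x x₀ ⟨n + 1, Fin.cons y z⟩ := by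
  have h1 : momentum (⟨n + 1, i.insertNth y z⟩ : Config (ℝ × Space d)) =
      momentum ⟨n + 1, Fin.cons y z⟩ :=
    sum_insertNth_eq_sum_cons i y z fun y => toC y.2
  have h2 : drift t (⟨n + 1, i.insertNth y z⟩ : Config (ℝ × Space d)) =
      drift t ⟨n + 1, Fin.cons y z⟩ :=
    sum_insertNth_eq_sum_cons i y z fun y => ((t - y.1 : ℝ) : ℂ) • toC y.2
  have h3 : action θ t₀ t (⟨n + 1, i.insertNth y z⟩ : Config (ℝ × Space d)) =
      action θ t₀ t ⟨n + 1, Fin.cons y z⟩ := by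
    unfold action
    congr 1
    · congr 2
      exact sum_insertNth_eq_sum_cons i y z fun y => cdot (toC y.2) (∫ s in y.1..t, θ s)
    · refine (Finset.sum_congr rfl fun j _ => sum_insertNth_eq_sum_cons i y z fun y' =>
        ((t - max ((i.insertNth y z : Fin (n + 1) → ℝ × Space d) j).1 y'.1 : ℝ) : ℂ) *
          cdot (toC ((i.insertNth y z : Fin (n + 1) → ℝ × Space d) j).2) (toC y'.2)).trans ?_
      exact sum_insertNth_eq_sum_cons i y z fun y' => ∑ k : Fin (n + 1),
        ((t - max y'.1 ((Fin.cons y z : Fin (n + 1) → ℝ × Space d) k).1 : ℝ) : ℂ) *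
          cdot (toC y'.2) (toC ((Fin.cons y z : Fin (n + 1) → ℝ × Space d) k).2)
  rw [phase, phase, shift, shift, h1, h2, h3]

/-- A point at the final time is invisible to the drift and to the action: t - t = 0, and the
maximum of t with any earlier time is t. Only the total momentum sees it, giving the factor e^{α·x}
from which the potential arises. -/
theorem phase_cons (α : Space d) (hc : c ∈ before t) :
    phase θ t₀ t x x₀ (Config.cons (t, α) c) =
      phase θ t₀ t x x₀ c + ((inner ℝ α x : ℝ) : ℂ) := by
  have h1 : momentum (Config.cons (t, α) c) = toC α + momentum c :=
    sum_cons (t, α) c fun y => toC y.2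
  have h2 : drift t (Config.cons (t, α) c) = drift t c := by
    refine (sum_cons (t, α) c fun y => ((t - y.1 : ℝ) : ℂ) • toC y.2).trans ?_
    simp [drift]
  have h3 : action θ t₀ t (Config.cons (t, α) c) = action θ t₀ t c := by
    unfold action
    congr 1
    · congr 2
      refine (sum_cons (t, α) c fun y => cdot (toC y.2) (∫ s in y.1..t, θ s)).trans ?_
      simp
    · refine (Finset.sum_congr rfl fun j _ => sum_cons (t, α) c fun y' =>
        ((t - max ((Config.cons (t, α) c).2 j).1 y'.1 : ℝ) : ℂ) *
          cdot (toC ((Config.cons (t, α) c).2 j).2) (toC y'.2)).trans ?_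
      refine (sum_cons (t, α) c fun y => ((t - max y.1 t : ℝ) : ℂ) * cdot (toC y.2) (toC α) +
        ∑ k, ((t - max y.1 (c.2 k).1 : ℝ) : ℂ) * cdot (toC y.2) (toC (c.2 k).2)).trans ?_
      have hk : ∀ k, max t (c.2 k).1 = t := fun k => max_eq_left (hc k)
      have hk' : ∀ k, max (c.2 k).1 t = t := fun k => max_eq_right (hc k)
      simp [hk, hk']
  rw [phase, phase, shift, shift, h1, h2, h3, cdot_add_right (toC x) (toC α), cdot_toC,
    real_inner_comm]
  ring

theorem continuous_primitive_left : Continuous fun r => ∫ s in r..t, θ s := by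
  have : (fun r => ∫ s in r..t, θ s) = fun r => -∫ s in t..r, θ s := by
    ext1 r
    exact intervalIntegral.integral_symm _ _
  rw [this]
  exact (intervalIntegral.continuous_primitive
    (fun a b => θ.continuous.intervalIntegrable a b) t).neg

theorem continuous_momentum (n : ℕ) :
    Continuous fun z : Fin n → ℝ × Space d => momentum ⟨n, z⟩ := by
  change Continuous fun z : Fin n → ℝ × Space d => ∑ j : Fin n, toC (z j).2
  exact continuous_finsetSum _ fun j _ =>
    continuous_toC.comp (continuous_snd.comp (continuous_apply j))

theorem continuous_shift (n : ℕ) :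
    Continuous fun z : Fin n → ℝ × Space d => shift θ t₀ t ⟨n, z⟩ := by
  change Continuous fun z : Fin n → ℝ × Space d => (∫ s in t₀..t, θ s) +
    Complex.I • ∑ j : Fin n, ((t - (z j).1 : ℝ) : ℂ) • toC (z j).2
  refine continuous_const.add (Continuous.fun_const_smul (continuous_finsetSum _ fun j _ => ?_) _)
  exact (Complex.continuous_ofReal.comp (continuous_const.sub
    (continuous_fst.comp (continuous_apply j)))).smul
    (continuous_toC.comp (continuous_snd.comp (continuous_apply j)))

theorem continuous_action (n : ℕ) :
    Continuous fun z : Fin n → ℝ × Space d => action θ t₀ t ⟨n, z⟩ := by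
  change Continuous fun z : Fin n → ℝ × Space d => (∫ s in t₀..t, cdot (θ s) (θ s)) +
    2 * Complex.I * ∑ j : Fin n, cdot (toC (z j).2) (∫ s in (z j).1..t, θ s) -
    ∑ j : Fin n, ∑ k : Fin n, ((t - max (z j).1 (z k).1 : ℝ) : ℂ) *
      cdot (toC (z j).2) (toC (z k).2)
  have hα : ∀ j : Fin n, Continuous fun z : Fin n → ℝ × Space d => toC (z j).2 := fun j =>
    continuous_toC.comp (continuous_snd.comp (continuous_apply j))
  have hτ : ∀ j : Fin n, Continuous fun z : Fin n → ℝ × Space d => (z j).1 := fun j =>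
    continuous_fst.comp (continuous_apply j)
  refine (continuous_const.add (continuous_const.mul (continuous_finsetSum _ fun j _ => ?_))).sub
    (continuous_finsetSum _ fun j _ => continuous_finsetSum _ fun k _ => ?_)
  · exact continuous_cdot_comp (hα j) ((continuous_primitive_left θ t).comp (hτ j))
  · exact (Complex.continuous_ofReal.comp (continuous_const.sub ((hτ j).max (hτ k)))).mul
      (continuous_cdot_comp (hα j) (hα k))

theorem continuous_phase (n : ℕ) :
    Continuous fun z : Fin n → ℝ × Space d => phase θ t₀ t x x₀ ⟨n, z⟩ := by
  unfold phase
  have h1 := continuous_action θ t₀ t n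
  have h2 := (continuous_shift θ t₀ t n).add (continuous_const (y := toC x - toC x₀))
  have h3 := continuous_cdot_comp (continuous_const (y := toC x)) (continuous_momentum n)
  exact (((continuous_const.mul h1).add (continuous_const.mul (continuous_cdot_comp h2 h2))).add
    h3).add continuous_const

theorem continuous_phaseDeriv (n : ℕ) :
    Continuous fun z : Fin n → ℝ × Space d => phaseDeriv θ t₀ t x x₀ ⟨n, z⟩ := by
  unfold phaseDeriv
  have h2 := (continuous_shift θ t₀ t n).add (continuous_const (y := toC x - toC x₀))
  have h3 := (continuous_const (y := θ t)).add ((continuous_momentum n).fun_const_smul Complex.I)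
  exact (((continuous_const.mul (continuous_cdot_comp h3 h3)).sub
    (continuous_const.mul (continuous_cdot_comp h2 h2))).add
    (continuous_const.mul (continuous_cdot_comp h2 h3))).sub continuous_const

theorem continuous_slopeX (n : ℕ) :
    Continuous fun z : Fin n → ℝ × Space d => slopeX θ t₀ t ⟨n, z⟩ := by
  unfold slopeX
  exact (((continuous_shift θ t₀ t n).fun_const_smul _).add (continuous_momentum n)).sub
    continuous_const

theorem continuous_slopeY (n : ℕ) :
    Continuous fun z : Fin n → ℝ × Space d => slopeY θ t₀ t ⟨n, z⟩ := by
  unfold slopeY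
  exact ((continuous_shift θ t₀ t n).fun_const_smul _).add continuous_const

theorem continuous_offsetX (n : ℕ) :
    Continuous fun z : Fin n → ℝ × Space d => offsetX θ t₀ t x₀ ⟨n, z⟩ := by
  unfold offsetX
  have h1 := continuous_action θ t₀ t n
  have h2 := continuous_shift θ t₀ t n
  exact (((continuous_const.mul h1).add (continuous_const.mul (continuous_cdot_comp h2 h2))).sub
    (continuous_const.mul (continuous_cdot_comp continuous_const h2))).add continuous_const

theorem continuous_offsetY (n : ℕ) :
    Continuous fun z : Fin n → ℝ × Space d => offsetY θ t₀ t x ⟨n, z⟩ := by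
  unfold offsetY
  have h1 := continuous_action θ t₀ t n
  have h2 := continuous_shift θ t₀ t n
  exact ((((continuous_const.mul h1).add (continuous_const.mul (continuous_cdot_comp h2 h2))).add
    (continuous_const.mul (continuous_cdot_comp continuous_const h2))).add
    (continuous_cdot_comp continuous_const (continuous_momentum n))).sub continuous_const

theorem continuous_cons {Y : Type*} [TopologicalSpace Y] {n : ℕ} (z : Fin n → Y) :
    Continuous fun y : Y => (Fin.cons y z : Fin (n + 1) → Y) := by
  refine continuous_pi fun j => ?_
  refine Fin.cases ?_ (fun j => ?_) j
  · exact continuous_id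
  · simpa using continuous_const

theorem continuous_phase_cons (α : Space d) :
    Continuous fun s => phase θ t₀ t x x₀ (Config.cons (s, α) c) :=
  (continuous_phase θ t₀ t x x₀ (c.1 + 1)).comp
    ((continuous_cons c.2).comp (continuous_id.prodMk continuous_const))

end Phase

/-! ### Exponential bounds on the integrand -/

section Bounds

variable {d : ℕ} {θ : 𝓢(ℝ, CSpace d)} {t₀ t : ℝ} {x x₀ : Space d}
  {c : Config (ℝ × Space d)}

/-- The size `∑ⱼ (1 + |αⱼ|)` of a configuration. -/
def size (c : Config (ℝ × Space d)) : ℝ := ∑ j, (1 + ‖(c.2 j).2‖)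

theorem size_nonneg (c : Config (ℝ × Space d)) : 0 ≤ size c :=
  Finset.sum_nonneg fun _ _ => by positivity

theorem weight_exp_eq (K : ℝ) (c : Config (ℝ × Space d)) :
    weight (fun y : ℝ × Space d => Real.exp (K * (1 + ‖y.2‖))) c = Real.exp (K * size c) := by
  rw [weight, ← Real.exp_sum, size, Finset.mul_sum]

theorem sum_norm_le_size (c : Config (ℝ × Space d)) : ∑ j, ‖toC (c.2 j).2‖ ≤ size c :=
  Finset.sum_le_sum fun j _ => by rw [norm_toC]; linarith

theorem norm_momentum_le (c : Config (ℝ × Space d)) : ‖momentum c‖ ≤ size c :=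
  (norm_sum_le _ _).trans (sum_norm_le_size c)

theorem norm_drift_le {R : ℝ} (hR : ∀ j, |t - (c.2 j).1| ≤ R) (hR0 : 0 ≤ R) :
    ‖drift t c‖ ≤ R * size c := by
  refine (norm_sum_le _ _).trans ?_
  refine le_trans ?_ (mul_le_mul_of_nonneg_left (sum_norm_le_size c) hR0)
  rw [Finset.mul_sum]
  refine Finset.sum_le_sum fun j _ => ?_
  rw [norm_smul, Complex.norm_real, Real.norm_eq_abs]
  exact mul_le_mul_of_nonneg_right (hR j) (norm_nonneg _)

variable {B κ M : ℝ}

theorem norm_integral_le_of_bound (hB : ∀ s, ‖θ s‖ ≤ B) (r : ℝ) :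
    ‖∫ s in r..t, θ s‖ ≤ B * |t - r| :=
  intervalIntegral.norm_integral_le_of_norm_le_const fun s _ => hB s

/-- The bound carries a factor t - t₀, compensating the 1/(t - t₀) in the phase. The ratio κ is 1
when all times lie in [t₀, t]; a larger value serves when t varies over a fixed strip. -/
theorem norm_shift_le (hB : ∀ s, ‖θ s‖ ≤ B) (ht : t₀ < t) (hκ : 0 ≤ κ)
    (hτ : ∀ j, |t - (c.2 j).1| ≤ κ * (t - t₀)) :
    ‖shift θ t₀ t c‖ ≤ (t - t₀) * ((B + κ) * (1 + size c)) := by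
  have hT : 0 < t - t₀ := sub_pos.2 ht
  have hS := size_nonneg c
  have hB0 : 0 ≤ B := (norm_nonneg _).trans (hB 0)
  have h1 := norm_integral_le_of_bound (t := t) hB t₀
  rw [abs_of_pos hT] at h1
  have h2 := norm_drift_le hτ (by positivity)
  calc ‖shift θ t₀ t c‖ ≤ B * (t - t₀) + κ * (t - t₀) * size c := by
        refine (norm_add_le _ _).trans (add_le_add h1 ?_)
        simpa [norm_smul] using h2
    _ ≤ _ := by
        have h3 : 0 ≤ (t - t₀) * (B * size c + κ) := by positivity
        linarith

/-- The constant in the bounds on the slopes and offsets. -/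
def phaseConst (B κ M : ℝ) : ℝ := 2 * M * (B ^ 2 + B * κ) + (2 * B + κ + 1)

theorem norm_I_div_mul_shift (hB : ∀ s, ‖θ s‖ ≤ B) (ht : t₀ < t) (hκ : 0 ≤ κ)
    (hτ : ∀ j, |t - (c.2 j).1| ≤ κ * (t - t₀)) :
    ‖(Complex.I / ((t - t₀ : ℝ) : ℂ)) • shift θ t₀ t c‖ ≤ (B + κ) * (1 + size c) := by
  have hT : 0 < t - t₀ := sub_pos.2 ht
  rw [norm_smul, norm_div, Complex.norm_I, Complex.norm_real, Real.norm_eq_abs, abs_of_pos hT,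
    one_div, inv_mul_le_iff₀ hT]
  exact norm_shift_le hB ht hκ hτ

theorem norm_slopeX_le (hB : ∀ s, ‖θ s‖ ≤ B) (ht : t₀ < t) (htM : t - t₀ ≤ M) (hκ : 0 ≤ κ)
    (hτ : ∀ j, |t - (c.2 j).1| ≤ κ * (t - t₀)) :
    ‖slopeX θ t₀ t c‖ ≤ phaseConst B κ M * (1 + size c) := by
  have hT : 0 < t - t₀ := sub_pos.2 ht
  have hS := size_nonneg c
  have hB0 : 0 ≤ B := (norm_nonneg _).trans (hB 0)
  have hM : 0 ≤ M := hT.le.trans htM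
  have h1 := norm_I_div_mul_shift hB ht hκ hτ
  have h2 := norm_momentum_le c
  have h3 : ‖Complex.I • θ t‖ ≤ B := by simpa [norm_smul] using hB t
  have h4 : ‖slopeX θ t₀ t c‖ ≤ (B + κ) * (1 + size c) + size c + B :=
    (norm_sub_le _ _).trans (add_le_add ((norm_add_le _ _).trans (add_le_add h1 h2)) h3)
  have h5 : 0 ≤ 2 * M * (B ^ 2 + B * κ) * (1 + size c) := by positivity
  have h6 : 0 ≤ B * size c := by positivity
  unfold phaseConst
  linarith

theorem norm_slopeY_le (hB : ∀ s, ‖θ s‖ ≤ B) (ht : t₀ < t) (htM : t - t₀ ≤ M) (hκ : 0 ≤ κ)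
    (hτ : ∀ j, |t - (c.2 j).1| ≤ κ * (t - t₀)) :
    ‖slopeY θ t₀ t c‖ ≤ phaseConst B κ M * (1 + size c) := by
  have hT : 0 < t - t₀ := sub_pos.2 ht
  have hS := size_nonneg c
  have hB0 : 0 ≤ B := (norm_nonneg _).trans (hB 0)
  have hM : 0 ≤ M := hT.le.trans htM
  have h1 := norm_I_div_mul_shift hB ht hκ hτ
  have h3 : ‖Complex.I • θ t₀‖ ≤ B := by simpa [norm_smul] using hB t₀
  have h4 : ‖slopeY θ t₀ t c‖ ≤ (B + κ) * (1 + size c) + B := by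
    refine (norm_add_le _ _).trans (add_le_add ?_ h3)
    rwa [neg_smul, norm_neg]
  have h5 : 0 ≤ 2 * M * (B ^ 2 + B * κ) * (1 + size c) := by positivity
  have h6 : 0 ≤ B * size c := by positivity
  unfold phaseConst
  linarith

/-- The drift is a real vector, so its bilinear square is real. Multiplied by i it affects the phase
only by a unimodular factor, which removes a term quadratic in the α_j from the estimates. -/
theorem cdot_drift_drift_im (t : ℝ) (c : Config (ℝ × Space d)) :
    (cdot (drift t c) (drift t c)).im = 0 := by
  have : drift t c = toC (∑ j, (t - (c.2 j).1) • (c.2 j).2) := by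
    rw [toC_sum]
    exact Finset.sum_congr rfl fun j _ => (toC_smul _ _).symm
  rw [this, cdot_toC, Complex.ofReal_im]

/-- The double sum over pairs is real and drops out of the imaginary part. What remains is at most
linear in the α_j. -/
theorem action_im_le (hB : ∀ s, ‖θ s‖ ≤ B) (ht : t₀ < t) (hκ : 0 ≤ κ)
    (hτ : ∀ j, |t - (c.2 j).1| ≤ κ * (t - t₀)) :
    (action θ t₀ t c).im ≤ (t - t₀) * (B ^ 2 + 2 * (B * κ) * size c) := by
  have hT : 0 < t - t₀ := sub_pos.2 ht
  have hB0 : 0 ≤ B := (norm_nonneg _).trans (hB 0)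
  have h1 : (∫ s in t₀..t, cdot (θ s) (θ s)).im ≤ B ^ 2 * (t - t₀) := by
    refine (Complex.abs_im_le_norm _).trans' (le_abs_self _) |>.trans ?_
    rw [← abs_of_pos hT]
    refine intervalIntegral.norm_integral_le_of_norm_le_const fun s _ => ?_
    refine (norm_cdot_le _ _).trans ?_
    rw [sq]
    exact mul_le_mul (hB s) (hB s) (norm_nonneg _) hB0
  have h2 : (2 * Complex.I * ∑ j, cdot (toC (c.2 j).2) (∫ s in (c.2 j).1..t, θ s)).im ≤
      2 * (size c * (B * (κ * (t - t₀)))) := by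
    refine (Complex.abs_im_le_norm _).trans' (le_abs_self _) |>.trans ?_
    rw [norm_mul, norm_mul, Complex.norm_I, Complex.norm_ofNat, mul_one]
    refine mul_le_mul_of_nonneg_left ?_ zero_le_two
    refine (norm_sum_le _ _).trans ?_
    refine le_trans ?_ (mul_le_mul_of_nonneg_right (sum_norm_le_size c) (by positivity))
    rw [Finset.sum_mul]
    refine Finset.sum_le_sum fun j _ => (norm_cdot_le _ _).trans ?_
    refine mul_le_mul_of_nonneg_left ?_ (norm_nonneg _)
    exact (norm_integral_le_of_bound hB _).trans (mul_le_mul_of_nonneg_left (hτ j) hB0)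
  have h3 : (∑ j, ∑ k, ((t - max (c.2 j).1 (c.2 k).1 : ℝ) : ℂ) *
      cdot (toC (c.2 j).2) (toC (c.2 k).2)).im = 0 := by
    simp_rw [cdot_toC, ← Complex.ofReal_mul, ← Complex.ofReal_sum, Complex.ofReal_im]
  rw [action, Complex.sub_im, Complex.add_im, h3]
  linarith

/-- Only the cross term between ∫ θ and the drift, and the square of ∫ θ, can contribute. Both are
O((t - t₀)²), so the division by t - t₀ is harmless. -/
theorem shift_sq_re_le (hB : ∀ s, ‖θ s‖ ≤ B) (ht : t₀ < t) (hκ : 0 ≤ κ)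
    (hτ : ∀ j, |t - (c.2 j).1| ≤ κ * (t - t₀)) :
    (Complex.I / (2 * ((t - t₀ : ℝ) : ℂ)) * cdot (shift θ t₀ t c) (shift θ t₀ t c)).re ≤
      (t - t₀) / 2 * (B ^ 2 + 2 * (B * κ) * size c) := by
  have hT : 0 < t - t₀ := sub_pos.2 ht
  have hB0 : 0 ≤ B := (norm_nonneg _).trans (hB 0)
  have hS := size_nonneg c
  set Θ := ∫ s in t₀..t, θ s with hΘ
  have h1 : ‖Θ‖ ≤ B * (t - t₀) := by
    simpa [abs_of_pos hT] using norm_integral_le_of_bound (t := t) hB t₀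
  have h2 := norm_drift_le hτ (by positivity)
  have hexp : cdot (shift θ t₀ t c) (shift θ t₀ t c) =
      cdot Θ Θ + 2 * Complex.I * cdot Θ (drift t c) - cdot (drift t c) (drift t c) := by
    simp only [shift, cdot_add_left, cdot_add_right, cdot_smul_left, cdot_smul_right]
    rw [cdot_comm (drift t c) Θ]
    linear_combination cdot (drift t c) (drift t c) * Complex.I_mul_I
  have hre : (Complex.I / (2 * ((t - t₀ : ℝ) : ℂ)) * cdot (shift θ t₀ t c) (shift θ t₀ t c)).re =
      -(1 / (2 * (t - t₀))) * (cdot (shift θ t₀ t c) (shift θ t₀ t c)).im := by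
    have : Complex.I / (2 * ((t - t₀ : ℝ) : ℂ)) = ((1 / (2 * (t - t₀)) : ℝ) : ℂ) * Complex.I := by
      push_cast
      ring
    rw [this, mul_assoc, Complex.re_ofReal_mul, Complex.I_mul_re]
    ring
  rw [hre, hexp, Complex.sub_im, cdot_drift_drift_im, sub_zero]
  have h3 : -(cdot Θ Θ + 2 * Complex.I * cdot Θ (drift t c)).im ≤
      (B * (t - t₀)) ^ 2 + 2 * (B * (t - t₀) * (κ * (t - t₀) * size c)) := by
    refine (neg_le_abs _).trans ((Complex.abs_im_le_norm _).trans ?_)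
    refine (norm_add_le _ _).trans (add_le_add ?_ ?_)
    · refine (norm_cdot_le _ _).trans ?_
      rw [sq]
      exact mul_le_mul h1 h1 (norm_nonneg _) (by positivity)
    · rw [norm_mul, norm_mul, Complex.norm_I, Complex.norm_ofNat, mul_one]
      refine mul_le_mul_of_nonneg_left ?_ zero_le_two
      exact (norm_cdot_le _ _).trans (mul_le_mul h1 h2 (norm_nonneg _) (by positivity))
  calc _ = 1 / (2 * (t - t₀)) * -(cdot Θ Θ + 2 * Complex.I * cdot Θ (drift t c)).im := by ring
    _ ≤ 1 / (2 * (t - t₀)) *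
        ((B * (t - t₀)) ^ 2 + 2 * (B * (t - t₀) * (κ * (t - t₀) * size c))) :=
      mul_le_mul_of_nonneg_left h3 (by positivity)
    _ = _ := by field_simp

theorem action_shift_re_le (hB : ∀ s, ‖θ s‖ ≤ B) (ht : t₀ < t) (htM : t - t₀ ≤ M) (hκ : 0 ≤ κ)
    (hτ : ∀ j, |t - (c.2 j).1| ≤ κ * (t - t₀)) :
    (-(Complex.I / 2) * action θ t₀ t c + Complex.I / (2 * ((t - t₀ : ℝ) : ℂ)) *
      cdot (shift θ t₀ t c) (shift θ t₀ t c)).re ≤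
      2 * M * (B ^ 2 + B * κ) * (1 + size c) := by
  have hT : 0 < t - t₀ := sub_pos.2 ht
  have hB0 : 0 ≤ B := (norm_nonneg _).trans (hB 0)
  have hS := size_nonneg c
  have h1 := action_im_le hB ht hκ hτ
  have h2 := shift_sq_re_le hB ht hκ hτ
  have h3 : (-(Complex.I / 2) * action θ t₀ t c).re = (action θ t₀ t c).im / 2 := by
    have : -(Complex.I / 2) * action θ t₀ t c =
      ((-1 / 2 : ℝ) : ℂ) * (Complex.I * action θ t₀ t c) := by
        push_cast
        ring
    rw [this, Complex.re_ofReal_mul, Complex.I_mul_re]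
    ring
  rw [Complex.add_re, h3]
  have h4 : 0 ≤ B ^ 2 + 2 * (B * κ) * size c := by positivity
  have h5 : (t - t₀) * (B ^ 2 + 2 * (B * κ) * size c) ≤ M * (B ^ 2 + 2 * (B * κ) * size c) :=
    mul_le_mul_of_nonneg_right htM h4
  have hM : 0 ≤ M := hT.le.trans htM
  have h6 : 0 ≤ M * (B ^ 2 + 2 * B ^ 2 * size c + 2 * (B * κ)) := by positivity
  linarith

theorem offsetX_re_le (hB : ∀ s, ‖θ s‖ ≤ B) (ht : t₀ < t) (htM : t - t₀ ≤ M) (hκ : 0 ≤ κ)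
    (hτ : ∀ j, |t - (c.2 j).1| ≤ κ * (t - t₀)) :
    (offsetX θ t₀ t x₀ c).re ≤ phaseConst B κ M * (1 + ‖x₀‖) * (1 + size c) := by
  have hT : 0 < t - t₀ := sub_pos.2 ht
  have hS := size_nonneg c
  have hB0 : 0 ≤ B := (norm_nonneg _).trans (hB 0)
  have hM : 0 ≤ M := hT.le.trans htM
  have h1 := norm_I_div_mul_shift hB ht hκ hτ
  have h2 := action_shift_re_le hB ht htM hκ hτ
  have h3 : (-(Complex.I / ((t - t₀ : ℝ) : ℂ) * cdot (toC x₀) (shift θ t₀ t c))).re ≤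
      ‖x₀‖ * ((B + κ) * (1 + size c)) := by
    refine (Complex.re_le_norm _).trans ?_
    rw [norm_neg, ← cdot_smul_right]
    refine (norm_cdot_le _ _).trans ?_
    rw [norm_toC]
    exact mul_le_mul_of_nonneg_left h1 (norm_nonneg _)
  have h4 : (Complex.I * cdot (toC x₀) (θ t₀)).re ≤ ‖x₀‖ * B := by
    refine (Complex.re_le_norm _).trans ?_
    rw [norm_mul, Complex.norm_I, one_mul]
    refine (norm_cdot_le _ _).trans ?_
    rw [norm_toC]
    exact mul_le_mul_of_nonneg_left (hB _) (norm_nonneg _)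
  rw [offsetX, Complex.add_re, sub_eq_add_neg, Complex.add_re]
  have h5 : 0 ≤ 2 * M * (B ^ 2 + B * κ) * ‖x₀‖ * (1 + size c) := by positivity
  have h6 : 0 ≤ (2 * B + κ + 1) * (1 + size c) + ‖x₀‖ * (B * size c) + ‖x₀‖ * (1 + size c) := by
    positivity
  unfold phaseConst
  linarith

theorem offsetY_re_le (hB : ∀ s, ‖θ s‖ ≤ B) (ht : t₀ < t) (htM : t - t₀ ≤ M) (hκ : 0 ≤ κ)
    (hτ : ∀ j, |t - (c.2 j).1| ≤ κ * (t - t₀)) :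
    (offsetY θ t₀ t x c).re ≤ phaseConst B κ M * (1 + ‖x‖) * (1 + size c) := by
  have hT : 0 < t - t₀ := sub_pos.2 ht
  have hS := size_nonneg c
  have hB0 : 0 ≤ B := (norm_nonneg _).trans (hB 0)
  have hM : 0 ≤ M := hT.le.trans htM
  have h1 := norm_I_div_mul_shift hB ht hκ hτ
  have h2 := action_shift_re_le hB ht htM hκ hτ
  have h3 : (Complex.I / ((t - t₀ : ℝ) : ℂ) * cdot (toC x) (shift θ t₀ t c)).re ≤
      ‖x‖ * ((B + κ) * (1 + size c)) := by
    refine (Complex.re_le_norm _).trans ?_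
    rw [← cdot_smul_right]
    refine (norm_cdot_le _ _).trans ?_
    rw [norm_toC]
    exact mul_le_mul_of_nonneg_left h1 (norm_nonneg _)
  have h7 : (cdot (toC x) (momentum c)).re ≤ ‖x‖ * size c := by
    refine (Complex.re_le_norm _).trans ((norm_cdot_le _ _).trans ?_)
    rw [norm_toC]
    exact mul_le_mul_of_nonneg_left (norm_momentum_le c) (norm_nonneg _)
  have h4 : (-(Complex.I * cdot (toC x) (θ t))).re ≤ ‖x‖ * B := by
    refine (Complex.re_le_norm _).trans ?_
    rw [norm_neg, norm_mul, Complex.norm_I, one_mul]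
    refine (norm_cdot_le _ _).trans ?_
    rw [norm_toC]
    exact mul_le_mul_of_nonneg_left (hB _) (norm_nonneg _)
  rw [offsetY, sub_eq_add_neg, Complex.add_re, Complex.add_re, Complex.add_re]
  have h5 : 0 ≤ 2 * M * (B ^ 2 + B * κ) * ‖x‖ * (1 + size c) := by positivity
  have h6 : 0 ≤ (2 * B + κ + 1) * (1 + size c) + ‖x‖ * (B * size c) + ‖x‖ := by
    positivity
  unfold phaseConst
  linarith

theorem I_div_mul_ofReal_re (T r : ℝ) :
    (Complex.I / (2 * (T : ℂ)) * (r : ℂ)).re = 0 := by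
  have : Complex.I / (2 * (T : ℂ)) * (r : ℂ) = ((r / (2 * T) : ℝ) : ℂ) * Complex.I := by
    push_cast
    ring
  rw [this]
  rw [Complex.re_ofReal_mul, Complex.I_re, mul_zero]

theorem phaseConst_nonneg (hB : 0 ≤ B) (hκ : 0 ≤ κ) (hM : 0 ≤ M) : 0 ≤ phaseConst B κ M := by
  unfold phaseConst
  positivity

/-- The free Gaussian is unimodular, and the affine remainder has a slope and a real offset linear
in the size of the configuration. -/
theorem norm_exp_phase_le (hB : ∀ s, ‖θ s‖ ≤ B) (ht : t₀ < t) (htM : t - t₀ ≤ M) (hκ : 0 ≤ κ)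
    (hτ : ∀ j, |t - (c.2 j).1| ≤ κ * (t - t₀)) :
    ‖Complex.exp (phase θ t₀ t x x₀ c)‖ ≤
      Real.exp (phaseConst B κ M * (1 + ‖x‖ + ‖x₀‖) * (1 + size c)) := by
  rw [Complex.norm_exp, Real.exp_le_exp, phase_eq_slopeX, Complex.add_re, Complex.add_re,
    I_div_mul_ofReal_re]
  have h1 := offsetX_re_le (x₀ := x₀) hB ht htM hκ hτ
  have h2 : (cdot (toC x) (slopeX θ t₀ t c)).re ≤ ‖x‖ * (phaseConst B κ M * (1 + size c)) := by
    refine (Complex.re_le_norm _).trans ((norm_cdot_le _ _).trans ?_)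
    rw [norm_toC]
    exact mul_le_mul_of_nonneg_left (norm_slopeX_le hB ht htM hκ hτ) (norm_nonneg _)
  linarith

theorem one_add_sq_le_exp {s : ℝ} (hs : 0 ≤ s) : (1 + s) ^ 2 ≤ 2 * Real.exp (1 + s) := by
  have := Real.quadratic_le_exp_of_nonneg (show 0 ≤ 1 + s by linarith)
  nlinarith

/-- The time derivative is quadratic in the size and is absorbed into an exponential. The lower
bound l keeps the factors 1/(t - t₀)² under control. -/
theorem exists_norm_phaseDeriv_le (θ : 𝓢(ℝ, CSpace d)) (t₀ : ℝ) (x x₀ : Space d) {l M κ : ℝ}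
    (hl : 0 < l) (hκ : 0 ≤ κ) :
    ∃ D, 0 ≤ D ∧ ∀ t c, l ≤ t - t₀ → t - t₀ ≤ M → (∀ j, |t - (c.2 j).1| ≤ κ * (t - t₀)) →
      ‖phaseDeriv θ t₀ t x x₀ c‖ ≤ D * Real.exp (1 + size c) := by
  obtain ⟨B, hB⟩ : ∃ B, ∀ s, ‖θ s‖ ≤ B := ⟨_, fun s => SchwartzMap.norm_le_seminorm ℝ θ s⟩
  obtain ⟨B', hB'⟩ : ∃ B', ∀ s, ‖deriv θ s‖ ≤ B' :=
    ⟨_, fun s => by simpa using SchwartzMap.norm_le_seminorm ℝ (SchwartzMap.derivCLM ℝ (CSpace d) θ) s⟩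
  have hB0 : 0 ≤ B := (norm_nonneg _).trans (hB 0)
  have hB0' : 0 ≤ B' := (norm_nonneg _).trans (hB' 0)
  set Q : ℝ := |M| * (B + κ) + ‖x‖ + ‖x₀‖ with hQ
  have hQ0 : 0 ≤ Q := by positivity
  set D : ℝ := 1 / 2 * (B + 1) ^ 2 + 1 / (2 * l ^ 2) * Q ^ 2 + 1 / l * (Q * (B + 1)) + ‖x‖ * B'
  have hD0 : 0 ≤ D := by positivity
  refine ⟨2 * D, by positivity, fun t c hlt htM hτ => ?_⟩
  have hS := size_nonneg c
  have ht : t₀ < t := by linarith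
  have hT : 0 < t - t₀ := sub_pos.2 ht
  set S := 1 + size c with hSdef
  have hS1 : 1 ≤ S := by linarith
  have hψ : ‖θ t + Complex.I • momentum c‖ ≤ (B + 1) * S := by
    have h1 : ‖Complex.I • momentum c‖ ≤ size c := by
      simpa [norm_smul] using norm_momentum_le c
    have h2 : 0 ≤ B * size c := by positivity
    calc _ ≤ B + size c := (norm_add_le _ _).trans (add_le_add (hB t) h1)
      _ ≤ _ := by rw [hSdef]; linarith
  have hE : ‖shift θ t₀ t c + (toC x - toC x₀)‖ ≤ Q * S := by
    have h1 := norm_shift_le hB ht hκ hτ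
    have h2 : ‖toC x - toC x₀‖ ≤ ‖x‖ + ‖x₀‖ := by
      rw [← norm_toC x, ← norm_toC x₀]
      exact norm_sub_le _ _
    have h3 : (t - t₀) * ((B + κ) * S) ≤ |M| * ((B + κ) * S) :=
      mul_le_mul_of_nonneg_right (htM.trans (le_abs_self M)) (by positivity)
    have h4 : (‖x‖ + ‖x₀‖) * 1 ≤ (‖x‖ + ‖x₀‖) * S :=
      mul_le_mul_of_nonneg_left hS1 (by positivity)
    calc _ ≤ (t - t₀) * ((B + κ) * S) + (‖x‖ + ‖x₀‖) :=
          (norm_add_le _ _).trans (add_le_add h1 h2)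
      _ ≤ _ := by rw [hQ]; linarith
  have e1 : ‖-(Complex.I / 2) * cdot (θ t + Complex.I • momentum c)
      (θ t + Complex.I • momentum c)‖ ≤ 1 / 2 * (B + 1) ^ 2 * S ^ 2 := by
    rw [norm_mul, norm_neg, norm_div, Complex.norm_I, Complex.norm_ofNat, mul_assoc, ← mul_pow]
    refine mul_le_mul_of_nonneg_left ((norm_cdot_le _ _).trans ?_) (by positivity)
    rw [sq]
    exact mul_le_mul hψ hψ (norm_nonneg _) (by positivity)
  have e2 : ‖Complex.I / (2 * ((t - t₀ : ℝ) : ℂ) ^ 2) * cdot (shift θ t₀ t c + (toC x - toC x₀))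
      (shift θ t₀ t c + (toC x - toC x₀))‖ ≤ 1 / (2 * l ^ 2) * Q ^ 2 * S ^ 2 := by
    rw [norm_mul, norm_div, Complex.norm_I, norm_mul, Complex.norm_ofNat, norm_pow,
      Complex.norm_real, Real.norm_eq_abs, abs_of_pos hT, mul_assoc, ← mul_pow]
    refine mul_le_mul ?_ ((norm_cdot_le _ _).trans ?_) (norm_nonneg _) (by positivity)
    · gcongr
    · rw [sq]
      exact mul_le_mul hE hE (norm_nonneg _) (by positivity)
  have e3 : ‖Complex.I / ((t - t₀ : ℝ) : ℂ) * cdot (shift θ t₀ t c + (toC x - toC x₀))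
      (θ t + Complex.I • momentum c)‖ ≤ 1 / l * (Q * (B + 1)) * S ^ 2 := by
    rw [norm_mul, norm_div, Complex.norm_I, Complex.norm_real, Real.norm_eq_abs, abs_of_pos hT,
      mul_assoc, show Q * (B + 1) * S ^ 2 = (Q * S) * ((B + 1) * S) by ring]
    refine mul_le_mul ?_ ((norm_cdot_le _ _).trans ?_) (norm_nonneg _) (by positivity)
    · gcongr
    · exact mul_le_mul hE hψ (norm_nonneg _) (by positivity)
  have e4 : ‖Complex.I * cdot (toC x) (deriv θ t)‖ ≤ ‖x‖ * B' * S ^ 2 := by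
    rw [norm_mul, Complex.norm_I, one_mul]
    have h1 : ‖cdot (toC x) (deriv θ t)‖ ≤ ‖x‖ * B' := by
      refine (norm_cdot_le _ _).trans ?_
      rw [norm_toC]
      exact mul_le_mul_of_nonneg_left (hB' t) (norm_nonneg _)
    exact h1.trans (le_mul_of_one_le_right (by positivity) (one_le_pow₀ hS1))
  calc ‖phaseDeriv θ t₀ t x x₀ c‖ ≤ D * S ^ 2 := by
        refine (norm_sub_le _ _).trans ?_
        refine (add_le_add ((norm_add_le _ _).trans (add_le_add ((norm_sub_le _ _).trans
          (add_le_add e1 e2)) e3)) e4).trans (le_of_eq ?_)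
        ring
    _ ≤ D * (2 * Real.exp S) := mul_le_mul_of_nonneg_left (one_add_sq_le_exp hS) hD0
    _ = _ := by ring

end Bounds

/-! ### The free evolution of exponentially modulated test functions -/

section Oscillatory

open scoped FourierTransform

variable {d : ℕ}

/-- The normalization `(2πiT)^{-d/2}` of the free kernel. -/
def kernelConst (d : ℕ) (T : ℝ) : ℂ :=
  (2 * (Real.pi : ℂ) * Complex.I * (T : ℂ)) ^ (-(d : ℂ) / 2)

/-- The Fourier transform can be moved from one factor to the other under the integral; here one
factor is a modulated Gaussian, whose transform is a Gaussian centred at a. -/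
theorem integral_gaussian_fourier {ψ : Space d → ℂ} (hψ : Integrable ψ) (a : Space d) {b : ℂ}
    (hb : 0 < b.re) :
    ((Real.pi : ℂ) / b) ^ ((d : ℂ) / 2) *
        ∫ y, Complex.exp (-(Real.pi : ℂ) ^ 2 * ‖y - a‖ ^ 2 / b) * ψ y =
      ∫ k, Complex.exp (-b * ‖k‖ ^ 2 + 2 * Real.pi * Complex.I * (inner ℝ a k : ℝ)) * 𝓕 ψ k := by
  have J : Integrable (fun k : Space d =>
      Complex.exp (-b * ‖k‖ ^ 2 + 2 * Real.pi * Complex.I * (inner ℝ a k : ℝ))) :=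
    GaussianFourier.integrable_cexp_neg_mul_sq_norm_add hb _ _
  have h : ∫ w : Space d, 𝓕 (fun k : Space d =>
      Complex.exp (-b * ‖k‖ ^ 2 + 2 * Real.pi * Complex.I * (inner ℝ a k : ℝ))) w * ψ w =
      ∫ k, Complex.exp (-b * ‖k‖ ^ 2 + 2 * Real.pi * Complex.I * (inner ℝ a k : ℝ)) * 𝓕 ψ k := by
    simpa using! (VectorFourier.integral_fourierIntegral_smul_eq_flip (L := innerₗ (Space d))
      Real.continuous_fourierChar continuous_inner J hψ)
  rw [← h, ← integral_const_mul]
  congr 1 with y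
  rw [fourier_gaussian_innerProductSpace' hb, norm_sub_rev y a]
  simp only [finrank_euclideanSpace, Fintype.card_fin]
  ring

theorem norm_cexp_le_one {z : ℂ} (h : z.re ≤ 0) : ‖Complex.exp z‖ ≤ 1 := by
  rw [Complex.norm_exp]
  exact Real.exp_le_one_iff.2 h

/-- Parseval's identity against the free kernel. -/
theorem kernelConst_mul_integral {ψ : Space d → ℂ} (hψ : Integrable ψ) (hψ' : Integrable (𝓕 ψ))
    (a : Space d) {T : ℝ} (hT : 0 < T) :
    kernelConst d T *
        ∫ y, Complex.exp (Complex.I / (2 * (T : ℂ)) * ((‖y - a‖ ^ 2 : ℝ) : ℂ)) * ψ y =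
      ∫ k, Complex.exp (-(2 * Real.pi ^ 2 * T * Complex.I) * ‖k‖ ^ 2 +
        2 * Real.pi * Complex.I * (inner ℝ a k : ℝ)) * 𝓕 ψ k := by
  -- The oscillatory Gaussian is the boundary case ε = 0 of a Gaussian with complex width of real
  -- part ε > 0. Both sides converge as ε ↓ 0 by dominated convergence, the exponentials having
  -- modulus at most 1.
  set β : ℝ → ℂ := fun ε => (ε : ℂ) + 2 * Real.pi ^ 2 * T * Complex.I with hβ
  have hre : ∀ ε, (β ε).re = ε := by
    intro ε
    simp only [hβ, Complex.add_re, Complex.ofReal_re, Complex.mul_I_re]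
    norm_cast
    simp
  have hpi : (Real.pi : ℂ) ≠ 0 := by exact_mod_cast Real.pi_ne_zero
  have hTc : (T : ℂ) ≠ 0 := by exact_mod_cast hT.ne'
  have hβ0 : β 0 = 2 * Real.pi ^ 2 * T * Complex.I := by simp [hβ]
  have hβ0' : β 0 ≠ 0 := by
    rw [hβ0]
    simp [hpi, hTc]
  have hβc : Continuous β := by fun_prop
  have hβt : Tendsto β (𝓝[>] 0) (𝓝 (β 0)) := (hβc.tendsto 0).mono_left nhdsWithin_le_nhds
  have hpos : ∀ᶠ ε : ℝ in 𝓝[>] 0, 0 < ε := self_mem_nhdsWithin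
  have hconst : ((Real.pi : ℂ) / β 0) ^ ((d : ℂ) / 2) = kernelConst d T := by
    have h1 : (Real.pi : ℂ) / β 0 = (2 * (Real.pi : ℂ) * Complex.I * (T : ℂ))⁻¹ := by
      rw [hβ0]
      field_simp
    -- The principal power commutes with inversion away from the negative real axis; here the
    -- argument is π/2.
    have harg : (2 * (Real.pi : ℂ) * Complex.I * (T : ℂ)).arg ≠ Real.pi := by
      have h2 : 2 * (Real.pi : ℂ) * Complex.I * (T : ℂ) = ((2 * Real.pi * T : ℝ) : ℂ) *
          Complex.I := by push_cast; ring
      rw [h2, Complex.arg_real_mul _ (by positivity), Complex.arg_I]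
      have := Real.pi_pos
      intro h
      linarith
    rw [h1, Complex.inv_cpow _ _ harg, kernelConst, neg_div, Complex.cpow_neg]
  have hslit : (Real.pi : ℂ) / β 0 ∈ Complex.slitPlane := by
    right
    have h1 : (Real.pi : ℂ) / β 0 = ((-(1 / (2 * Real.pi * T)) : ℝ) : ℂ) * Complex.I := by
      rw [hβ0]
      push_cast
      field_simp
      simp
    rw [h1]
    have := Real.pi_pos
    have h2 : (((-(1 / (2 * Real.pi * T)) : ℝ) : ℂ) * Complex.I).im
        = -(1 / (2 * Real.pi * T)) := by simp [-Complex.ofReal_neg, -Complex.ofReal_div]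
    rw [h2]
    have : 0 < 1 / (2 * Real.pi * T) := by positivity
    linarith
  have hL : Tendsto (fun ε => ((Real.pi : ℂ) / β ε) ^ ((d : ℂ) / 2) *
        ∫ y, Complex.exp (-(Real.pi : ℂ) ^ 2 * ‖y - a‖ ^ 2 / β ε) * ψ y) (𝓝[>] 0)
      (𝓝 (((Real.pi : ℂ) / β 0) ^ ((d : ℂ) / 2) *
        ∫ y, Complex.exp (-(Real.pi : ℂ) ^ 2 * ‖y - a‖ ^ 2 / β 0) * ψ y)) := by
    refine Tendsto.mul (((tendsto_const_nhds.div hβt hβ0').cpow tendsto_const_nhds hslit)) ?_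
    refine tendsto_integral_filter_of_dominated_convergence (fun y => ‖ψ y‖) ?_ ?_ hψ.norm ?_
    · exact Eventually.of_forall fun ε =>
        (Continuous.aestronglyMeasurable (by fun_prop)).mul hψ.1
    · filter_upwards [hpos] with ε hε
      refine Eventually.of_forall fun y => ?_
      rw [norm_mul]
      refine mul_le_of_le_one_left (norm_nonneg _) (norm_cexp_le_one ?_)
      have h1 : -(Real.pi : ℂ) ^ 2 * ‖y - a‖ ^ 2 / β ε =
          ((-(Real.pi ^ 2 * ‖y - a‖ ^ 2) : ℝ) : ℂ) * (β ε)⁻¹ := by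
        push_cast
        ring
      rw [h1, Complex.re_ofReal_mul, Complex.inv_re, hre]
      have : 0 ≤ ε / Complex.normSq (β ε) := div_nonneg hε.le (Complex.normSq_nonneg _)
      have h2 : 0 ≤ Real.pi ^ 2 * ‖y - a‖ ^ 2 := by positivity
      nlinarith
    · refine Eventually.of_forall fun y => Tendsto.mul_const _ ?_
      exact (Complex.continuous_exp.tendsto _).comp (tendsto_const_nhds.div hβt hβ0')
  have hR : Tendsto (fun ε => ∫ k, Complex.exp (-(β ε) * ‖k‖ ^ 2 +
        2 * Real.pi * Complex.I * (inner ℝ a k : ℝ)) * 𝓕 ψ k) (𝓝[>] 0)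
      (𝓝 (∫ k, Complex.exp (-(β 0) * ‖k‖ ^ 2 +
        2 * Real.pi * Complex.I * (inner ℝ a k : ℝ)) * 𝓕 ψ k)) := by
    refine tendsto_integral_filter_of_dominated_convergence (fun y => ‖𝓕 ψ y‖) ?_ ?_ hψ'.norm ?_
    · exact Eventually.of_forall fun ε =>
        (Continuous.aestronglyMeasurable (by fun_prop)).mul hψ'.1
    · filter_upwards [hpos] with ε hε
      refine Eventually.of_forall fun y => ?_
      rw [norm_mul]
      refine mul_le_of_le_one_left (norm_nonneg _) (norm_cexp_le_one ?_)
      have h1 : -(β ε) * ‖y‖ ^ 2 + 2 * Real.pi * Complex.I * (inner ℝ a y : ℝ) =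
          ((‖y‖ ^ 2 : ℝ) : ℂ) * (-(β ε)) + ((2 * Real.pi * inner ℝ a y : ℝ) : ℂ) * Complex.I := by
        push_cast
        ring
      rw [h1, Complex.add_re, Complex.re_ofReal_mul, Complex.re_ofReal_mul, Complex.neg_re, hre,
        Complex.I_re]
      have h2 : 0 ≤ ‖y‖ ^ 2 := by positivity
      nlinarith
    · refine Eventually.of_forall fun y => Tendsto.mul_const _ ?_
      exact (Complex.continuous_exp.tendsto _).comp ((hβt.neg.mul_const _).add_const _)
  have huniq := tendsto_nhds_unique hL (hR.congr' (by
    filter_upwards [hpos] with ε hε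
    exact (integral_gaussian_fourier hψ a (by rw [hre]; exact hε)).symm))
  rw [hconst, hβ0] at huniq
  rw [← huniq]
  congr 2 with y
  congr 2
  push_cast
  field_simp
  simp

/-- `y ↦ cdot (toC y) b` as a continuous linear functional on `ℝᵈ`. -/
def pairing (b : CSpace d) : Space d →L[ℝ] ℂ :=
  LinearMap.mkContinuous
    { toFun := fun y => cdot (toC y) b
      map_add' := fun y z => by rw [toC_add, cdot_add_left]
      map_smul' := fun r z => by
        rw [toC_smul, cdot_smul_left]
        simp } ‖b‖ fun y => by
          rw [mul_comm, ← norm_toC y]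
          exact norm_cdot_le _ _

@[simp] theorem pairing_apply (b : CSpace d) (y : Space d) : pairing b y = cdot (toC y) b := rfl

theorem norm_pairing_le (b : CSpace d) : ‖pairing b‖ ≤ ‖b‖ :=
  LinearMap.mkContinuous_norm_le _ (norm_nonneg _) _

theorem norm_cdot_toC_le (y : Space d) (b : CSpace d) : ‖cdot (toC y) b‖ ≤ ‖y‖ * ‖b‖ := by
  rw [← norm_toC y]
  exact norm_cdot_le _ _

/-- The first derivative of a linear map is constant and all higher ones vanish. The form D^i is the
hypothesis of the composition estimate for iterated derivatives. -/
theorem norm_iteratedFDeriv_clm_le {E F : Type*} [NormedAddCommGroup E] [NormedSpace ℝ E]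
    [NormedAddCommGroup F] [NormedSpace ℝ F] (L : E →L[ℝ] F) {D : ℝ} (hD : ‖L‖ ≤ D) {i : ℕ}
    (hi : 1 ≤ i) (x : E) : ‖iteratedFDeriv ℝ i L x‖ ≤ D ^ i := by
  have hD0 : 0 ≤ D := (norm_nonneg _).trans hD
  obtain ⟨j, rfl⟩ : ∃ j, i = j + 1 := ⟨i - 1, by omega⟩
  rw [← norm_iteratedFDeriv_fderiv]
  have : fderiv ℝ L = fun _ => L := by
    ext1 y
    exact L.fderiv
  rw [this]
  cases j with
  | zero => simpa using hD
  | succ j =>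
    rw [iteratedFDeriv_succ_const]
    simp only [Pi.zero_apply, norm_zero]
    positivity

theorem norm_iteratedFDeriv_cexp (i : ℕ) (z : ℂ) :
    ‖iteratedFDeriv ℝ i Complex.exp z‖ = ‖Complex.exp z‖ := by
  have h : ContDiffAt ℂ i Complex.exp z := Complex.contDiff_exp.contDiffAt
  rw [← h.restrictScalars_iteratedFDeriv (𝕜 := ℝ)]
  simp only [Function.comp_apply]
  change ‖(iteratedFDeriv ℂ i Complex.exp z).restrictScalars ℝ‖ = _
  rw [ContinuousMultilinearMap.norm_restrictScalars, norm_iteratedFDeriv_eq_norm_iteratedDeriv,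
    iteratedDeriv_eq_iterate, Complex.iter_deriv_exp]

theorem norm_iteratedFDeriv_cexp_cdot_le (b : CSpace d) (i : ℕ) (y : Space d) :
    ‖iteratedFDeriv ℝ i (fun y => Complex.exp (cdot (toC y) b)) y‖ ≤
      i.factorial * Real.exp (‖y‖ * ‖b‖) * ‖b‖ ^ i := by
  refine norm_iteratedFDeriv_comp_le (g := Complex.exp) (f := pairing b) (N := ∞)
    Complex.contDiff_exp (pairing b).contDiff (mod_cast le_top) y (fun j _ => ?_)
    (fun j hj _ => norm_iteratedFDeriv_clm_le _ (norm_pairing_le b) hj y)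
  rw [norm_iteratedFDeriv_cexp, Complex.norm_exp]
  exact Real.exp_le_exp.2 ((Complex.re_le_norm _).trans (norm_cdot_toC_le y b))

theorem contDiff_cexp_cdot (b : CSpace d) {n : ℕ∞ω} :
    ContDiff ℝ n fun y : Space d => Complex.exp (cdot (toC y) b) :=
  Complex.contDiff_exp.comp (pairing b).contDiff

/-- Derivatives of `e^{b·y} φ(y)` are bounded exponentially in `b`. -/
theorem exists_norm_iteratedFDeriv_exp_mul_le {φ : Space d → ℂ} (hφ : ContDiff ℝ ∞ φ)
    (hc : HasCompactSupport φ) (n : ℕ) :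
    ∃ C, 0 ≤ C ∧ ∀ (b : CSpace d) (y : Space d),
      ‖iteratedFDeriv ℝ n (fun y => Complex.exp (cdot (toC y) b) * φ y) y‖ ≤
        C * Real.exp (C * ‖b‖) * (tsupport φ).indicator (fun _ => 1) y := by
  obtain ⟨R, hR⟩ := hc.isCompact.isBounded.exists_norm_le
  have hM : ∀ i, ∃ M, ∀ y, ‖iteratedFDeriv ℝ i φ y‖ ≤ M := fun i =>
    (hc.iteratedFDeriv i).exists_bound_of_continuous
      (hφ.continuous_iteratedFDeriv (mod_cast le_top))
  choose M hM using hM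
  have hM0 : ∀ i, 0 ≤ M i := fun i => (norm_nonneg _).trans (hM i 0)
  set A : ℝ := ∑ i ∈ Finset.range (n + 1), (n.choose i : ℝ) * i.factorial * i.factorial *
    M (n - i) with hA
  have hA0 : 0 ≤ A := Finset.sum_nonneg fun i _ => by have := hM0 (n - i); positivity
  -- In A, one factor i! comes from the composition estimate and the other from |b|^i ≤ i! e^{|b|}.
  -- In the exponent, |R| bounds the support and the 1 absorbs that e^{|b|}. The maximum lets one
  -- constant play both roles.
  refine ⟨max A (|R| + 1), hA0.trans (le_max_left _ _), fun b y => ?_⟩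
  by_cases hy : y ∈ tsupport φ
  · rw [Set.indicator_of_mem hy, mul_one]
    refine (norm_iteratedFDeriv_mul_le (contDiff_cexp_cdot b) hφ y (mod_cast le_top)).trans ?_
    have h1 : ∀ i ∈ Finset.range (n + 1), (n.choose i : ℝ) *
        ‖iteratedFDeriv ℝ i (fun y => Complex.exp (cdot (toC y) b)) y‖ *
        ‖iteratedFDeriv ℝ (n - i) φ y‖ ≤ (n.choose i : ℝ) * i.factorial * i.factorial *
          M (n - i) * Real.exp ((|R| + 1) * ‖b‖) := by
      intro i _
      have hyR : ‖y‖ ≤ |R| := (hR y hy).trans (le_abs_self R)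
      have h2 : ‖b‖ ^ i ≤ i.factorial * Real.exp ‖b‖ := by
        have := Real.pow_div_factorial_le_exp ‖b‖ (norm_nonneg _) i
        rw [div_le_iff₀ (by positivity)] at this
        linarith
      have h3 : ‖iteratedFDeriv ℝ i (fun y => Complex.exp (cdot (toC y) b)) y‖ ≤
          i.factorial * i.factorial * Real.exp ((|R| + 1) * ‖b‖) := by
        refine (norm_iteratedFDeriv_cexp_cdot_le b i y).trans ?_
        calc (i.factorial : ℝ) * Real.exp (‖y‖ * ‖b‖) * ‖b‖ ^ i
            ≤ i.factorial * Real.exp (|R| * ‖b‖) * (i.factorial * Real.exp ‖b‖) := by gcongr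
          _ = _ := by rw [add_mul, one_mul, Real.exp_add]; ring
      calc _ ≤ (n.choose i : ℝ) * (i.factorial * i.factorial * Real.exp ((|R| + 1) * ‖b‖)) *
            M (n - i) := by
            gcongr
            exact hM _ _
        _ = _ := by ring
    refine (Finset.sum_le_sum h1).trans ?_
    rw [← Finset.sum_mul, ← hA]
    gcongr
    · exact le_max_left _ _
    · exact le_max_right _ _
  · have : iteratedFDeriv ℝ n (fun y => Complex.exp (cdot (toC y) b) * φ y) y = 0 := by
      have hs : y ∉ tsupport (fun y => Complex.exp (cdot (toC y) b) * φ y) := fun h =>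
        hy (closure_mono (Function.support_mul_subset_right _ _) h)
      exact image_eq_zero_of_notMem_tsupport fun h => hs (tsupport_iteratedFDeriv_subset n h)
    rw [this, norm_zero, Set.indicator_of_notMem hy, mul_zero]

/-- Derivatives of order up to d + 1 of e^{b·y} φ(y) are integrable with norms at most exponential
in |b|, and each derivative buys one power of |k|. The exponent d + 1 exceeds the dimension, so the
bound is integrable in k. -/
theorem exists_norm_fourier_exp_mul_le {φ : Space d → ℂ} (hφ : ContDiff ℝ ∞ φ)
    (hc : HasCompactSupport φ) :
    ∃ C, 0 ≤ C ∧ ∀ (b : CSpace d) (k : Space d),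
      ‖𝓕 (fun y => Complex.exp (cdot (toC y) b) * φ y) k‖ ≤
        C * Real.exp (C * ‖b‖) * (1 + ‖k‖) ^ (-((d : ℝ) + 1)) := by
  choose C hC0 hC using exists_norm_iteratedFDeriv_exp_mul_le hφ hc
  have hcd : ∀ b : CSpace d, ContDiff ℝ ∞ (fun y => Complex.exp (cdot (toC y) b) * φ y) :=
    fun b => (contDiff_cexp_cdot b).mul hφ
  have hcs : ∀ b : CSpace d, HasCompactSupport (fun y => Complex.exp (cdot (toC y) b) * φ y) :=
    fun b => hc.mul_left
  set v : ℝ := (volume (tsupport φ)).toReal with hv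
  have hind : Integrable ((tsupport φ).indicator fun _ : Space d => (1 : ℝ)) :=
    (integrable_indicator_iff hc.isClosed.measurableSet).2
      (integrableOn_const hc.isCompact.measure_lt_top.ne)
  have hindv : ∫ y, (tsupport φ).indicator (fun _ : Space d => (1 : ℝ)) y = v := by
    rw [integral_indicator hc.isClosed.measurableSet]
    simp [hv, Measure.real]
  have hint : ∀ (b : CSpace d) (n : ℕ), Integrable (fun y => ‖iteratedFDeriv ℝ n
      (fun y => Complex.exp (cdot (toC y) b) * φ y) y‖) := fun b n =>
    (((hcd b).continuous_iteratedFDeriv (mod_cast le_top)).integrable_of_hasCompactSupport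
      ((hcs b).iteratedFDeriv n)).norm
  have hI : ∀ (b : CSpace d) (n : ℕ), ∫ y, ‖iteratedFDeriv ℝ n
      (fun y => Complex.exp (cdot (toC y) b) * φ y) y‖ ≤ C n * v * Real.exp (C n * ‖b‖) := by
    intro b n
    calc _ ≤ ∫ y, C n * Real.exp (C n * ‖b‖) * (tsupport φ).indicator (fun _ => 1) y :=
          integral_mono (hint b n) (hind.const_mul _) (hC n b)
      _ = _ := by rw [integral_const_mul, hindv]; ring
  have hv0 : 0 ≤ v := ENNReal.toReal_nonneg
  have key : ∀ (N : ℕ) (b : CSpace d) (k : Space d), ‖k‖ ^ N *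
      ‖𝓕 (fun y => Complex.exp (cdot (toC y) b) * φ y) k‖ ≤ 2 ^ N *
        ∑ n ∈ Finset.range (N + 1), C n * v * Real.exp (C n * ‖b‖) := by
    intro N b k
    have h := Real.pow_mul_norm_iteratedFDeriv_fourier_le (K := 0) (N := (⊤ : ℕ∞)) (hcd b)
      (fun k n hk _ => by
        have hk0 : k = 0 := by simpa using hk
        subst hk0
        simpa using hint b n) (k := 0) (n := N) le_rfl (by exact_mod_cast le_top) k
    simp only [norm_iteratedFDeriv_zero, pow_zero, one_mul, Nat.cast_zero, mul_zero, zero_add,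
      Finset.range_one] at h
    refine h.trans ?_
    gcongr
    rw [Finset.singleton_product, Finset.sum_map]
    refine Finset.sum_le_sum fun n _ => ?_
    simpa using hI b n
  set S : ℝ := ∑ n ∈ Finset.range (d + 1 + 1), C n with hS
  have hCS : ∀ n ∈ Finset.range (d + 1 + 1), C n ≤ S := fun n hn =>
    Finset.single_le_sum (fun i _ => hC0 i) hn
  have hS0 : 0 ≤ S := Finset.sum_nonneg fun i _ => hC0 i
  have key2 : ∀ N ≤ d + 1, ∀ (b : CSpace d) (k : Space d), ‖k‖ ^ N *
      ‖𝓕 (fun y => Complex.exp (cdot (toC y) b) * φ y) k‖ ≤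
        2 ^ (d + 1) * (S * v * Real.exp (S * ‖b‖)) := by
    intro N hN b k
    refine (key N b k).trans ?_
    have hsub : Finset.range (N + 1) ⊆ Finset.range (d + 1 + 1) :=
      Finset.range_subset_range.2 (by omega)
    refine mul_le_mul (pow_le_pow_right₀ one_le_two hN) ?_ (Finset.sum_nonneg fun i _ => by
      have := hC0 i; positivity) (by positivity)
    calc _ ≤ ∑ n ∈ Finset.range (N + 1), C n * (v * Real.exp (S * ‖b‖)) := by
          refine Finset.sum_le_sum fun n hn => ?_
          have h1 := hC0 n
          have h2 := hCS n (hsub hn)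
          rw [mul_assoc]
          gcongr
      _ = (∑ n ∈ Finset.range (N + 1), C n) * (v * Real.exp (S * ‖b‖)) :=
          (Finset.sum_mul _ _ _).symm
      _ ≤ S * (v * Real.exp (S * ‖b‖)) := by
          gcongr
          exact Finset.sum_le_sum_of_subset_of_nonneg hsub fun i _ _ => hC0 i
      _ = _ := by ring
  set A : ℝ := 2 ^ (d + 1) * (2 * (2 ^ (d + 1) * (S * v))) with hA
  have hA0 : 0 ≤ A := by positivity
  refine ⟨max A S, hA0.trans (le_max_left _ _), fun b k => ?_⟩
  set F := ‖𝓕 (fun y => Complex.exp (cdot (toC y) b) * φ y) k‖ with hF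
  have hF0 : 0 ≤ F := norm_nonneg _
  have h0 := key2 0 (by omega) b k
  have h1 := key2 (d + 1) le_rfl b k
  rw [← hF] at h0 h1
  -- Only the powers 0 and d + 1 of |k| are controlled separately; this inequality combines them
  -- into decay in 1 + |k|.
  have hpow : (1 + ‖k‖) ^ (d + 1) ≤ 2 ^ (d + 1) * (1 + ‖k‖ ^ (d + 1)) := by
    have hk := norm_nonneg k
    rcases le_total ‖k‖ 1 with hk1 | hk1
    · calc (1 + ‖k‖) ^ (d + 1) ≤ 2 ^ (d + 1) := by gcongr; linarith
        _ ≤ _ := by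
          have : 0 ≤ ‖k‖ ^ (d + 1) := by positivity
          have h2 : (0 : ℝ) < 2 ^ (d + 1) := by positivity
          nlinarith
    · calc (1 + ‖k‖) ^ (d + 1) ≤ (2 * ‖k‖) ^ (d + 1) := by gcongr; linarith
        _ = 2 ^ (d + 1) * ‖k‖ ^ (d + 1) := mul_pow _ _ _
        _ ≤ _ := by gcongr; linarith
  have hmain : (1 + ‖k‖) ^ (d + 1) * F ≤ A * Real.exp (S * ‖b‖) := by
    calc _ ≤ 2 ^ (d + 1) * (1 + ‖k‖ ^ (d + 1)) * F := by gcongr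
      _ = 2 ^ (d + 1) * (‖k‖ ^ 0 * F + ‖k‖ ^ (d + 1) * F) := by ring
      _ ≤ 2 ^ (d + 1) * (2 ^ (d + 1) * (S * v * Real.exp (S * ‖b‖)) +
            2 ^ (d + 1) * (S * v * Real.exp (S * ‖b‖))) := by gcongr
      _ = _ := by rw [hA]; ring
  have hp : (1 + ‖k‖) ^ (-((d : ℝ) + 1)) = ((1 + ‖k‖) ^ (d + 1))⁻¹ := by
    rw [Real.rpow_neg (by positivity), ← Real.rpow_natCast]
    push_cast
    rfl
  rw [hp, ← div_eq_mul_inv, le_div_iff₀ (by positivity), mul_comm F]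
  refine hmain.trans ?_
  gcongr
  · exact le_max_left _ _
  · exact le_max_right _ _

/-- The free evolution of `e^{b·y} φ(y)` evaluated at `a`. -/
def freeEvolution (φ : Space d → ℂ) (T : ℝ) (a : Space d) (b : CSpace d) : ℂ :=
  kernelConst d T * ∫ y, Complex.exp (Complex.I / (2 * (T : ℂ)) * ((‖y - a‖ ^ 2 : ℝ) : ℂ)) *
    (Complex.exp (cdot (toC y) b) * φ y)

theorem continuous_exp_mul {φ : Space d → ℂ} (hφ : ContDiff ℝ ∞ φ) (b : CSpace d) :
    Continuous fun y => Complex.exp (cdot (toC y) b) * φ y :=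
  ((contDiff_cexp_cdot b (n := ∞)).mul hφ).continuous

theorem integrable_exp_mul {φ : Space d → ℂ} (hφ : ContDiff ℝ ∞ φ)
    (hc : HasCompactSupport φ) (b : CSpace d) :
    Integrable fun y => Complex.exp (cdot (toC y) b) * φ y :=
  (continuous_exp_mul hφ b).integrable_of_hasCompactSupport hc.mul_left

theorem integrable_decay : Integrable fun k : Space d => (1 + ‖k‖) ^ (-((d : ℝ) + 1)) :=
  integrable_one_add_norm (by simp)

theorem continuous_fourier_of_integrable {ψ : Space d → ℂ} (hψ : Integrable ψ) :
    Continuous (𝓕 ψ) :=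
  VectorFourier.fourierIntegral_continuous Real.continuous_fourierChar
    (by exact continuous_inner) hψ

theorem integrable_fourier_exp_mul {φ : Space d → ℂ} (hφ : ContDiff ℝ ∞ φ)
    (hc : HasCompactSupport φ) (b : CSpace d) :
    Integrable (𝓕 fun y => Complex.exp (cdot (toC y) b) * φ y) := by
  obtain ⟨C, _, hC⟩ := exists_norm_fourier_exp_mul_le hφ hc
  exact (integrable_decay.const_mul _).mono'
    (continuous_fourier_of_integrable (integrable_exp_mul hφ hc b)).aestronglyMeasurable
    (Eventually.of_forall (hC b))

theorem freeEvolution_eq {φ : Space d → ℂ} (hφ : ContDiff ℝ ∞ φ)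
    (hc : HasCompactSupport φ) {T : ℝ} (hT : 0 < T) (a : Space d) (b : CSpace d) :
    freeEvolution φ T a b = ∫ k, Complex.exp (-(2 * Real.pi ^ 2 * T * Complex.I) * ‖k‖ ^ 2 +
      2 * Real.pi * Complex.I * (inner ℝ a k : ℝ)) *
        𝓕 (fun y => Complex.exp (cdot (toC y) b) * φ y) k :=
  kernelConst_mul_integral (integrable_exp_mul hφ hc b) (integrable_fourier_exp_mul hφ hc b) a hT

theorem norm_freePhase (T : ℝ) (a k : Space d) :
    ‖Complex.exp (-(2 * Real.pi ^ 2 * T * Complex.I) * ‖k‖ ^ 2 +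
      2 * Real.pi * Complex.I * (inner ℝ a k : ℝ))‖ = 1 := by
  rw [show -(2 * Real.pi ^ 2 * T * Complex.I) * ‖k‖ ^ 2 +
      2 * Real.pi * Complex.I * (inner ℝ a k : ℝ) =
      ((-(2 * Real.pi ^ 2 * T) * ‖k‖ ^ 2 + 2 * Real.pi * inner ℝ a k : ℝ) : ℂ) * Complex.I by
    push_cast; ring]
  exact Complex.norm_exp_ofReal_mul_I _

/-- The free evolution of `e^{b·y} φ(y)` is bounded uniformly in time. -/
theorem exists_norm_freeEvolution_le {φ : Space d → ℂ} (hφ : ContDiff ℝ ∞ φ)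
    (hc : HasCompactSupport φ) :
    ∃ C, 0 ≤ C ∧ ∀ T, 0 < T → ∀ (a : Space d) (b : CSpace d),
      ‖freeEvolution φ T a b‖ ≤ C * Real.exp (C * ‖b‖) := by
  obtain ⟨C, hC0, hC⟩ := exists_norm_fourier_exp_mul_le hφ hc
  set A := ∫ k : Space d, (1 + ‖k‖) ^ (-((d : ℝ) + 1)) with hA
  have hA0 : 0 ≤ A := integral_nonneg fun k => by positivity
  refine ⟨max C (C * A), hC0.trans (le_max_left _ _), fun T hT a b => ?_⟩
  rw [freeEvolution_eq hφ hc hT]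
  -- In Fourier variables the evolution is multiplication by a unimodular factor, so the L¹ norm of
  -- the transform is a bound independent of T, although the kernel constant is singular at T = 0
  -- when d > 0.
  calc _ ≤ ∫ k : Space d, C * Real.exp (C * ‖b‖) * (1 + ‖k‖) ^ (-((d : ℝ) + 1)) := by
        refine norm_integral_le_of_norm_le (integrable_decay.const_mul _)
          (Eventually.of_forall fun k => ?_)
        rw [norm_mul, norm_freePhase, one_mul]
        exact hC b k
    _ = C * A * Real.exp (C * ‖b‖) := by rw [integral_const_mul]; ring
    _ ≤ _ := by
        gcongr
        · exact le_max_right _ _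
        · exact le_max_left _ _

/-- For |b| < 1 the integrand is dominated by e^{|y|} |φ(y)|, which is integrable because φ has
compact support. -/
theorem tendsto_fourier_exp_mul {φ : Space d → ℂ} (hφ : ContDiff ℝ ∞ φ)
    (hc : HasCompactSupport φ) (k : Space d) :
    Tendsto (fun b : CSpace d => 𝓕 (fun y => Complex.exp (cdot (toC y) b) * φ y) k) (𝓝 0)
      (𝓝 (𝓕 φ k)) := by
  have hF : ∀ ψ : Space d → ℂ, 𝓕 ψ k = ∫ y, Real.fourierChar (-(inner ℝ y k)) • ψ y :=
    fun ψ => Real.fourier_eq ψ k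
  simp only [hF]
  refine tendsto_integral_filter_of_dominated_convergence
    (fun y => ‖Real.exp ‖y‖ * ‖φ y‖‖) ?_ ?_ ?_ ?_
  · refine Eventually.of_forall fun b => Continuous.aestronglyMeasurable ?_
    have h1 := continuous_exp_mul hφ b
    have h2 : Continuous fun y : Space d => Real.fourierChar (-(inner ℝ y k)) :=
      Real.continuous_fourierChar.comp (by fun_prop)
    exact h2.smul h1
  · have : ∀ᶠ b : CSpace d in 𝓝 0, ‖b‖ < 1 :=
      (continuous_norm.tendsto' _ _ norm_zero).eventually_lt_const one_pos
    filter_upwards [this] with b hb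
    refine Eventually.of_forall fun y => ?_
    rw [Circle.norm_smul, norm_mul, norm_mul, norm_norm, Real.norm_of_nonneg (Real.exp_pos _).le,
      Complex.norm_exp]
    gcongr
    refine (Complex.re_le_norm _).trans ((norm_cdot_toC_le y b).trans ?_)
    exact mul_le_of_le_one_right (norm_nonneg _) hb.le
  · refine Integrable.norm (Continuous.integrable_of_hasCompactSupport ?_ hc.norm.mul_left)
    exact (Real.continuous_exp.comp continuous_norm).mul hφ.continuous.norm
  · refine Eventually.of_forall fun y => ?_
    have h : Tendsto (fun b : CSpace d => Real.fourierChar (-(inner ℝ y k)) •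
        (Complex.exp (cdot (toC y) b) * φ y)) (𝓝 0)
        (𝓝 (Real.fourierChar (-(inner ℝ y k)) • (Complex.exp (cdot (toC y) 0) * φ y))) := by
      refine Continuous.tendsto ?_ 0
      have : Continuous fun b : CSpace d => cdot (toC y) b :=
        continuous_cdot_comp continuous_const continuous_id
      exact ((Complex.continuous_exp.comp this).mul continuous_const).const_smul _
    simpa using h

/-- The free evolution is strongly continuous at time zero. -/
theorem tendsto_freeEvolution {φ : Space d → ℂ} (hφ : ContDiff ℝ ∞ φ)
    (hc : HasCompactSupport φ) (a : Space d) {ι : Type*} {l : Filter ι} [l.IsCountablyGenerated]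
    {T : ι → ℝ} {b : ι → CSpace d} (hT : ∀ᶠ s in l, 0 < T s) (hT0 : Tendsto T l (𝓝 0))
    (hb : Tendsto b l (𝓝 0)) :
    Tendsto (fun s => freeEvolution φ (T s) a (b s)) l (𝓝 (φ a)) := by
  obtain ⟨C, hC0, hC⟩ := exists_norm_fourier_exp_mul_le hφ hc
  have hφi : Integrable φ := hφ.continuous.integrable_of_hasCompactSupport hc
  have h0 : Integrable (𝓕 φ) := by simpa using integrable_fourier_exp_mul hφ hc 0
  -- At T = 0 and b = 0 the Parseval form is the Fourier inversion formula at a.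
  have hval : φ a = ∫ k, Complex.exp (-(2 * Real.pi ^ 2 * ((0 : ℝ) : ℂ) * Complex.I) * ‖k‖ ^ 2 +
      2 * Real.pi * Complex.I * (inner ℝ a k : ℝ)) * 𝓕 φ k := by
    have h1 : 𝓕⁻ (𝓕 φ) a = φ a := by
      rw [hφ.continuous.fourierInv_fourier_eq hφi h0]
    rw [← h1, Real.fourierInv_eq]
    congr 1 with k
    rw [Circle.smul_def, Real.fourierChar_apply, smul_eq_mul, real_inner_comm]
    congr 2
    push_cast
    ring
  rw [hval]
  have hb1 : ∀ᶠ s in l, ‖b s‖ < 1 :=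
    ((continuous_norm.tendsto' _ _ norm_zero).comp hb).eventually_lt_const one_pos
  refine Tendsto.congr' (f₁ := fun s => ∫ k, Complex.exp
      (-(2 * Real.pi ^ 2 * (T s) * Complex.I) * ‖k‖ ^ 2 +
      2 * Real.pi * Complex.I * (inner ℝ a k : ℝ)) *
        𝓕 (fun y => Complex.exp (cdot (toC y) (b s)) * φ y) k) ?_ ?_
  · filter_upwards [hT] with s hs
    exact (freeEvolution_eq hφ hc hs a (b s)).symm
  refine tendsto_integral_filter_of_dominated_convergence
    (fun k => C * Real.exp C * (1 + ‖k‖) ^ (-((d : ℝ) + 1))) ?_ ?_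
    (integrable_decay.const_mul _) ?_
  · exact Eventually.of_forall fun s => (Continuous.aestronglyMeasurable (by fun_prop)).mul
      (integrable_fourier_exp_mul hφ hc _).1
  · filter_upwards [hb1] with s hs
    refine Eventually.of_forall fun k => ?_
    rw [norm_mul, norm_freePhase, one_mul]
    refine (hC _ k).trans ?_
    gcongr
    exact mul_le_of_le_one_right hC0 hs.le
  · refine Eventually.of_forall fun k => Tendsto.mul ?_ ((tendsto_fourier_exp_mul hφ hc k).comp hb)
    refine (Complex.continuous_exp.tendsto _).comp ?_
    have hTc : Tendsto (fun s => ((T s : ℝ) : ℂ)) l (𝓝 ((0 : ℝ) : ℂ)) :=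
      (Complex.continuous_ofReal.tendsto _).comp hT0
    exact ((((hTc.const_mul _).mul_const _).neg).mul_const _).add_const _

end Oscillatory

/-! ### Laplace transforms with all exponential moments, and their products with Gaussians -/

section Laplace

variable {d : ℕ} {Y : Type*} [MeasurableSpace Y] {ρ : Measure Y} {b : Y → CSpace d} {W : Y → ℂ}

theorem pairing_sub (b b' : CSpace d) : pairing b - pairing b' = pairing (b - b') := by
  ext y
  simp [cdot_sub_right]

theorem continuous_pairing : Continuous (pairing : CSpace d → Space d →L[ℝ] ℂ) := by
  refine (LipschitzWith.of_dist_le_mul (K := 1) fun b b' => ?_).continuous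
  rw [dist_eq_norm, dist_eq_norm, pairing_sub, NNReal.coe_one, one_mul]
  exact norm_pairing_le _

/-- The weight `W` has all exponential moments with respect to the frequency `b`. -/
structure HasExpMoments (ρ : Measure Y) (b : Y → CSpace d) (W : Y → ℂ) : Prop where
  measurable_freq : Measurable b
  measurable_weight : Measurable W
  integrable : ∀ K : ℝ, Integrable (fun c => Real.exp (K * ‖b c‖) * ‖W c‖) ρ

/-- The Laplace transform `x ↦ ∫ e^{x·b} W dρ`. -/
def laplace (ρ : Measure Y) (b : Y → CSpace d) (W : Y → ℂ) (x : Space d) : ℂ :=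
  ∫ c, Complex.exp (cdot (toC x) (b c)) * W c ∂ρ

/-- The weight of the derivative of a Laplace transform in direction `v`. -/
def derivWeight (b : Y → CSpace d) (v : Space d) (W : Y → ℂ) (c : Y) : ℂ :=
  cdot (toC v) (b c) * W c

theorem norm_cexp_cdot_toC_le (x : Space d) (z : CSpace d) :
    ‖Complex.exp (cdot (toC x) z)‖ ≤ Real.exp (‖x‖ * ‖z‖) := by
  rw [Complex.norm_exp]
  exact Real.exp_le_exp.2 ((Complex.re_le_norm _).trans (norm_cdot_toC_le x z))

theorem measurable_cdot_toC (v : Space d) (hb : Measurable b) :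
    Measurable fun c => cdot (toC v) (b c) :=
  (continuous_cdot_comp continuous_const continuous_id).measurable.comp hb

theorem HasExpMoments.integrable_laplace (h : HasExpMoments ρ b W) (x : Space d) :
    Integrable (fun c => Complex.exp (cdot (toC x) (b c)) * W c) ρ := by
  refine (h.integrable ‖x‖).mono' ?_ (Eventually.of_forall fun c => ?_)
  · exact ((measurable_cdot_toC x h.measurable_freq).cexp.mul
      h.measurable_weight).aestronglyMeasurable
  · rw [norm_mul]
    gcongr
    exact norm_cexp_cdot_toC_le x _

theorem HasExpMoments.derivWeight (h : HasExpMoments ρ b W) (v : Space d) :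
    HasExpMoments ρ b (derivWeight b v W) := by
  have hm : Measurable (FeynmanPropagator.derivWeight b v W) :=
    (measurable_cdot_toC v h.measurable_freq).mul h.measurable_weight
  refine ⟨h.measurable_freq, hm, fun K => ?_⟩
  refine ((h.integrable (K + 1)).const_mul ‖v‖).mono' ?_ (Eventually.of_forall fun c => ?_)
  · exact ((h.measurable_freq.norm.const_mul K).exp.mul hm.norm).aestronglyMeasurable
  · rw [Real.norm_of_nonneg (by positivity), FeynmanPropagator.derivWeight, norm_mul, add_mul,
      one_mul, Real.exp_add]
    have h1 : ‖b c‖ ≤ Real.exp ‖b c‖ := by linarith [Real.add_one_le_exp ‖b c‖]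
    calc Real.exp (K * ‖b c‖) * (‖cdot (toC v) (b c)‖ * ‖W c‖)
        ≤ Real.exp (K * ‖b c‖) * (‖v‖ * Real.exp ‖b c‖ * ‖W c‖) := by
          gcongr
          exact (norm_cdot_toC_le v _).trans (by gcongr)
      _ = _ := by ring

/-- On the unit ball around x the derivative of the integrand is dominated by an exponential moment:
|y| ≤ |x| + 1 gives one exponential, and |b| ≤ e^{|b|} accounts for the additional 1. -/
theorem hasFDerivAt_laplace (h : HasExpMoments ρ b W) (x : Space d) :
    Integrable (fun c => (Complex.exp (cdot (toC x) (b c)) * W c) • pairing (b c)) ρ ∧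
    HasFDerivAt (laplace ρ b W)
      (∫ c, (Complex.exp (cdot (toC x) (b c)) * W c) • pairing (b c) ∂ρ) x := by
  have hm : ∀ y, Measurable fun c => Complex.exp (cdot (toC y) (b c)) * W c := fun y =>
    (measurable_cdot_toC y h.measurable_freq).cexp.mul h.measurable_weight
  have hm' : AEStronglyMeasurable
      (fun c => (Complex.exp (cdot (toC x) (b c)) * W c) • pairing (b c)) ρ :=
    (hm x).aestronglyMeasurable.smul
      (continuous_pairing.comp_stronglyMeasurable
        h.measurable_freq.stronglyMeasurable).aestronglyMeasurable
  have hbd : ∀ c, ∀ y ∈ Metric.ball x 1,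
      ‖(Complex.exp (cdot (toC y) (b c)) * W c) • pairing (b c)‖ ≤
        Real.exp ((‖x‖ + 1 + 1) * ‖b c‖) * ‖W c‖ := by
    intro c y hy
    have hy' : ‖y‖ ≤ ‖x‖ + 1 := by
      have h1 := norm_sub_norm_le y x
      rw [Metric.mem_ball, dist_eq_norm] at hy
      linarith
    have h1 : ‖b c‖ ≤ Real.exp ‖b c‖ := by linarith [Real.add_one_le_exp ‖b c‖]
    rw [norm_smul, norm_mul, add_mul _ 1, one_mul, Real.exp_add]
    calc ‖Complex.exp (cdot (toC y) (b c))‖ * ‖W c‖ * ‖pairing (b c)‖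
        ≤ Real.exp ((‖x‖ + 1) * ‖b c‖) * ‖W c‖ * Real.exp ‖b c‖ := by
          gcongr
          · exact (norm_cexp_cdot_toC_le y _).trans (by gcongr)
          · exact (norm_pairing_le _).trans h1
      _ = _ := by ring
  refine ⟨(h.integrable _).mono' hm' (Eventually.of_forall fun c =>
    hbd c x (Metric.mem_ball_self one_pos)), ?_⟩
  refine hasFDerivAt_integral_of_dominated_of_fderiv_le
    (F' := fun y c => (Complex.exp (cdot (toC y) (b c)) * W c) • pairing (b c))
    (Metric.ball_mem_nhds x one_pos)
    (Eventually.of_forall fun y => (hm y).aestronglyMeasurable) (h.integrable_laplace x) hm'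
    (Eventually.of_forall hbd) (h.integrable (‖x‖ + 1 + 1))
    (Eventually.of_forall fun c y _ => ?_)
  have h1 : HasFDerivAt (fun y : Space d => Complex.exp (pairing (b c) y))
      (Complex.exp (pairing (b c) y) • pairing (b c)) y := (pairing (b c)).hasFDerivAt.cexp
  refine (h1.mul_const (W c)).congr_fderiv ?_
  ext v
  simp only [pairing_apply, smul_apply, smul_eq_mul]
  ring

theorem differentiable_laplace (h : HasExpMoments ρ b W) : Differentiable ℝ (laplace ρ b W) :=
  fun x => (hasFDerivAt_laplace h x).2.differentiableAt

theorem fderiv_laplace_apply (h : HasExpMoments ρ b W) (x v : Space d) :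
    fderiv ℝ (laplace ρ b W) x v = laplace ρ b (derivWeight b v W) x := by
  obtain ⟨hi, hd⟩ := hasFDerivAt_laplace h x
  rw [hd.fderiv, ContinuousLinearMap.integral_apply hi, laplace]
  congr 1 with c
  simp only [derivWeight, smul_apply, pairing_apply, smul_eq_mul]
  ring

/-- Directional derivatives are again Laplace transforms, with weight multiplied by v·b, and the
class of admissible weights is stable under this operation. Smoothness follows by induction over all
weights at once. -/
theorem contDiff_laplace (h : HasExpMoments ρ b W) (n : ℕ) : ContDiff ℝ n (laplace ρ b W) := by
  induction n generalizing W with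
  | zero => exact contDiff_zero.2 (differentiable_laplace h).continuous
  | succ n ih =>
    push_cast
    refine contDiff_succ_iff_fderiv_apply.2 ⟨differentiable_laplace h, fun hn => ?_, fun v => ?_⟩
    · exact absurd hn (by exact_mod_cast WithTop.coe_ne_top)
    · simp only [fderiv_laplace_apply h]
      exact ih (h.derivWeight v)

/-- A Gaussian times a Laplace transform. -/
def gaussLaplace (ρ : Measure Y) (b : Y → CSpace d) (β : ℂ) (x₀ : Space d) (W : Y → ℂ)
    (x : Space d) : ℂ :=
  Complex.exp (β * ((‖x - x₀‖ ^ 2 : ℝ) : ℂ)) * laplace ρ b W x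

variable (β : ℂ) (x₀ : Space d)

theorem contDiff_gaussLaplace (h : HasExpMoments ρ b W) (n : ℕ) :
    ContDiff ℝ n (gaussLaplace ρ b β x₀ W) := by
  refine ContDiff.mul ?_ (contDiff_laplace h n)
  refine Complex.contDiff_exp.comp (contDiff_const.mul ?_)
  exact Complex.ofRealCLM.contDiff.comp ((contDiff_id.sub contDiff_const).norm_sq ℝ)

theorem fderiv_gaussLaplace_apply (h : HasExpMoments ρ b W) (x v : Space d) :
    fderiv ℝ (gaussLaplace ρ b β x₀ W) x v =
      2 * β * ((inner ℝ (x - x₀) v : ℝ) : ℂ) * gaussLaplace ρ b β x₀ W x +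
        gaussLaplace ρ b β x₀ (derivWeight b v W) x := by
  have h1 : HasFDerivAt (fun y : Space d => ‖y - x₀‖ ^ 2)
      (2 • (innerSL ℝ (x - x₀)).comp (ContinuousLinearMap.id ℝ (Space d))) x :=
    ((hasFDerivAt_id x).sub_const x₀).norm_sq
  have h2 : HasFDerivAt (fun y : Space d => Complex.exp (β * ((‖y - x₀‖ ^ 2 : ℝ) : ℂ))) _ x :=
    ((Complex.ofRealCLM.hasFDerivAt.comp x h1).const_mul β).cexp
  have h3 := h2.mul (differentiable_laplace h x).hasFDerivAt
  have h4 : gaussLaplace ρ b β x₀ W = (fun y : Space d =>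
      Complex.exp (β * ((‖y - x₀‖ ^ 2 : ℝ) : ℂ))) * laplace ρ b W := rfl
  rw [h4, h3.fderiv]
  simp only [Function.comp_apply, add_apply, smul_apply, fderiv_laplace_apply h, gaussLaplace, Pi.mul_apply,
    ContinuousLinearMap.comp_apply, smul_eq_mul, Complex.ofRealCLM_apply, innerSL_apply_apply,
    ContinuousLinearMap.id_apply, nsmul_eq_mul, Complex.ofReal_mul, Nat.cast_ofNat,
    Complex.ofReal_ofNat]
  ring

theorem fderiv_fderiv_gaussLaplace_apply (h : HasExpMoments ρ b W) (x v : Space d) :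
    fderiv ℝ (fderiv ℝ (gaussLaplace ρ b β x₀ W)) x v v =
      (2 * β * ((inner ℝ v v : ℝ) : ℂ) + (2 * β * ((inner ℝ (x - x₀) v : ℝ) : ℂ)) ^ 2) *
          gaussLaplace ρ b β x₀ W x +
        2 * (2 * β * ((inner ℝ (x - x₀) v : ℝ) : ℂ)) *
          gaussLaplace ρ b β x₀ (derivWeight b v W) x +
        gaussLaplace ρ b β x₀ (derivWeight b v (derivWeight b v W)) x := by
  have hd : ∀ {W}, HasExpMoments ρ b W → Differentiable ℝ (gaussLaplace ρ b β x₀ W) :=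
    fun h => (contDiff_gaussLaplace β x₀ h 1).differentiable (by simp)
  have hd2 : DifferentiableAt ℝ (fderiv ℝ (gaussLaplace ρ b β x₀ W)) x :=
    ((contDiff_gaussLaplace β x₀ h 2).fderiv_right (m := 1) (by norm_num)).differentiable
      (by simp) x
  have h1 : fderiv ℝ (fderiv ℝ (gaussLaplace ρ b β x₀ W)) x v v =
      fderiv ℝ (fun y => fderiv ℝ (gaussLaplace ρ b β x₀ W) y v) x v := by
    rw [fderiv_clm_apply hd2 (differentiableAt_const v)]
    simp
  have h2 : HasFDerivAt (fun y : Space d => inner ℝ (y - x₀) v)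
      ((innerSL ℝ v).comp (ContinuousLinearMap.id ℝ (Space d))) x := by
    have := (innerSL ℝ v).hasFDerivAt.comp x ((hasFDerivAt_id x).sub_const x₀)
    refine this.congr_of_eventuallyEq (Eventually.of_forall fun y => ?_)
    simp [real_inner_comm]
  have h3 : HasFDerivAt (fun y : Space d => 2 * β * ((inner ℝ (y - x₀) v : ℝ) : ℂ)) _ x :=
    (Complex.ofRealCLM.hasFDerivAt.comp x h2).const_mul (2 * β)
  have h4 := (h3.mul (hd h x).hasFDerivAt).add (hd (h.derivWeight v) x).hasFDerivAt
  have h5 : (fun y => fderiv ℝ (gaussLaplace ρ b β x₀ W) y v) =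
      (fun y : Space d => 2 * β * ((inner ℝ (y - x₀) v : ℝ) : ℂ)) * gaussLaplace ρ b β x₀ W +
        gaussLaplace ρ b β x₀ (derivWeight b v W) := by
    ext y
    exact fderiv_gaussLaplace_apply β x₀ h y v
  rw [h1, h5, h4.fderiv]
  simp only [add_apply, smul_apply, fderiv_gaussLaplace_apply β x₀ h,
    fderiv_gaussLaplace_apply β x₀ (h.derivWeight v), ContinuousLinearMap.comp_apply, smul_eq_mul,
    Complex.ofRealCLM_apply, innerSL_apply_apply, ContinuousLinearMap.id_apply]
  ring

theorem cdot_toC_basisFun (i : Fin d) (z : CSpace d) :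
    cdot (toC (EuclideanSpace.basisFun (Fin d) ℝ i)) z = z i := by
  simp [cdot, toC, apply_ite (Complex.ofReal)]

/-- The Laplacian of a Gaussian times a Laplace transform. -/
theorem laplacian_gaussLaplace (h : HasExpMoments ρ b W) (x : Space d) :
    (Δ (gaussLaplace ρ b β x₀ W)) x = gaussLaplace ρ b β x₀ (fun c =>
      (2 * d * β + ∑ i, (2 * β * ((x i - x₀ i : ℝ) : ℂ) + b c i) ^ 2) * W c) x := by
  rw [InnerProductSpace.laplacian_eq_iteratedFDeriv_orthonormalBasis _
    (EuclideanSpace.basisFun (Fin d) ℝ)]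
  simp only [iteratedFDeriv_two_apply, Matrix.cons_val_zero, Matrix.cons_val_one,
    fderiv_fderiv_gaussLaplace_apply β x₀ h]
  set e : Fin d → Space d := fun i => EuclideanSpace.basisFun (Fin d) ℝ i with he
  have hee : ∀ i, inner ℝ (e i) (e i) = (1 : ℝ) := fun i => by simp [he]
  have hxe : ∀ i, inner ℝ (x - x₀) (e i) = x i - x₀ i := fun i => by
    simp [he, EuclideanSpace.inner_single_right]
  change ∑ i, ((2 * β * ((inner ℝ (e i) (e i) : ℝ) : ℂ) +
      (2 * β * ((inner ℝ (x - x₀) (e i) : ℝ) : ℂ)) ^ 2) * gaussLaplace ρ b β x₀ W x +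
        2 * (2 * β * ((inner ℝ (x - x₀) (e i) : ℝ) : ℂ)) *
          gaussLaplace ρ b β x₀ (derivWeight b (e i) W) x +
        gaussLaplace ρ b β x₀ (derivWeight b (e i) (derivWeight b (e i) W)) x) = _
  simp only [hee, hxe, gaussLaplace, laplace]
  have hI := h.integrable_laplace x
  have hI1 := fun i => (h.derivWeight (e i)).integrable_laplace x
  have hI2 := fun i => ((h.derivWeight (e i)).derivWeight (e i)).integrable_laplace x
  have hsum : ∀ i, (2 * β + (2 * β * ((x i - x₀ i : ℝ) : ℂ)) ^ 2) *
      (∫ c, Complex.exp (cdot (toC x) (b c)) * W c ∂ρ) +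
      2 * (2 * β * ((x i - x₀ i : ℝ) : ℂ)) *
        (∫ c, Complex.exp (cdot (toC x) (b c)) * derivWeight b (e i) W c ∂ρ) +
      (∫ c, Complex.exp (cdot (toC x) (b c)) *
        derivWeight b (e i) (derivWeight b (e i) W) c ∂ρ) =
      ∫ c, Complex.exp (cdot (toC x) (b c)) *
        ((2 * β + (2 * β * ((x i - x₀ i : ℝ) : ℂ) + b c i) ^ 2) * W c) ∂ρ := by
    intro i
    have h12 : Integrable (fun c => (2 * β + (2 * β * ((x i - x₀ i : ℝ) : ℂ)) ^ 2) *
        (Complex.exp (cdot (toC x) (b c)) * W c) + 2 * (2 * β * ((x i - x₀ i : ℝ) : ℂ)) *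
          (Complex.exp (cdot (toC x) (b c)) * derivWeight b (e i) W c)) ρ :=
      (hI.const_mul _).add ((hI1 i).const_mul _)
    rw [← integral_const_mul, ← integral_const_mul, ← integral_add (hI.const_mul _)
      ((hI1 i).const_mul _), ← integral_add h12 (hI2 i)]
    congr 1 with c
    simp only [derivWeight, he, cdot_toC_basisFun]
    ring
  have hint : ∀ i, Integrable (fun c => Complex.exp (cdot (toC x) (b c)) *
        ((2 * β + (2 * β * ((x i - x₀ i : ℝ) : ℂ) + b c i) ^ 2) * W c)) ρ := by
    intro i
    refine (((hI.const_mul (2 * β + (2 * β * ((x i - x₀ i : ℝ) : ℂ)) ^ 2)).add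
      ((hI1 i).const_mul (2 * (2 * β * ((x i - x₀ i : ℝ) : ℂ))))).add (hI2 i)).congr
      (Eventually.of_forall fun c => ?_)
    simp only [Pi.add_apply, derivWeight, he, cdot_toC_basisFun]
    ring
  calc _ = ∑ i, Complex.exp (β * ((‖x - x₀‖ ^ 2 : ℝ) : ℂ)) *
      ∫ c, Complex.exp (cdot (toC x) (b c)) *
        ((2 * β + (2 * β * ((x i - x₀ i : ℝ) : ℂ) + b c i) ^ 2) * W c) ∂ρ := by
        refine Finset.sum_congr rfl fun i _ => ?_
        rw [← hsum i, Complex.ofReal_one]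
        ring
    _ = _ := by
        rw [← Finset.mul_sum, ← integral_finsetSum _ fun i _ => hint i]
        congr 2 with c
        rw [← Finset.mul_sum, ← Finset.sum_mul, Finset.sum_add_distrib]
        simp only [Finset.sum_const, Finset.card_univ, Fintype.card_fin, nsmul_eq_mul]
        ring

end Laplace

/-! ### Complex weights of configurations and integrability -/

section Amplitude

variable {d : ℕ} {μ : Measure (Space d)} [IsFiniteMeasure μ] {a b : ℝ}

theorem integrable_of_le_exp_size (hμ : ∀ K : ℝ, Integrable (fun α => Real.exp (K * (1 + ‖α‖))) μ)
    {C K : ℝ} {H : Config (ℝ × Space d) → ℂ}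
    (hm : AEStronglyMeasurable H (fock (strip μ a b)))
    (hb : ∀ c ∈ within a b, ‖H c‖ ≤ C * Real.exp (K * size c)) :
    Integrable H (fock (strip μ a b)) :=
  integrable_of_le_weight (w := fun α => Real.exp (K * (1 + ‖α‖))) (C := C)
    (fun _ => (Real.exp_pos _).le) (hμ K) hm fun c hc => by
      rw [weight_exp_eq]
      exact hb c hc

/-- The product of the complex weights `-i g h(αⱼ)` of a configuration. -/
def amplitude (g : ℂ) (h : Space d → ℂ) (c : Config (ℝ × Space d)) : ℂ :=
  ∏ j, (-Complex.I * g * h (c.2 j).2)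

variable {g : ℂ} {h : Space d → ℂ}

theorem amplitude_mk (n : ℕ) (z : Fin n → ℝ × Space d) :
    amplitude g h ⟨n, z⟩ = (-Complex.I * g) ^ n * ∏ j, h (z j).2 := by
  rw [amplitude, Finset.prod_mul_distrib]
  simp

theorem amplitude_cons (y : ℝ × Space d) (c : Config (ℝ × Space d)) :
    amplitude g h (Config.cons y c) = -Complex.I * g * h y.2 * amplitude g h c := by
  change ∏ j : Fin (c.1 + 1), (-Complex.I * g *
    h ((Fin.cons y c.2 : Fin (c.1 + 1) → ℝ × Space d) j).2) = _
  rw [Fin.prod_univ_succ]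
  rfl

@[simp] theorem amplitude_empty : amplitude g h (Config.empty) = 1 := by
  change ∏ j : Fin 0, _ = _
  simp

theorem amplitude_insertNth (n : ℕ) (i : Fin (n + 1)) (y : ℝ × Space d)
    (z : Fin n → ℝ × Space d) :
    amplitude g h ⟨n + 1, i.insertNth y z⟩ = amplitude g h ⟨n + 1, Fin.cons y z⟩ := by
  change ∏ j : Fin (n + 1), (-Complex.I * g *
      h ((i.insertNth y z : Fin (n + 1) → ℝ × Space d) j).2) =
    ∏ j : Fin (n + 1), (-Complex.I * g * h ((Fin.cons y z : Fin (n + 1) → ℝ × Space d) j).2)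
  rw [Fin.prod_univ_succAbove _ i, Fin.prod_univ_succ]
  simp

theorem measurable_amplitude (hh : Measurable h) : Measurable (amplitude g h) :=
  measurable_sigma_iff.2 fun n => by
    change Measurable fun z : Fin n → ℝ × Space d => ∏ j, (-Complex.I * g * h (z j).2)
    exact Finset.measurable_fun_prod _ fun j _ =>
      (hh.comp (measurable_snd.comp (measurable_pi_apply j))).const_mul _

/-- Each point contributes the modulus |g| ≤ e^{|g|} ≤ e^{|g|(1 + |α_j|)}, so the coupling constant
only shifts the exponential rate. -/
theorem norm_amplitude_le (h1 : ∀ α, ‖h α‖ = 1) (c : Config (ℝ × Space d)) :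
    ‖amplitude g h c‖ ≤ Real.exp (‖g‖ * size c) := by
  rw [amplitude, norm_prod, size, Finset.mul_sum, Real.exp_sum]
  refine Finset.prod_le_prod (fun _ _ => norm_nonneg _) fun j _ => ?_
  rw [norm_mul, norm_mul, norm_neg, Complex.norm_I, one_mul, h1, mul_one]
  have h2 : ‖g‖ ≤ Real.exp ‖g‖ := by linarith [Real.add_one_le_exp ‖g‖]
  refine h2.trans (Real.exp_le_exp.2 ?_)
  nlinarith [norm_nonneg g, norm_nonneg (c.2 j).2]

/-- Slope, real offset and logarithm of the amplitude are all bounded linearly in the size, so every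
exponential moment is dominated by a multiplicative weight, whose integral is finite. -/
theorem hasExpMoments_fock (hμ : ∀ K : ℝ, Integrable (fun α => Real.exp (K * (1 + ‖α‖))) μ)
    {s : Config (ℝ × Space d) → CSpace d} {o A : Config (ℝ × Space d) → ℂ} {P Q R : ℝ}
    (hs : Measurable s) (ho : Measurable o) (hA : Measurable A)
    (hsP : ∀ c ∈ within a b, ‖s c‖ ≤ P * (1 + size c))
    (hoQ : ∀ c ∈ within a b, (o c).re ≤ Q * (1 + size c))
    (hAR : ∀ c, ‖A c‖ ≤ Real.exp (R * size c)) :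
    HasExpMoments (fock (strip μ a b)) s fun c => Complex.exp (o c) * A c := by
  have hW : Measurable fun c => Complex.exp (o c) * A c := ho.cexp.mul hA
  refine ⟨hs, hW, fun K => ?_⟩
  have h1 : Integrable (fun c =>
      ((Real.exp (K * ‖s c‖) * ‖Complex.exp (o c) * A c‖ : ℝ) : ℂ)) (fock (strip μ a b)) := by
    refine integrable_of_le_exp_size (C := Real.exp (|K| * P + Q)) (K := |K| * P + Q + R) hμ
      ?_ fun c hc => ?_
    · exact (((hs.norm.const_mul K).exp.mul hW.norm).complex_ofReal).aestronglyMeasurable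
    · rw [Complex.norm_real, Real.norm_of_nonneg (by positivity), norm_mul, Complex.norm_exp]
      have h2 : K * ‖s c‖ ≤ |K| * (P * (1 + size c)) :=
        (mul_le_mul_of_nonneg_right (le_abs_self K) (norm_nonneg _)).trans
          (mul_le_mul_of_nonneg_left (hsP c hc) (abs_nonneg K))
      calc Real.exp (K * ‖s c‖) * (Real.exp (o c).re * ‖A c‖)
          ≤ Real.exp (|K| * (P * (1 + size c))) *
              (Real.exp (Q * (1 + size c)) * Real.exp (R * size c)) := by
            gcongr
            · exact hoQ c hc
            · exact hAR c
        _ = _ := by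
            rw [← Real.exp_add, ← Real.exp_add, ← Real.exp_add]
            congr 1
            ring
  exact h1.re.congr (Eventually.of_forall fun c => Complex.ofReal_re _)

end Amplitude

/-! ### The perturbation series as a configuration integral -/

section Representation

variable {d : ℕ} (θ : 𝓢(ℝ, CSpace d)) (t₀ t : ℝ) (x x₀ : Space d)

theorem abs_sub_le_of_mem_within {c : Config (ℝ × Space d)} (hc : c ∈ within t₀ t) (j : Fin c.1) :
    |t - (c.2 j).1| ≤ 1 * (t - t₀) := by
  have := hc j
  rw [one_mul, abs_of_nonneg (by linarith [this.2])]
  linarith [this.1]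

/-- Uniform control of the coefficients of the phase. -/
theorem exists_phase_bounds {M : ℝ} (hM : 0 ≤ M) :
    ∃ P, 0 ≤ P ∧ ∀ t c, t₀ < t → t - t₀ ≤ M → c ∈ within t₀ t →
      ‖slopeX θ t₀ t c‖ ≤ P * (1 + size c) ∧ ‖slopeY θ t₀ t c‖ ≤ P * (1 + size c) ∧
      (∀ x₀, (offsetX θ t₀ t x₀ c).re ≤ P * (1 + ‖x₀‖) * (1 + size c)) ∧
      ∀ x, (offsetY θ t₀ t x c).re ≤ P * (1 + ‖x‖) * (1 + size c) := by
  obtain ⟨B, hB⟩ : ∃ B, ∀ s, ‖θ s‖ ≤ B := ⟨_, fun s => SchwartzMap.norm_le_seminorm ℝ θ s⟩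
  refine ⟨phaseConst B 1 M, phaseConst_nonneg ((norm_nonneg _).trans (hB 0)) zero_le_one hM,
    fun t c ht htM hc => ?_⟩
  have hτ := abs_sub_le_of_mem_within t₀ t hc
  exact ⟨norm_slopeX_le hB ht htM zero_le_one hτ, norm_slopeY_le hB ht htM zero_le_one hτ,
    fun _ => offsetX_re_le hB ht htM zero_le_one hτ,
    fun _ => offsetY_re_le hB ht htM zero_le_one hτ⟩

theorem measurable_slopeX : Measurable (slopeX θ t₀ t) :=
  measurable_sigma_iff.2 fun n => (continuous_slopeX θ t₀ t n).measurable

theorem measurable_slopeY : Measurable (slopeY θ t₀ t) :=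
  measurable_sigma_iff.2 fun n => (continuous_slopeY θ t₀ t n).measurable

theorem measurable_offsetX : Measurable (offsetX θ t₀ t x₀) :=
  measurable_sigma_iff.2 fun n => (continuous_offsetX θ t₀ t x₀ n).measurable

theorem measurable_offsetY : Measurable (offsetY θ t₀ t x) :=
  measurable_sigma_iff.2 fun n => (continuous_offsetY θ t₀ t x n).measurable

theorem measurable_phase : Measurable (phase θ t₀ t x x₀) :=
  measurable_sigma_iff.2 fun n => (continuous_phase θ t₀ t x x₀ n).measurable

theorem measurable_phaseDeriv : Measurable (phaseDeriv θ t₀ t x x₀) :=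
  measurable_sigma_iff.2 fun n => (continuous_phaseDeriv θ t₀ t x x₀ n).measurable

variable {μ : Measure (Space d)}

theorem integral_exp_phase_eq_gaussLaplaceX (A : Config (ℝ × Space d) → ℂ)
    (ρ : Measure (Config (ℝ × Space d))) :
    ∫ c, Complex.exp (phase θ t₀ t x x₀ c) * A c ∂ρ =
      gaussLaplace ρ (slopeX θ t₀ t) (Complex.I / (2 * ((t - t₀ : ℝ) : ℂ))) x₀
        (fun c => Complex.exp (offsetX θ t₀ t x₀ c) * A c) x := by
  rw [gaussLaplace, laplace, ← integral_const_mul]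
  congr 1 with c
  rw [phase_eq_slopeX, Complex.exp_add, Complex.exp_add]
  ring

theorem integral_exp_phase_eq_gaussLaplaceY (A : Config (ℝ × Space d) → ℂ)
    (ρ : Measure (Config (ℝ × Space d))) :
    ∫ c, Complex.exp (phase θ t₀ t x x₀ c) * A c ∂ρ =
      gaussLaplace ρ (slopeY θ t₀ t) (Complex.I / (2 * ((t - t₀ : ℝ) : ℂ))) x
        (fun c => Complex.exp (offsetY θ t₀ t x c) * A c) x₀ := by
  rw [gaussLaplace, laplace, ← integral_const_mul]
  congr 1 with c
  rw [phase_eq_slopeY, Complex.exp_add, Complex.exp_add]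
  ring

variable [IsFiniteMeasure μ] {t₀ t} {A : Config (ℝ × Space d) → ℂ} {R : ℝ}

theorem hasExpMoments_slopeX (hμ : ∀ K : ℝ, Integrable (fun α => Real.exp (K * (1 + ‖α‖))) μ)
    (ht : t₀ < t) (hA : Measurable A) (hAR : ∀ c, ‖A c‖ ≤ Real.exp (R * size c)) :
    HasExpMoments (fock (strip μ t₀ t)) (slopeX θ t₀ t)
      fun c => Complex.exp (offsetX θ t₀ t x₀ c) * A c := by
  obtain ⟨P, _, hP⟩ := exists_phase_bounds θ t₀ (sub_pos.2 ht).le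
  exact hasExpMoments_fock hμ (measurable_slopeX θ t₀ t) (measurable_offsetX θ t₀ t x₀) hA
    (fun c hc => (hP t c ht le_rfl hc).1) (fun c hc => (hP t c ht le_rfl hc).2.2.1 x₀) hAR

theorem hasExpMoments_slopeY (hμ : ∀ K : ℝ, Integrable (fun α => Real.exp (K * (1 + ‖α‖))) μ)
    (ht : t₀ < t) (hA : Measurable A) (hAR : ∀ c, ‖A c‖ ≤ Real.exp (R * size c)) :
    HasExpMoments (fock (strip μ t₀ t)) (slopeY θ t₀ t)
      fun c => Complex.exp (offsetY θ t₀ t x c) * A c := by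
  obtain ⟨P, _, hP⟩ := exists_phase_bounds θ t₀ (sub_pos.2 ht).le
  exact hasExpMoments_fock hμ (measurable_slopeY θ t₀ t) (measurable_offsetY θ t₀ t x) hA
    (fun c hc => (hP t c ht le_rfl hc).2.1) (fun c hc => (hP t c ht le_rfl hc).2.2.2 x) hAR

theorem integrable_exp_phase (hμ : ∀ K : ℝ, Integrable (fun α => Real.exp (K * (1 + ‖α‖))) μ)
    (ht : t₀ < t) (hA : Measurable A) (hAR : ∀ c, ‖A c‖ ≤ Real.exp (R * size c)) :
    Integrable (fun c => Complex.exp (phase θ t₀ t x x₀ c) * A c) (fock (strip μ t₀ t)) := by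
  refine (((hasExpMoments_slopeX θ x₀ hμ ht hA hAR).integrable_laplace x).const_mul
    (Complex.exp (Complex.I / (2 * ((t - t₀ : ℝ) : ℂ)) * ((‖x - x₀‖ ^ 2 : ℝ) : ℂ)))).congr
    (Eventually.of_forall fun c => ?_)
  simp only []
  rw [phase_eq_slopeX, Complex.exp_add, Complex.exp_add]
  ring

/-- Separating times and frequencies of an ordered configuration. -/
theorem measurePreserving_pi_strip (μ : Measure (Space d)) [IsFiniteMeasure μ] (t₀ t : ℝ) (n : ℕ) :
    MeasurePreserving (MeasurableEquiv.arrowProdEquivProdArrow ℝ (Space d) (Fin n))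
      (Measure.pi fun _ : Fin n => strip μ t₀ t)
      ((volume.restrict (Set.Icc (fun _ : Fin n => t₀) (fun _ : Fin n => t))).prod
        (Measure.pi fun _ : Fin n => μ)) := by
  have h : (volume.restrict (Set.Icc (fun _ : Fin n => t₀) (fun _ : Fin n => t))) =
      Measure.pi fun _ : Fin n => (volume : Measure ℝ).restrict (Set.Icc t₀ t) := by
    rw [← Set.pi_univ_Icc, volume_pi, Measure.restrict_pi_pi]
  rw [h]
  exact measurePreserving_arrowProdEquivProdArrow ℝ (Space d) (Fin n) _ _

/-- The closed form of the action requires all times to lie in [t₀, t], which holds almost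
everywhere for the product of strips. -/
theorem integrand_ae_eq (n : ℕ) :
    (fun z : Fin n → ℝ × Space d => Complex.exp (phase θ t₀ t x x₀ ⟨n, z⟩))
      =ᵐ[Measure.pi fun _ : Fin n => strip μ t₀ t]
    (fun p : (Fin n → ℝ) × (Fin n → Space d) => integrand θ x t x₀ t₀ n p.1 p.2) ∘
      MeasurableEquiv.arrowProdEquivProdArrow ℝ (Space d) (Fin n) := by
  have h : ∀ᵐ z ∂(Measure.pi fun _ : Fin n => strip μ t₀ t), ∀ j, (z j).1 ∈ Set.Icc t₀ t := by
    rw [ae_all_iff]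
    exact fun j => (Measure.quasiMeasurePreserving_eval
      (μ := fun _ : Fin n => strip μ t₀ t) j).ae ae_strip_mem
  filter_upwards [h] with z hz
  exact (integrand_eq_exp_phase θ x x₀ hz).symm

theorem integrable_integrand (hμ : ∀ K : ℝ, Integrable (fun α => Real.exp (K * (1 + ‖α‖))) μ)
    (ht : t₀ < t) (n : ℕ) :
    Integrable (fun p : (Fin n → ℝ) × (Fin n → Space d) => integrand θ x t x₀ t₀ n p.1 p.2)
      ((volume.restrict (Set.Icc (fun _ : Fin n => t₀) (fun _ : Fin n => t))).prod
        (Measure.pi fun _ : Fin n => μ)) := by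
  have h1 := (integrable_fock_iff.1 (integrable_exp_phase θ x x₀ (A := fun _ => 1) (R := 0) hμ ht
    measurable_const (fun c => by simp))).1 n
  simp only [mul_one] at h1
  exact ((measurePreserving_pi_strip μ t₀ t n).integrable_comp_emb
    (MeasurableEquiv.measurableEmbedding _)).1 (h1.congr (integrand_ae_eq θ x x₀ n))

variable {m : ComplexMeasure (Space d)} {g : ℂ} {h : Space d → ℂ}

theorem isFiniteMeasure_variation (hm : ExpMoments m) : IsFiniteMeasure m.variation := by
  refine ⟨?_⟩
  calc m.variation Set.univ = ∫⁻ _, 1 ∂m.variation := by simp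
    _ ≤ ∫⁻ α, ENNReal.ofReal (Real.exp (1 * ‖α‖)) ∂m.variation := by
        refine lintegral_mono fun α => ?_
        rw [← ENNReal.ofReal_one]
        exact ENNReal.ofReal_le_ofReal (Real.one_le_exp (by positivity))
    _ < ⊤ := hm 1 one_pos

theorem integrable_exp_variation (hm : ExpMoments m) [IsFiniteMeasure m.variation] (K : ℝ) :
    Integrable (fun α => Real.exp (K * (1 + ‖α‖))) m.variation := by
  -- The moment hypothesis is available only for positive rates, whereas K may have any sign.
  set L := max K 1 with hL
  have hL0 : 0 < L := lt_of_lt_of_le one_pos (le_max_right _ _)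
  have h1 : Integrable (fun α : Space d => Real.exp (L * ‖α‖)) m.variation := by
    refine ⟨Continuous.aestronglyMeasurable (by fun_prop), ?_⟩
    rw [hasFiniteIntegral_iff_ofReal (Eventually.of_forall fun _ => (Real.exp_pos _).le)]
    exact hm L hL0
  refine (h1.const_mul (Real.exp L)).mono' (Continuous.aestronglyMeasurable (by fun_prop))
    (Eventually.of_forall fun α => ?_)
  rw [Real.norm_of_nonneg (Real.exp_pos _).le, ← Real.exp_add, Real.exp_le_exp]
  have : K ≤ L := le_max_left _ _
  nlinarith [norm_nonneg α]

/-- Fubini merges the integral over the time cube with that over the frequencies. The powers of -i g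
and the unimodular densities form the amplitude, and the 1/n! becomes the weight of the n-point
sector. -/
theorem term_eq [IsFiniteMeasure m.variation] (hm : ExpMoments m)
    (hh : Measurable h) (h1 : ∀ α, ‖h α‖ = 1) (hmh : m = m.variation.withDensityᵥ h)
    (ht : t₀ < t) (n : ℕ) :
    term m g θ x t x₀ t₀ n = kernelConst d (t - t₀) * (((n.factorial : ℝ)⁻¹ : ℝ) •
      ∫ z, Complex.exp (phase θ t₀ t x x₀ ⟨n, z⟩) * amplitude g h ⟨n, z⟩
        ∂(Measure.pi fun _ : Fin n => strip m.variation t₀ t)) := by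
  have hint := integrable_integrand θ x x₀ (integrable_exp_variation hm) ht n
  have hprod : Measurable fun α : Fin n → Space d => ∏ j, h (α j) :=
    Finset.measurable_fun_prod _ fun j _ => hh.comp (measurable_pi_apply j)
  have hint2 : Integrable (fun p : (Fin n → ℝ) × (Fin n → Space d) =>
      integrand θ x t x₀ t₀ n p.1 p.2 * ∏ j, h (p.2 j))
      ((volume.restrict (Set.Icc (fun _ : Fin n => t₀) (fun _ : Fin n => t))).prod
        (Measure.pi fun _ : Fin n => m.variation)) := by
    refine hint.mul_bdd (c := 1) (hprod.comp measurable_snd).aestronglyMeasurable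
      (Eventually.of_forall fun p => ?_)
    simp [norm_prod, h1]
  have h2 : ∫ τ in Set.Icc (fun _ : Fin n => t₀) (fun _ : Fin n => t),
      cintegral (productMeasure m n) (integrand θ x t x₀ t₀ n τ) =
      ∫ z, Complex.exp (phase θ t₀ t x x₀ ⟨n, z⟩) * ∏ j, h (z j).2
        ∂(Measure.pi fun _ : Fin n => strip m.variation t₀ t) := by
    calc _ = ∫ τ in Set.Icc (fun _ : Fin n => t₀) (fun _ : Fin n => t),
        ∫ α, integrand θ x t x₀ t₀ n τ α * ∏ j, h (α j)
          ∂(Measure.pi fun _ : Fin n => m.variation) := by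
          refine integral_congr_ae ?_
          filter_upwards [hint.prod_right_ae] with τ hτ
          exact cintegral_productMeasure m hh h1 hmh n hτ
      _ = ∫ p, integrand θ x t x₀ t₀ n p.1 p.2 * ∏ j, h (p.2 j)
          ∂((volume.restrict (Set.Icc (fun _ : Fin n => t₀) (fun _ : Fin n => t))).prod
            (Measure.pi fun _ : Fin n => m.variation)) := (integral_prod _ hint2).symm
      _ = ∫ z, integrand θ x t x₀ t₀ n (fun j => (z j).1) (fun j => (z j).2) * ∏ j, h (z j).2
          ∂(Measure.pi fun _ : Fin n => strip m.variation t₀ t) :=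
          ((measurePreserving_pi_strip m.variation t₀ t n).integral_comp'
            (fun p : (Fin n → ℝ) × (Fin n → Space d) =>
              integrand θ x t x₀ t₀ n p.1 p.2 * ∏ j, h (p.2 j))).symm
      _ = _ := by
          refine integral_congr_ae ?_
          filter_upwards [integrand_ae_eq (μ := m.variation) θ x x₀ (t₀ := t₀) (t := t) n] with z hz
          rw [hz]
          rfl
  rw [term, h2]
  simp only [amplitude_mk, mul_left_comm _ ((-Complex.I * g) ^ n)]
  rw [integral_const_mul, kernelConst, Complex.real_smul]
  push_cast
  ring

/-- The perturbation series sums to an integral over configurations. -/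
theorem hasSum_term [IsFiniteMeasure m.variation] (hm : ExpMoments m)
    (hh : Measurable h) (h1 : ∀ α, ‖h α‖ = 1) (hmh : m = m.variation.withDensityᵥ h)
    (ht : t₀ < t) :
    HasSum (term m g θ x t x₀ t₀) (kernelConst d (t - t₀) *
      ∫ c, Complex.exp (phase θ t₀ t x x₀ c) * amplitude g h c
        ∂fock (strip m.variation t₀ t)) := by
  have := (hasSum_integral_fock (integrable_exp_phase θ x x₀ (A := amplitude g h)
    (integrable_exp_variation hm) ht (measurable_amplitude hh)
    (norm_amplitude_le h1))).mul_left (kernelConst d (t - t₀))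
  exact this.congr_fun fun n => term_eq θ x x₀ hm hh h1 hmh ht n

end Representation

/-! ### The Schrödinger equation -/

section Schrodinger

variable {d : ℕ} (θ : 𝓢(ℝ, CSpace d)) {t₀ t : ℝ} (x x₀ : Space d) {μ : Measure (Space d)}
  [IsFiniteMeasure μ] {g : ℂ} {h : Space d → ℂ}

theorem integrable_phaseDeriv_mul
    (hμ : ∀ K : ℝ, Integrable (fun α => Real.exp (K * (1 + ‖α‖))) μ)
    (hh : Measurable h) (h1 : ∀ α, ‖h α‖ = 1) (ht : t₀ < t) :
    Integrable (fun c => phaseDeriv θ t₀ t x x₀ c *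
      (Complex.exp (phase θ t₀ t x x₀ c) * amplitude g h c)) (fock (strip μ t₀ t)) := by
  have hT : 0 < t - t₀ := sub_pos.2 ht
  obtain ⟨B, hB⟩ : ∃ B, ∀ s, ‖θ s‖ ≤ B := ⟨_, fun s => SchwartzMap.norm_le_seminorm ℝ θ s⟩
  obtain ⟨D, hD0, hD⟩ := exists_norm_phaseDeriv_le θ t₀ x x₀ (M := t - t₀) hT zero_le_one
  set Q := phaseConst B 1 (t - t₀) * (1 + ‖x‖ + ‖x₀‖) with hQ
  refine integrable_of_le_exp_size (C := D * Real.exp (1 + Q)) (K := 1 + Q + ‖g‖) hμ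
    ((measurable_phaseDeriv θ t₀ t x x₀).mul ((measurable_phase θ t₀ t x x₀).cexp.mul
      (measurable_amplitude hh))).aestronglyMeasurable fun c hc => ?_
  have hτ := abs_sub_le_of_mem_within t₀ t hc
  rw [norm_mul, norm_mul]
  calc _ ≤ D * Real.exp (1 + size c) * (Real.exp (Q * (1 + size c)) *
        Real.exp (‖g‖ * size c)) := by
        gcongr
        · exact hD t c le_rfl le_rfl hτ
        · exact norm_exp_phase_le hB ht le_rfl zero_le_one hτ
        · exact norm_amplitude_le h1 c
    _ = _ := by
        rw [mul_assoc D, mul_assoc D, ← Real.exp_add, ← Real.exp_add, ← Real.exp_add]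
        congr 2
        ring

/-- The time derivative of the configuration integral. -/
theorem hasDerivAt_integral_exp_phase
    (hμ : ∀ K : ℝ, Integrable (fun α => Real.exp (K * (1 + ‖α‖))) μ)
    (hh : Measurable h) (h1 : ∀ α, ‖h α‖ = 1) (ht : t₀ < t) :
    HasDerivAt (fun s => ∫ c, Complex.exp (phase θ t₀ s x x₀ c) * amplitude g h c
        ∂fock (strip μ t₀ s))
      (-Complex.I * g * (∫ α, Complex.exp ((inner ℝ α x : ℝ) : ℂ) * h α ∂μ) *
          (∫ c, Complex.exp (phase θ t₀ t x x₀ c) * amplitude g h c ∂fock (strip μ t₀ t)) +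
        ∫ c, phaseDeriv θ t₀ t x x₀ c *
          (Complex.exp (phase θ t₀ t x x₀ c) * amplitude g h c) ∂fock (strip μ t₀ t)) t := by
  have hT : 0 < t - t₀ := sub_pos.2 ht
  obtain ⟨B, hB⟩ : ∃ B, ∀ s, ‖θ s‖ ≤ B := ⟨_, fun s => SchwartzMap.norm_le_seminorm ℝ θ s⟩
  have hB0 : 0 ≤ B := (norm_nonneg _).trans (hB 0)
  set T := t - t₀ with hTdef
  -- For s in (t - T/2, t + 1) and times in [t₀, t + 1], one has |s - τ| ≤ T + 1 while s - t₀ ≥ T/2;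
  -- κ is the ratio of these two bounds.
  set κ := 2 * (T + 1) / T with hκdef
  have hκ : 0 ≤ κ := by positivity
  obtain ⟨D, hD0, hD⟩ := exists_norm_phaseDeriv_le θ t₀ x x₀ (l := T / 2) (M := T + 1)
    (half_pos hT) hκ
  set Q := phaseConst B κ (T + 1) * (1 + ‖x‖ + ‖x₀‖) with hQ
  have hP0 := phaseConst_nonneg hB0 hκ (M := T + 1) (by positivity)
  have hQ0 : 0 ≤ Q := by positivity
  set Φ : ℝ → Config (ℝ × Space d) → ℂ := fun s c =>
    Complex.exp (phase θ t₀ s x x₀ c) * amplitude g h c with hΦ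
  set Φ' : ℝ → Config (ℝ × Space d) → ℂ := fun s c => phaseDeriv θ t₀ s x x₀ c * Φ s c with hΦ'
  have hmΦ : ∀ s, Measurable (Φ s) := fun s =>
    (measurable_phase θ t₀ s x x₀).cexp.mul (measurable_amplitude hh)
  have hτ : ∀ s ∈ Set.Ioo (t - T / 2) (t + 1), ∀ c : Config (ℝ × Space d), c ∈ within t₀ (t + 1) →
      T / 2 ≤ s - t₀ ∧ s - t₀ ≤ T + 1 ∧ ∀ j, |s - (c.2 j).1| ≤ κ * (s - t₀) := by
    intro s hs c hc
    have hs1 : T / 2 ≤ s - t₀ := by linarith [hs.1]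
    refine ⟨hs1, by linarith [hs.2], fun j => ?_⟩
    have h2 : T + 1 ≤ κ * (s - t₀) := by
      calc T + 1 = κ * (T / 2) := by rw [hκdef]; field_simp
        _ ≤ _ := by gcongr
    refine le_trans ?_ h2
    have h3 := hc j
    rw [abs_le]
    constructor <;> linarith [h3.1, h3.2, hs.2]
  have hbΦ : ∀ s ∈ Set.Ioo (t - T / 2) (t + 1), ∀ c ∈ within t₀ (t + 1),
      ‖Φ s c‖ ≤ Real.exp (Q + (Q + ‖g‖) * size c) := by
    intro s hs c hc
    obtain ⟨ha, hb, hc'⟩ := hτ s hs c hc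
    rw [norm_mul]
    calc _ ≤ Real.exp (Q * (1 + size c)) * Real.exp (‖g‖ * size c) := by
          gcongr
          · exact norm_exp_phase_le hB (by linarith) hb hκ hc'
          · exact norm_amplitude_le h1 c
      _ = _ := by
          rw [← Real.exp_add]
          congr 1
          ring
  -- One constant and one weight must dominate both the integrand and its derivative. The derivative
  -- costs an extra D e^{1 + size}, whence the added 1 in both exponents; D + 1 ≥ 1 makes the
  -- constant valid for the integrand too.
  have main := hasDerivAt_integral_before_param (a := t₀) (b := t + 1) (t := t) (μ := μ)
    (w := fun α => Real.exp ((Q + ‖g‖ + 1) * (1 + ‖α‖))) (C := (D + 1) * Real.exp (Q + 1))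
    (Φ := Φ) (Φ' := Φ') (l := t - T / 2) (u := t + 1) ht (by linarith)
    (fun _ => (Real.exp_pos _).le) (hμ _) (Measurable.exp (by fun_prop)) hmΦ
    ((measurable_phaseDeriv θ t₀ t x x₀).mul (hmΦ t))
    (fun n i y z => by
      simp only [hΦ]
      rw [phase_insertNth, amplitude_insertNth]) (by linarith) (by linarith)
    (fun s hs c hc => by
      rw [weight_exp_eq]
      refine (hbΦ s hs c hc).trans ?_
      have hS := size_nonneg c
      calc Real.exp (Q + (Q + ‖g‖) * size c)
          ≤ 1 * Real.exp (Q + 1 + (Q + ‖g‖ + 1) * size c) := by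
            rw [one_mul]
            exact Real.exp_le_exp.2 (by nlinarith)
        _ ≤ (D + 1) * Real.exp (Q + 1 + (Q + ‖g‖ + 1) * size c) := by
            gcongr
            linarith
        _ = _ := by rw [Real.exp_add]; ring)
    (fun s hs c hc => by
      rw [weight_exp_eq]
      obtain ⟨ha, hb, hc'⟩ := hτ s hs c hc
      rw [norm_mul]
      calc _ ≤ D * Real.exp (1 + size c) * Real.exp (Q + (Q + ‖g‖) * size c) := by
            gcongr
            · exact hD s c ha hb hc'
            · exact hbΦ s hs c hc
        _ ≤ (D + 1) * Real.exp (1 + size c) * Real.exp (Q + (Q + ‖g‖) * size c) := by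
            gcongr
            linarith
        _ = _ := by
            rw [mul_assoc, mul_assoc, ← Real.exp_add, ← Real.exp_add]
            congr 2
            ring)
    (fun s hs c _ => by
      have hs0 : s ≠ t₀ := by
        have := hs.1
        intro h0
        rw [h0] at this
        linarith
      refine ((hasDerivAt_phase θ t₀ s x x₀ c hs0).cexp.mul_const _).congr_deriv ?_
      simp only [hΦ', hΦ]
      ring)
    (fun α c => by
      simp only [hΦ, amplitude_cons]
      exact (((continuous_phase_cons θ t₀ t x x₀ c α).cexp).mul continuous_const).continuousAt)
  -- The strip [t₀, t + 1] is a fixed reference; restricting it to times at most s recovers the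
  -- measure of the strip [t₀, s] for every s < t + 1.
  have hrestr : (fock (strip μ t₀ (t + 1))).restrict (before t) = fock (strip μ t₀ t) :=
    fock_strip_restrict (by linarith)
  have hbd : (∫ α, ∫ c in before t, Φ t (Config.cons (t, α) c) ∂fock (strip μ t₀ (t + 1)) ∂μ) =
      -Complex.I * g * (∫ α, Complex.exp ((inner ℝ α x : ℝ) : ℂ) * h α ∂μ) *
        ∫ c, Φ t c ∂fock (strip μ t₀ t) := by
    have hα : ∀ α, ∫ c in before t, Φ t (Config.cons (t, α) c) ∂fock (strip μ t₀ (t + 1)) =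
        (-Complex.I * g) * (Complex.exp ((inner ℝ α x : ℝ) : ℂ) * h α) *
          ∫ c, Φ t c ∂fock (strip μ t₀ t) := by
      intro α
      rw [← hrestr, ← integral_const_mul]
      refine setIntegral_congr_fun (measurableSet_before t) fun c hc => ?_
      simp only [hΦ, amplitude_cons]
      rw [phase_cons θ t₀ t x x₀ c α hc, Complex.exp_add]
      ring
    simp only [hα]
    rw [integral_mul_const, integral_const_mul]
  rw [hbd, hrestr] at main
  refine main.congr_of_eventuallyEq ?_
  filter_upwards [Iio_mem_nhds (show t < t + 1 by linarith)] with s hs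
  simp only [hΦ]
  rw [fock_strip_restrict (le_of_lt hs)]

/-- The base lies on the positive imaginary axis, inside the domain where the principal power is
holomorphic. The factor -d/(2T) cancels the contribution of the quadratic phase to the Laplacian. -/
theorem hasDerivAt_kernelConst (d : ℕ) {t₀ t : ℝ} (ht : t₀ < t) :
    HasDerivAt (fun s => kernelConst d (s - t₀))
      (-(d : ℂ) / (2 * ((t - t₀ : ℝ) : ℂ)) * kernelConst d (t - t₀)) t := by
  have hT : 0 < t - t₀ := sub_pos.2 ht
  have hTc : ((t - t₀ : ℝ) : ℂ) ≠ 0 := by exact_mod_cast hT.ne'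
  have h1 : HasDerivAt (fun z : ℂ => 2 * (Real.pi : ℂ) * Complex.I * (z - (t₀ : ℂ)))
      (2 * (Real.pi : ℂ) * Complex.I) (t : ℂ) := by
    simpa using ((hasDerivAt_id (t : ℂ)).sub_const (t₀ : ℂ)).const_mul
      (2 * (Real.pi : ℂ) * Complex.I)
  have hval : 2 * (Real.pi : ℂ) * Complex.I * ((t : ℂ) - (t₀ : ℂ)) =
      ((2 * Real.pi * (t - t₀) : ℝ) : ℂ) * Complex.I := by
    push_cast
    ring
  have hpos : 0 < 2 * Real.pi * (t - t₀) := by have := Real.pi_pos; positivity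
  have hslit : 2 * (Real.pi : ℂ) * Complex.I * ((t : ℂ) - (t₀ : ℂ)) ∈ Complex.slitPlane := by
    right
    rw [hval, Complex.im_ofReal_mul, Complex.I_im, mul_one]
    exact hpos.ne'
  have h2 := (h1.cpow_const (c := -(d : ℂ) / 2) hslit).comp_ofReal
  have hpi : (Real.pi : ℂ) ≠ 0 := by exact_mod_cast Real.pi_ne_zero
  refine (h2.congr_of_eventuallyEq (Eventually.of_forall fun s => ?_)).congr_deriv ?_
  · simp only [kernelConst]
    push_cast
    rfl
  · rw [kernelConst, Complex.cpow_sub _ _ (Complex.slitPlane_ne_zero hslit), Complex.cpow_one]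
    push_cast at hTc ⊢
    field_simp

variable {m : ComplexMeasure (Space d)}

theorem propagator_eq [IsFiniteMeasure m.variation] (hm : ExpMoments m)
    (hh : Measurable h) (h1 : ∀ α, ‖h α‖ = 1) (hmh : m = m.variation.withDensityᵥ h)
    (ht : t₀ < t) :
    propagator m g θ x t x₀ t₀ = kernelConst d (t - t₀) *
      ∫ c, Complex.exp (phase θ t₀ t x x₀ c) * amplitude g h c
        ∂fock (strip m.variation t₀ t) :=
  (hasSum_term θ x x₀ hm hh h1 hmh ht).tsum_eq

theorem potential_eq [IsFiniteMeasure m.variation] (hm : ExpMoments m)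
    (hh : Measurable h) (h1 : ∀ α, ‖h α‖ = 1) (hmh : m = m.variation.withDensityᵥ h) :
    potential m x = ∫ α, Complex.exp ((inner ℝ α x : ℝ) : ℂ) * h α ∂m.variation := by
  have hint : Integrable (fun α => Complex.exp ((inner ℝ α x : ℝ) : ℂ)) m.variation := by
    refine (integrable_exp_variation hm ‖x‖).mono' (Continuous.aestronglyMeasurable (by fun_prop))
      (Eventually.of_forall fun α => ?_)
    rw [Complex.norm_exp, Complex.ofReal_re, Real.exp_le_exp]
    nlinarith [real_inner_le_norm α x, norm_nonneg α, norm_nonneg x]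
  rw [potential]
  conv_lhs => rw [hmh]
  exact cintegral_withDensityᵥ hh h1 hint

theorem gaussLaplace_const_mul {Y : Type*} [MeasurableSpace Y] (ρ : Measure Y) (b : Y → CSpace d)
    (β : ℂ) (x₀ : Space d) (W : Y → ℂ) (x : Space d) (r : ℂ) :
    gaussLaplace ρ b β x₀ (fun c => r * W c) x = r * gaussLaplace ρ b β x₀ W x := by
  simp only [gaussLaplace, laplace, mul_left_comm _ r]
  rw [integral_const_mul]
  ring

/-- The propagator as a function of the endpoint. -/
theorem propagator_eq_gaussLaplaceX [IsFiniteMeasure m.variation] (hm : ExpMoments m)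
    (hh : Measurable h) (h1 : ∀ α, ‖h α‖ = 1) (hmh : m = m.variation.withDensityᵥ h)
    (ht : t₀ < t) :
    (fun y => propagator m g θ y t x₀ t₀) = fun y => kernelConst d (t - t₀) *
      gaussLaplace (fock (strip m.variation t₀ t)) (slopeX θ t₀ t)
        (Complex.I / (2 * ((t - t₀ : ℝ) : ℂ))) x₀
        (fun c => Complex.exp (offsetX θ t₀ t x₀ c) * amplitude g h c) y := by
  ext y
  rw [propagator_eq θ y x₀ hm hh h1 hmh ht, integral_exp_phase_eq_gaussLaplaceX]

/-- The propagator as a function of the starting point. -/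
theorem propagator_eq_gaussLaplaceY [IsFiniteMeasure m.variation] (hm : ExpMoments m)
    (hh : Measurable h) (h1 : ∀ α, ‖h α‖ = 1) (hmh : m = m.variation.withDensityᵥ h)
    (ht : t₀ < t) :
    (fun y => propagator m g θ x t y t₀) = fun y => kernelConst d (t - t₀) *
      gaussLaplace (fock (strip m.variation t₀ t)) (slopeY θ t₀ t)
        (Complex.I / (2 * ((t - t₀ : ℝ) : ℂ))) x
        (fun c => Complex.exp (offsetY θ t₀ t x c) * amplitude g h c) y := by
  ext y
  rw [propagator_eq θ x y hm hh h1 hmh ht, integral_exp_phase_eq_gaussLaplaceY]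

theorem HasExpMoments.const_mul {Y : Type*} [MeasurableSpace Y] {ρ : Measure Y}
    {b : Y → CSpace d} {W : Y → ℂ} (hW : HasExpMoments ρ b W) (r : ℂ) :
    HasExpMoments ρ b fun c => r * W c := by
  refine ⟨hW.measurable_freq, hW.measurable_weight.const_mul r, fun K => ?_⟩
  refine ((hW.integrable K).const_mul ‖r‖).congr (Eventually.of_forall fun c => ?_)
  simp only [norm_mul]
  ring

theorem contDiff_propagator [IsFiniteMeasure m.variation] (hm : ExpMoments m)
    (hh : Measurable h) (h1 : ∀ α, ‖h α‖ = 1) (hmh : m = m.variation.withDensityᵥ h)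
    (ht : t₀ < t) : ContDiff ℝ 2 (fun y => propagator m g θ y t x₀ t₀) := by
  rw [propagator_eq_gaussLaplaceX θ x₀ hm hh h1 hmh ht]
  exact contDiff_const.mul (contDiff_gaussLaplace _ _ (hasExpMoments_slopeX θ x₀
    (integrable_exp_variation hm) ht (measurable_amplitude hh) (norm_amplitude_le h1)) 2)

/-- Under the integral, the Laplacian multiplies the integrand by the sum of the squared gradient of
the phase and the constant d i/T. The eikonal identity replaces the squared gradient by the time
derivative of the phase and x·θ'(t). -/
theorem laplacian_propagator [IsFiniteMeasure m.variation] (hm : ExpMoments m)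
    (hh : Measurable h) (h1 : ∀ α, ‖h α‖ = 1) (hmh : m = m.variation.withDensityᵥ h)
    (ht : t₀ < t) :
    (1 / 2) * (Δ (fun y => propagator m g θ y t x₀ t₀)) x =
      (d * Complex.I / (2 * ((t - t₀ : ℝ) : ℂ)) + cdot (toC x) (deriv θ t)) *
          propagator m g θ x t x₀ t₀ -
        Complex.I * (kernelConst d (t - t₀) * ∫ c, phaseDeriv θ t₀ t x x₀ c *
          (Complex.exp (phase θ t₀ t x x₀ c) * amplitude g h c)
            ∂fock (strip m.variation t₀ t)) := by
  have hT : 0 < t - t₀ := sub_pos.2 ht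
  have hTc : ((t - t₀ : ℝ) : ℂ) ≠ 0 := by exact_mod_cast hT.ne'
  have hμ := integrable_exp_variation hm
  have hE := (hasExpMoments_slopeX θ x₀ (A := amplitude g h) hμ ht (measurable_amplitude hh)
    (norm_amplitude_le h1)).const_mul (kernelConst d (t - t₀))
  have hfun : (fun y => propagator m g θ y t x₀ t₀) =
      gaussLaplace (fock (strip m.variation t₀ t)) (slopeX θ t₀ t)
        (Complex.I / (2 * ((t - t₀ : ℝ) : ℂ))) x₀ (fun c => kernelConst d (t - t₀) *
          (Complex.exp (offsetX θ t₀ t x₀ c) * amplitude g h c)) := by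
    rw [propagator_eq_gaussLaplaceX θ x₀ hm hh h1 hmh ht]
    ext y
    rw [gaussLaplace_const_mul]
  rw [hfun, laplacian_gaussLaplace _ _ hE, propagator_eq θ x x₀ hm hh h1 hmh ht, gaussLaplace,
    laplace, ← integral_const_mul, ← integral_const_mul]
  have hI1 := integrable_phaseDeriv_mul (g := g) θ x x₀ hμ hh h1 ht
  have hI0 := integrable_exp_phase θ x x₀ hμ ht (measurable_amplitude (g := g) hh)
    (norm_amplitude_le h1)
  set k := kernelConst d (t - t₀)
  have hR : (d * Complex.I / (2 * ((t - t₀ : ℝ) : ℂ)) + cdot (toC x) (deriv θ t)) *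
      (k * ∫ c, Complex.exp (phase θ t₀ t x x₀ c) * amplitude g h c
        ∂fock (strip m.variation t₀ t)) - Complex.I * (k * ∫ c, phaseDeriv θ t₀ t x x₀ c *
          (Complex.exp (phase θ t₀ t x x₀ c) * amplitude g h c)
            ∂fock (strip m.variation t₀ t)) =
      ∫ c, ((d * Complex.I / (2 * ((t - t₀ : ℝ) : ℂ)) + cdot (toC x) (deriv θ t)) * k) *
        (Complex.exp (phase θ t₀ t x x₀ c) * amplitude g h c) - (Complex.I * k) *
        (phaseDeriv θ t₀ t x x₀ c *
          (Complex.exp (phase θ t₀ t x x₀ c) * amplitude g h c))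
            ∂fock (strip m.variation t₀ t) := by
    rw [integral_sub (hI0.const_mul _) (hI1.const_mul _), integral_const_mul, integral_const_mul]
    ring
  rw [hR]
  congr 1 with c
  have hsq := phaseDeriv_add_slopeX_sq θ t₀ t x x₀ c ht.ne'
  have hβ : 2 * (Complex.I / (2 * ((t - t₀ : ℝ) : ℂ))) = Complex.I / ((t - t₀ : ℝ) : ℂ) := by
    field_simp
  have hβ2 : 2 * (d : ℂ) * (Complex.I / (2 * ((t - t₀ : ℝ) : ℂ))) =
      2 * (d * Complex.I / (2 * ((t - t₀ : ℝ) : ℂ))) := by ring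
  rw [hβ, hβ2, phase_eq_slopeX, Complex.exp_add, Complex.exp_add, ← hsq]
  ring

/-- The propagator solves the Schrödinger equation. -/
theorem schrodinger_propagator [IsFiniteMeasure m.variation] (hm : ExpMoments m)
    (hh : Measurable h) (h1 : ∀ α, ‖h α‖ = 1) (hmh : m = m.variation.withDensityᵥ h)
    (ht : t₀ < t) :
    DifferentiableAt ℝ (fun s => propagator m g θ x s x₀ t₀) t ∧
      Complex.I * deriv (fun s => propagator m g θ x s x₀ t₀) t
        + (1 / 2) * (Δ (fun y => propagator m g θ y t x₀ t₀)) x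
        - g * potential m x * propagator m g θ x t x₀ t₀
        - cdot (toC x) (deriv θ t) * propagator m g θ x t x₀ t₀ = 0 := by
  have hT : 0 < t - t₀ := sub_pos.2 ht
  have hTc : ((t - t₀ : ℝ) : ℂ) ≠ 0 := by exact_mod_cast hT.ne'
  have hd := (hasDerivAt_kernelConst d ht).mul (hasDerivAt_integral_exp_phase (g := g) θ x x₀
    (integrable_exp_variation hm) hh h1 ht)
  have hd' : HasDerivAt (fun s => propagator m g θ x s x₀ t₀) _ t :=
    hd.congr_of_eventuallyEq (by
      filter_upwards [Ioi_mem_nhds ht] with s hs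
      exact propagator_eq θ x x₀ hm hh h1 hmh hs)
  refine ⟨hd'.differentiableAt, ?_⟩
  rw [hd'.deriv, laplacian_propagator θ x x₀ hm hh h1 hmh ht, potential_eq x hm hh h1 hmh,
    propagator_eq θ x x₀ hm hh h1 hmh ht]
  ring_nf
  rw [Complex.I_sq]
  ring

end Schrodinger

/-! ### Short-time limits of configuration integrals -/

section Delta

variable {d : ℕ}

/-- The oscillatory Gaussian has modulus 1, and y stays in the compact support of φ, so e^{y·b} is
dominated by an exponential moment at the radius of the support. This justifies Fubini below. -/
theorem integrable_gaussLaplace_kernel {Y : Type*} [MeasurableSpace Y] {ρ : Measure Y}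
    [SFinite ρ] {b : Y → CSpace d} {W : Y → ℂ} (hW : HasExpMoments ρ b W) {φ : Space d → ℂ}
    (hφ : Continuous φ) (hc : HasCompactSupport φ) (T : ℝ) (a : Space d) :
    Integrable (fun p : Space d × Y =>
      Complex.exp (Complex.I / (2 * (T : ℂ)) * ((‖p.1 - a‖ ^ 2 : ℝ) : ℂ)) *
        (Complex.exp (cdot (toC p.1) (b p.2)) * φ p.1) * W p.2) (volume.prod ρ) := by
  obtain ⟨R, hR⟩ := hc.isCompact.isBounded.exists_norm_le
  have hφi : Integrable φ := hφ.integrable_of_hasCompactSupport hc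
  refine (hφi.norm.mul_prod (hW.integrable |R|)).mono' ?_ (Eventually.of_forall fun p => ?_)
  · refine Measurable.aestronglyMeasurable ?_
    have h1 : Measurable fun p : Space d × Y => cdot (toC p.1) (b p.2) :=
      continuous_cdot.measurable.comp ((continuous_toC.measurable.comp measurable_fst).prodMk
        (hW.measurable_freq.comp measurable_snd))
    have h2 : Measurable fun y : Space d =>
        Complex.exp (Complex.I / (2 * (T : ℂ)) * ((‖y - a‖ ^ 2 : ℝ) : ℂ)) :=
      Continuous.measurable (by fun_prop)
    exact ((h2.comp measurable_fst).mul (h1.cexp.mul (hφ.measurable.comp measurable_fst))).mul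
      (hW.measurable_weight.comp measurable_snd)
  · have h1 : ‖Complex.exp (Complex.I / (2 * (T : ℂ)) * ((‖p.1 - a‖ ^ 2 : ℝ) : ℂ))‖ = 1 := by
      rw [Complex.norm_exp, I_div_mul_ofReal_re, Real.exp_zero]
    rw [norm_mul, norm_mul, h1, one_mul, norm_mul]
    by_cases hp : p.1 ∈ tsupport φ
    · have h2 : ‖Complex.exp (cdot (toC p.1) (b p.2))‖ ≤ Real.exp (|R| * ‖b p.2‖) :=
        (norm_cexp_cdot_toC_le _ _).trans (Real.exp_le_exp.2
          (mul_le_mul_of_nonneg_right ((hR _ hp).trans (le_abs_self R)) (norm_nonneg _)))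
      calc _ ≤ Real.exp (|R| * ‖b p.2‖) * ‖φ p.1‖ * ‖W p.2‖ := by gcongr
        _ = _ := by ring
    · simp [image_eq_zero_of_notMem_tsupport hp]

/-- Testing a Gaussian times a Laplace transform against a smooth function. -/
theorem integral_gaussLaplace_mul {Y : Type*} [MeasurableSpace Y] {ρ : Measure Y}
    [SFinite ρ] {b : Y → CSpace d} {W : Y → ℂ} (hW : HasExpMoments ρ b W) {φ : Space d → ℂ}
    (hφ : Continuous φ) (hc : HasCompactSupport φ) (T : ℝ) (a : Space d) :
    Integrable (fun c => freeEvolution φ T a (b c) * W c) ρ ∧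
      ∫ y, kernelConst d T * gaussLaplace ρ b (Complex.I / (2 * (T : ℂ))) a W y * φ y =
        ∫ c, freeEvolution φ T a (b c) * W c ∂ρ := by
  have hint := (integrable_gaussLaplace_kernel hW hφ hc T a).const_mul (kernelConst d T)
  have hF : ∀ c, ∫ y, kernelConst d T *
      (Complex.exp (Complex.I / (2 * (T : ℂ)) * ((‖y - a‖ ^ 2 : ℝ) : ℂ)) *
        (Complex.exp (cdot (toC y) (b c)) * φ y) * W c) = freeEvolution φ T a (b c) * W c := by
    intro c
    rw [integral_const_mul, integral_mul_const, freeEvolution, mul_assoc]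
  refine ⟨hint.integral_prod_right.congr (Eventually.of_forall hF), ?_⟩
  simp only [← hF]
  rw [← integral_integral_swap hint]
  congr 1 with y
  rw [gaussLaplace, laplace, integral_const_mul, mul_assoc, mul_assoc, ← integral_mul_const,
    ← integral_const_mul]
  congr 2 with c
  ring

variable {μ : Measure (Space d)} [IsFiniteMeasure μ] {t₀ : ℝ}

theorem weight_of_fst_eq_zero {Y : Type*} (w : Y → ℝ) {c : Config Y} (hc : c.1 = 0) :
    weight w c = 1 := by
  obtain ⟨n, z⟩ := c
  change n = 0 at hc
  subst hc
  simp [weight]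

/-- Over a short time strip only the empty configuration contributes. -/
theorem norm_integral_fock_strip_sub_le
    (hμ : ∀ K : ℝ, Integrable (fun α => Real.exp (K * (1 + ‖α‖))) μ) {t C K : ℝ} (ht : t₀ ≤ t)
    {Ψ : Config (ℝ × Space d) → ℂ} (hm : Integrable Ψ (fock (strip μ t₀ t)))
    (hb : ∀ c ∈ within t₀ t, ‖Ψ c‖ ≤ C * Real.exp (K * size c)) :
    ‖(∫ c, Ψ c ∂fock (strip μ t₀ t)) - Ψ Config.empty‖ ≤
      C * (Real.exp ((t - t₀) * ∫ α, Real.exp (K * (1 + ‖α‖)) ∂μ) - 1) := by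
  set w : ℝ × Space d → ℝ := fun y => Real.exp (K * (1 + ‖y.2‖)) with hw
  have hw0 : ∀ y, 0 ≤ w y := fun y => (Real.exp_pos _).le
  have hwi : Integrable w (strip μ t₀ t) := integrable_strip (hμ K)
  have h0 := integrable_ite_zero (ν := strip μ t₀ t) fun _ => (1 : ℂ)
  have h0r : Integrable (fun c : Config (ℝ × Space d) => if c.1 = 0 then (1 : ℝ) else 0)
      (fock (strip μ t₀ t)) := by
    refine h0.re.congr (Eventually.of_forall fun c => ?_)
    by_cases hc : c.1 = 0 <;> simp [hc]
  have h0i : ∫ c : Config (ℝ × Space d), (if c.1 = 0 then (1 : ℝ) else 0)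
      ∂fock (strip μ t₀ t) = 1 := by
    have h1 := integral_ite_zero (ν := strip μ t₀ t) fun _ => (1 : ℂ)
    have h2 : (fun c : Config (ℝ × Space d) => if c.1 = 0 then (1 : ℂ) else 0) =
        fun c => (((if c.1 = 0 then (1 : ℝ) else 0) : ℝ) : ℂ) := by
      ext c
      by_cases hc : c.1 = 0 <;> simp [hc]
    rw [h2, integral_complex_ofReal] at h1
    exact_mod_cast h1
  rw [← integral_ite_zero (ν := strip μ t₀ t) Ψ, ← integral_sub hm (integrable_ite_zero Ψ)]
  have hW := integrable_weight_real hw0 hwi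
  -- On nonempty configurations the difference is bounded by C times the weight; on the empty one it
  -- vanishes, as does the weight minus 1. The weight has total integral exp((t - t₀) ∫ e^{K(1+|α|)}
  -- dμ), and the empty sector has mass 1.
  calc _ ≤ ∫ c, C * (weight w c - if c.1 = 0 then (1 : ℝ) else 0) ∂fock (strip μ t₀ t) := by
        refine norm_integral_le_of_norm_le ((hW.sub h0r).const_mul C) ?_
        filter_upwards [ae_fock_within] with c hc
        by_cases h : c.1 = 0
        · simp [h, weight_of_fst_eq_zero w h]
        · simp only [h, if_false, sub_zero]
          rw [weight_exp_eq]
          exact hb c hc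
    _ = _ := by
        rw [integral_const_mul, integral_sub hW h0r, integral_weight hw0 hwi, h0i,
          integral_strip (w := fun α => Real.exp (K * (1 + ‖α‖))) ht]

theorem tendsto_integral_fock_strip
    (hμ : ∀ K : ℝ, Integrable (fun α => Real.exp (K * (1 + ‖α‖))) μ) {C K : ℝ} {L : ℂ}
    {Ψ : ℝ → Config (ℝ × Space d) → ℂ}
    (hm : ∀ t, t₀ < t → Integrable (Ψ t) (fock (strip μ t₀ t)))
    (hb : ∀ t, t₀ < t → t - t₀ ≤ 1 → ∀ c ∈ within t₀ t, ‖Ψ t c‖ ≤ C * Real.exp (K * size c))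
    (h0 : Tendsto (fun t => Ψ t Config.empty) (𝓝[>] t₀) (𝓝 L)) :
    Tendsto (fun t => ∫ c, Ψ t c ∂fock (strip μ t₀ t)) (𝓝[>] t₀) (𝓝 L) := by
  have h1 : Tendsto (fun t => (∫ c, Ψ t c ∂fock (strip μ t₀ t)) - Ψ t Config.empty)
      (𝓝[>] t₀) (𝓝 0) := by
    have hcont : Continuous fun t : ℝ =>
        C * (Real.exp ((t - t₀) * ∫ α, Real.exp (K * (1 + ‖α‖)) ∂μ) - 1) := by fun_prop
    have hlim : Tendsto (fun t : ℝ =>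
        C * (Real.exp ((t - t₀) * ∫ α, Real.exp (K * (1 + ‖α‖)) ∂μ) - 1)) (𝓝[>] t₀) (𝓝 0) :=
      (hcont.tendsto' t₀ 0 (by simp)).mono_left nhdsWithin_le_nhds
    refine squeeze_zero_norm' ?_ hlim
    filter_upwards [Ioc_mem_nhdsGT (show t₀ < t₀ + 1 by linarith)] with t ht
    exact norm_integral_fock_strip_sub_le hμ ht.1.le (hm t ht.1)
      (hb t ht.1 (by linarith [ht.2]))
  simpa using h1.add h0

/-- A criterion for convergence to the delta distribution. -/
theorem tendstoDelta_of_gaussLaplace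
    (hμ : ∀ K : ℝ, Integrable (fun α => Real.exp (K * (1 + ‖α‖))) μ) {F : ℝ → Space d → ℂ}
    {a : Space d} {s : ℝ → Config (ℝ × Space d) → CSpace d} {o : ℝ → Config (ℝ × Space d) → ℂ}
    {A : Config (ℝ × Space d) → ℂ} {P Q R : ℝ}
    (hF : ∀ t, t₀ < t → F t = fun y => kernelConst d (t - t₀) *
      gaussLaplace (fock (strip μ t₀ t)) (s t) (Complex.I / (2 * ((t - t₀ : ℝ) : ℂ))) a
        (fun c => Complex.exp (o t c) * A c) y)
    (hE : ∀ t, t₀ < t → HasExpMoments (fock (strip μ t₀ t)) (s t)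
      fun c => Complex.exp (o t c) * A c)
    (hsP : ∀ t, t₀ < t → t - t₀ ≤ 1 → ∀ c ∈ within t₀ t, ‖s t c‖ ≤ P * (1 + size c))
    (hoQ : ∀ t, t₀ < t → t - t₀ ≤ 1 → ∀ c ∈ within t₀ t, (o t c).re ≤ Q * (1 + size c))
    (hAR : ∀ c, ‖A c‖ ≤ Real.exp (R * size c)) (hA : A Config.empty = 1)
    (hs0 : Tendsto (fun t => s t Config.empty) (𝓝[>] t₀) (𝓝 0))
    (ho0 : Tendsto (fun t => o t Config.empty) (𝓝[>] t₀) (𝓝 0)) :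
    TendstoDelta F t₀ a := by
  refine ⟨fun t ht => ?_, fun φ hφ hc => ?_⟩
  · rw [hF t ht]
    exact (continuous_const.mul
      (contDiff_gaussLaplace _ _ (hE t ht) 0).continuous).locallyIntegrable
  obtain ⟨C, hC0, hC⟩ := exists_norm_freeEvolution_le hφ hc
  have hI := fun t ht => integral_gaussLaplace_mul (hE t ht) hφ.continuous hc (t - t₀) a
  have hpos : ∀ᶠ t in 𝓝[>] t₀, t₀ < t := self_mem_nhdsWithin
  have h0 : Tendsto (fun t => t - t₀) (𝓝[>] t₀) (𝓝 0) :=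
    ((continuous_id.sub continuous_const).tendsto' t₀ 0 (by simp)).mono_left nhdsWithin_le_nhds
  -- The uniform bound C e^{C|b|} on the free evolution, with |b| ≤ P(1 + size), is multiplied by
  -- the bounds on offset and amplitude. The constant parts of the exponents go into the prefactor,
  -- the linear parts into K.
  have hlim := tendsto_integral_fock_strip (t₀ := t₀) (L := φ a)
    (C := C * Real.exp (C * P) * Real.exp Q) (K := C * P + Q + R) hμ
    (fun t ht => (hI t ht).1) (fun t ht ht1 c hcw => by
      rw [norm_mul, norm_mul, Complex.norm_exp]
      calc _ ≤ C * Real.exp (C * (P * (1 + size c))) *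
            (Real.exp (Q * (1 + size c)) * Real.exp (R * size c)) := by
            gcongr
            · refine (hC _ (sub_pos.2 ht) a _).trans ?_
              gcongr
              exact hsP t ht ht1 c hcw
            · exact hoQ t ht ht1 c hcw
            · exact hAR c
        _ = _ := by
            rw [mul_assoc C, mul_assoc C, mul_assoc C, ← Real.exp_add, ← Real.exp_add,
              ← Real.exp_add, ← Real.exp_add]
            congr 2
            ring)
    (by
      have h1 := tendsto_freeEvolution hφ hc a (hpos.mono fun t ht => sub_pos.2 ht) h0 hs0
      have h2 : Tendsto (fun t => Complex.exp (o t Config.empty)) (𝓝[>] t₀) (𝓝 1) := by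
        simpa [Function.comp_def] using (Complex.continuous_exp.tendsto _).comp ho0
      simpa [hA] using h1.mul h2)
  refine hlim.congr' ?_
  filter_upwards [hpos] with t ht
  rw [hF t ht]
  exact (hI t ht).2.symm

end Delta

/-! ### The initial condition for the propagator -/

section DeltaPropagator

variable {d : ℕ} (θ : 𝓢(ℝ, CSpace d)) (t₀ : ℝ) (x x₀ : Space d)

/-- The mean of θ over [t₀, t] is the difference quotient of its primitive at t₀. Its limit θ(t₀) is
exactly what the boundary factor e^{i x₀·θ(t₀) - i x·θ(t)} compensates in the slopes and offsets. -/
theorem tendsto_I_div_smul_integral :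
    Tendsto (fun t : ℝ => (Complex.I / ((t - t₀ : ℝ) : ℂ)) • ∫ s in t₀..t, θ s) (𝓝[>] t₀)
      (𝓝 (Complex.I • θ t₀)) := by
  have h1 : HasDerivAt (fun s => ∫ r in t₀..s, θ r) (θ t₀) t₀ :=
    intervalIntegral.integral_hasDerivAt_right (θ.continuous.intervalIntegrable _ _)
      (θ.continuous.stronglyMeasurableAtFilter _ _) θ.continuous.continuousAt
  have h2 := ((hasDerivAt_iff_tendsto_slope.1 h1).mono_left
    (nhdsWithin_mono t₀ fun t (ht : t₀ < t) => ht.ne')).const_smul Complex.I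
  refine h2.congr fun t => ?_
  rw [slope_def_module, intervalIntegral.integral_same, sub_zero, ← Complex.coe_smul, smul_smul]
  push_cast
  rfl

theorem tendsto_apply_nhdsGT : Tendsto (fun t => θ t) (𝓝[>] t₀) (𝓝 (θ t₀)) :=
  θ.continuous.continuousAt.tendsto.mono_left nhdsWithin_le_nhds

theorem shift_empty (t : ℝ) : shift θ t₀ t Config.empty = ∫ s in t₀..t, θ s := by
  have : drift t (Config.empty : Config (ℝ × Space d)) = 0 := by
    change ∑ j : Fin 0, _ = _
    simp
  rw [shift, this, smul_zero, add_zero]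

theorem momentum_empty : momentum (Config.empty : Config (ℝ × Space d)) = 0 := by
  change ∑ j : Fin 0, _ = _
  simp

theorem action_empty (t : ℝ) :
    action θ t₀ t Config.empty = ∫ s in t₀..t, cdot (θ s) (θ s) := by
  have h1 : ∀ f : Fin 0 → ℂ, ∑ j, f j = 0 := fun f => by simp
  rw [action]
  change _ + 2 * Complex.I * (∑ j : Fin 0, _) - (∑ j : Fin 0, _) = _
  simp

theorem tendsto_slopeX_empty :
    Tendsto (fun t => slopeX θ t₀ t Config.empty) (𝓝[>] t₀) (𝓝 0) := by
  simp only [slopeX, shift_empty, momentum_empty, add_zero]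
  simpa using (tendsto_I_div_smul_integral θ t₀).sub
    ((tendsto_apply_nhdsGT θ t₀).const_smul Complex.I)

theorem tendsto_slopeY_empty :
    Tendsto (fun t => slopeY θ t₀ t Config.empty) (𝓝[>] t₀) (𝓝 0) := by
  simp only [slopeY, shift_empty, neg_smul]
  simpa using (tendsto_I_div_smul_integral θ t₀).neg.add_const (Complex.I • θ t₀)

/-- In the squared shift divided by t - t₀, one factor ∫ θ absorbs the denominator and converges,
while the other tends to 0. -/
theorem tendsto_action_shift_empty :
    Tendsto (fun t => -(Complex.I / 2) * action θ t₀ t Config.empty +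
      Complex.I / (2 * ((t - t₀ : ℝ) : ℂ)) *
        cdot (shift θ t₀ t Config.empty) (shift θ t₀ t Config.empty)) (𝓝[>] t₀) (𝓝 0) := by
  have hθθ : Continuous fun s => cdot (θ s) (θ s) :=
    continuous_cdot_comp θ.continuous θ.continuous
  have h1 : Tendsto (fun t => ∫ s in t₀..t, cdot (θ s) (θ s)) (𝓝[>] t₀) (𝓝 0) :=
    ((intervalIntegral.continuous_primitive (fun a b => hθθ.intervalIntegrable a b)
      t₀).tendsto' t₀ 0 (by simp)).mono_left nhdsWithin_le_nhds
  have h2 : Tendsto (fun t => ∫ s in t₀..t, θ s) (𝓝[>] t₀) (𝓝 0) :=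
    ((intervalIntegral.continuous_primitive (fun a b => θ.continuous.intervalIntegrable a b)
      t₀).tendsto' t₀ 0 (by simp)).mono_left nhdsWithin_le_nhds
  have h3 := (continuous_cdot.tendsto (Complex.I • θ t₀, (0 : CSpace d))).comp
    ((tendsto_I_div_smul_integral θ t₀).prodMk_nhds h2)
  have h4 := (h1.const_mul (-(Complex.I / 2))).add (h3.const_mul (1 / 2))
  simp only [cdot_zero_right, mul_zero, add_zero] at h4
  refine h4.congr fun t => ?_
  simp only [Function.comp_apply, cdot_smul_left, action_empty, shift_empty]
  rw [← mul_assoc]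
  congr 2
  ring

theorem tendsto_cdot_I_div_smul_integral :
    Tendsto (fun t : ℝ => Complex.I / ((t - t₀ : ℝ) : ℂ) *
      cdot (toC x) (∫ s in t₀..t, θ s)) (𝓝[>] t₀) (𝓝 (Complex.I * cdot (toC x) (θ t₀))) := by
  have h := ((cdotCLM (toC x)).continuous.tendsto _).comp (tendsto_I_div_smul_integral θ t₀)
  simpa [Function.comp_def, cdot_smul_right] using h

theorem tendsto_offsetX_empty :
    Tendsto (fun t => offsetX θ t₀ t x₀ Config.empty) (𝓝[>] t₀) (𝓝 0) := by
  have h := ((tendsto_action_shift_empty θ t₀).sub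
    (tendsto_cdot_I_div_smul_integral θ t₀ x₀)).add_const (Complex.I * cdot (toC x₀) (θ t₀))
  rw [zero_sub, neg_add_cancel] at h
  refine h.congr fun t => ?_
  rw [offsetX, shift_empty]

theorem tendsto_offsetY_empty :
    Tendsto (fun t => offsetY θ t₀ t x Config.empty) (𝓝[>] t₀) (𝓝 0) := by
  have hθ := (((cdotCLM (toC x)).continuous.tendsto _).comp
    (tendsto_apply_nhdsGT θ t₀)).const_mul Complex.I
  have h := ((tendsto_action_shift_empty θ t₀).add
    (tendsto_cdot_I_div_smul_integral θ t₀ x)).sub hθ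
  rw [zero_add, cdotCLM_apply, sub_self] at h
  refine h.congr fun t => ?_
  simp only [offsetY, shift_empty, momentum_empty, cdot_zero_right, add_zero, Function.comp_apply,
    cdotCLM_apply]

variable {g : ℂ} {h : Space d → ℂ} {m : ComplexMeasure (Space d)}

theorem tendstoDelta_propagator_right [IsFiniteMeasure m.variation] (hm : ExpMoments m)
    (hh : Measurable h) (h1 : ∀ α, ‖h α‖ = 1) (hmh : m = m.variation.withDensityᵥ h) :
    TendstoDelta (fun t x => propagator m g θ x t x₀ t₀) t₀ x₀ := by
  obtain ⟨P, _, hP⟩ := exists_phase_bounds θ t₀ zero_le_one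
  exact tendstoDelta_of_gaussLaplace (integrable_exp_variation hm)
    (fun t ht => propagator_eq_gaussLaplaceX θ x₀ hm hh h1 hmh ht)
    (fun t ht => hasExpMoments_slopeX θ x₀ (integrable_exp_variation hm) ht
      (measurable_amplitude hh) (norm_amplitude_le h1))
    (fun t ht ht1 c hc => (hP t c ht ht1 hc).1)
    (fun t ht ht1 c hc => (hP t c ht ht1 hc).2.2.1 x₀) (norm_amplitude_le h1) amplitude_empty
    (tendsto_slopeX_empty θ t₀) (tendsto_offsetX_empty θ t₀ x₀)

theorem tendstoDelta_propagator_left [IsFiniteMeasure m.variation] (hm : ExpMoments m)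
    (hh : Measurable h) (h1 : ∀ α, ‖h α‖ = 1) (hmh : m = m.variation.withDensityᵥ h) :
    TendstoDelta (fun t x₀ => propagator m g θ x t x₀ t₀) t₀ x := by
  obtain ⟨P, _, hP⟩ := exists_phase_bounds θ t₀ zero_le_one
  exact tendstoDelta_of_gaussLaplace (integrable_exp_variation hm)
    (fun t ht => propagator_eq_gaussLaplaceY θ x hm hh h1 hmh ht)
    (fun t ht => hasExpMoments_slopeY θ x (integrable_exp_variation hm) ht
      (measurable_amplitude hh) (norm_amplitude_le h1))
    (fun t ht ht1 c hc => (hP t c ht ht1 hc).2.1)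
    (fun t ht ht1 c hc => (hP t c ht ht1 hc).2.2.2 x) (norm_amplitude_le h1) amplitude_empty
    (tendsto_slopeY_empty θ t₀) (tendsto_offsetY_empty θ t₀ x)

end DeltaPropagator
end FeynmanPropagator
end

/-! ### Assembly of the three assertions -/

theorem mainTheorem2 {d : ℕ} (hd : 1 ≤ d)
    (m : ComplexMeasure (FeynmanPropagator.Space d)) (hm : FeynmanPropagator.ExpMoments m)
    (g : ℂ) (θ : 𝓢(ℝ, FeynmanPropagator.CSpace d)) (t₀ : ℝ) :
    -- the integrals and the perturbation series defining the propagator converge absolutely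
    (∀ (x x₀ : FeynmanPropagator.Space d) (t : ℝ), t₀ < t →
      (∀ n, FeynmanPropagator.TermIntegrable m θ x t x₀ t₀ n) ∧
        Summable (FeynmanPropagator.term m g θ x t x₀ t₀)) ∧
    -- pointwise Schrödinger equation
    (∀ (x x₀ : FeynmanPropagator.Space d) (t : ℝ), t₀ < t →
      DifferentiableAt ℝ (fun s => FeynmanPropagator.propagator m g θ x s x₀ t₀) t ∧
      ContDiff ℝ 2 (fun y => FeynmanPropagator.propagator m g θ y t x₀ t₀) ∧
      Complex.I * deriv (fun s => FeynmanPropagator.propagator m g θ x s x₀ t₀) t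
        + (1 / 2) * (Δ (fun y => FeynmanPropagator.propagator m g θ y t x₀ t₀)) x
        - g * FeynmanPropagator.potential m x * FeynmanPropagator.propagator m g θ x t x₀ t₀
        - FeynmanPropagator.cdot (FeynmanPropagator.toC x) (deriv θ t)
          * FeynmanPropagator.propagator m g θ x t x₀ t₀ = 0) ∧
    -- initial condition `K → δ(x - x₀)`, as distributions in `x` and as distributions in `x₀`
    (∀ x₀ : FeynmanPropagator.Space d, FeynmanPropagator.TendstoDelta
      (fun t x => FeynmanPropagator.propagator m g θ x t x₀ t₀) t₀ x₀) ∧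
    (∀ x : FeynmanPropagator.Space d, FeynmanPropagator.TendstoDelta
      (fun t x₀ => FeynmanPropagator.propagator m g θ x t x₀ t₀) t₀ x) := by
  have hfin := FeynmanPropagator.isFiniteMeasure_variation hm
  obtain ⟨h, hh, h1, hmh⟩ := FeynmanPropagator.exists_polar_decomposition m
  refine ⟨fun x x₀ t ht => ⟨fun n => ?_, ?_⟩, fun x x₀ t ht => ?_, fun x₀ => ?_, fun x => ?_⟩
  · rw [FeynmanPropagator.TermIntegrable, FeynmanPropagator.variation_productMeasure]
    exact FeynmanPropagator.integrable_integrand θ x x₀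
      (FeynmanPropagator.integrable_exp_variation hm) ht n
  · exact (FeynmanPropagator.hasSum_term θ x x₀ hm hh h1 hmh ht).summable
  · obtain ⟨hd, hS⟩ := FeynmanPropagator.schrodinger_propagator θ x x₀ hm hh h1 hmh ht
    exact ⟨hd, FeynmanPropagator.contDiff_propagator θ x₀ hm hh h1 hmh ht, hS⟩
  · exact FeynmanPropagator.tendstoDelta_propagator_right θ t₀ x₀ hm hh h1 hmh
  · exact FeynmanPropagator.tendstoDelta_propagator_left θ t₀ x hm hh h1 hmh
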